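/- Let $\ell_1,\ell_2>0$ and $D\in\mathbb R\setminus\{0\}$. Consider the planar rectangular lattice graph with vertices $(n\ell_1,m\ell_2)$, $n,m\in\mathbb Z$, and edges of length $\ell_1$ (horizontal) and $\ell_2$ (vertical). The $\delta'_s$ lattice Hamiltonian with parameter $D$ is the operator $\psi\mapsto-\psi''$ in the direct sum of the $L^2$ spaces of all edges, whose domain consists of the $\psi$ that are $H^2$ on each edge, with $\psi,\psi''$ in the direct sum, and satisfy at each vertex the following condition: the four outward derivatives at the vertex have a common value $f'$, and the four boundary values $f_1,\dots,f_4$ satisfy $\sum_{j=1}^4 f_j=Df'$. Put $L=\max(\ell_1,\ell_2)$, $\theta=\ell_2/\ell_1$, $$g(\theta)=\frac{2\theta+1+\sqrt{1+4\theta}}{2(\theta+1)},\qquad e(\theta)=\max\{g(\theta),g(\theta^{-1})\}.$$ Then the (real) spectrum of this Hamiltonian is $\bigcup_{r=1}^\infty[\alpha_r,\beta_r]$ with $\alpha_r<\beta_r<\alpha_{r+1}$ for all $r$, and the band widths satisfy $$\frac{8}{|D|L}+O(r^{-1})<\beta_r-\alpha_r<\frac{8}{|D|}\left(\ell_1^{-1}+\ell_2^{-1}\right)e(\theta)+O(r^{-1}),$$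 where the constants in $O(r^{-1})$ may depend on $\ell_1,\ell_2,D$. Moreover $e(\theta)\le\frac43$, with equality if and only if $\theta=2$ or $\theta=\frac12$; and if $\theta=2$ or $\theta=\frac12$, then the upper bound holds with $1$ in place of $e(\theta)$. -/

import Mathlib

open MeasureTheory Set
open scoped ENNReal

/-- Vertices of the planar rectangular lattice: `v` stands for the point
`(v 0 * ℓ 0, v 1 * ℓ 1)` of the plane. -/
abbrev LatticeVertex : Type := Fin 2 → ℤ

/-- Edges of the lattice: `(v, j)` is the edge which joins `v` to its neighbour in the positive
`j`-th coordinate direction. Its length is `ℓ j`, and it is parametrised by `[0, ℓ j]`, with the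
parameter `0` at `v`. -/
abbrev LatticeEdge : Type := LatticeVertex × Fin 2

/-- `L²` of a single edge. -/
abbrev EdgeL2 (ℓ : Fin 2 → ℝ) (e : LatticeEdge) : Type :=
  Lp ℂ 2 (volume.restrict (Ioo (0 : ℝ) (ℓ e.2)))

/-- The state space: the Hilbert direct sum of the spaces `L²(0, ℓ j)` over all edges. -/
abbrev LatticeL2 (ℓ : Fin 2 → ℝ) : Type := lp (EdgeL2 ℓ) 2

/-- `u` is the `C¹` representative on `[0, a]` of an `H²` function `f` with first derivative `du`
and second derivative `g ∈ L²(0, a)`: `u` is differentiable on `[0, a]` with derivative `du`, and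
`du` is absolutely continuous with density `g`. -/
structure IsH2Representative (a : ℝ) (f g : Lp ℂ 2 (volume.restrict (Ioo (0 : ℝ) a)))
    (u du : ℝ → ℂ) : Prop where
  ae_eq : f =ᵐ[volume.restrict (Ioo (0 : ℝ) a)] u
  hasDeriv : ∀ x ∈ Icc (0 : ℝ) a, HasDerivWithinAt u (du x) (Icc 0 a) x
  deriv_eq : ∀ x ∈ Icc (0 : ℝ) a, du x = du 0 + ∫ t in (0 : ℝ)..x, g t

/-- The `δ'_s` coupling with parameter `D` at the vertex `v`, for the edge functions `u` with
derivatives `du`. Four edges meet at `v`: for each `j`, the edge `(v, j)` starts there and the edge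
`(v - e_j, j)` ends there. All four outward derivatives have a common value `G`, and the sum of the
four boundary values is `D * G`. -/
def DeltaPrimeSCoupling (ℓ : Fin 2 → ℝ) (D : ℝ) (u du : LatticeEdge → ℝ → ℂ)
    (v : LatticeVertex) : Prop :=
  ∃ G : ℂ,
    (∀ j : Fin 2, du (v, j) 0 = G ∧ -du (v - Pi.single j 1, j) (ℓ j) = G) ∧
    ∑ j : Fin 2, (u (v, j) 0 + u (v - Pi.single j 1, j) (ℓ j)) = (D : ℂ) * G

/-- The graph of the `δ'_s` lattice Hamiltonian, i.e. the set of all pairs `(ψ, -ψ'')` with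
`ψ` and `ψ''` in the state space, where `ψ` is `H²` on each edge and satisfies the `δ'_s` coupling
at each vertex. -/
def deltaPrimeSGraph (ℓ : Fin 2 → ℝ) (D : ℝ) : Submodule ℂ (LatticeL2 ℓ × LatticeL2 ℓ) where
  carrier := {p | ∃ u du : LatticeEdge → ℝ → ℂ,
    (∀ e, IsH2Representative (ℓ e.2) (p.1 e) (-(p.2 e)) (u e) (du e)) ∧
    ∀ v, DeltaPrimeSCoupling ℓ D u du v}
  zero_mem' := by
    refine ⟨0, 0, fun e => ⟨?_, ?_, ?_⟩, fun v => ⟨0, ?_, ?_⟩⟩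
    · exact Lp.coeFn_zero _ _ _
    · intro x _
      exact hasDerivWithinAt_const x _ (0 : ℂ)
    · intro x hx
      have h0 : ∀ᵐ t, t ∈ Ioo (0 : ℝ) (ℓ e.2) →
          (-((0 : LatticeL2 ℓ × LatticeL2 ℓ).2 e) : EdgeL2 ℓ e) t = 0 := by
        have : (-((0 : LatticeL2 ℓ × LatticeL2 ℓ).2 e) : EdgeL2 ℓ e) = 0 := by simp
        rw [this]
        exact (ae_restrict_iff' measurableSet_Ioo).1 (Lp.coeFn_zero _ _ _)
      have h1 : ∫ t in (0 : ℝ)..x,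
          (-((0 : LatticeL2 ℓ × LatticeL2 ℓ).2 e) : EdgeL2 ℓ e) t = 0 := by
        rw [intervalIntegral.integral_of_le hx.1, integral_Ioc_eq_integral_Ioo]
        refine integral_eq_zero_of_ae ?_
        refine (ae_restrict_iff' measurableSet_Ioo).2 ?_
        filter_upwards [h0] with t ht htx
        exact ht ⟨htx.1, htx.2.trans_le hx.2⟩
      rw [h1]; simp
    · intro j; simp
    · simp
  add_mem' := by
    rintro ⟨ψ, φ⟩ ⟨ψ', φ'⟩ ⟨u, du, h, hv⟩ ⟨u', du', h', hv'⟩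
    refine ⟨u + u', du + du', fun e => ⟨?_, ?_, ?_⟩, fun v => ?_⟩
    · filter_upwards [Lp.coeFn_add (ψ e) (ψ' e), (h e).ae_eq, (h' e).ae_eq] with x h1 h2 h3
      change (ψ e + ψ' e : EdgeL2 ℓ e) x = u e x + u' e x
      rw [h1, Pi.add_apply, h2, h3]
    · intro x hx
      exact ((h e).hasDeriv x hx).add ((h' e).hasDeriv x hx)
    · intro x hx
      have hint : ∀ g : EdgeL2 ℓ e, IntervalIntegrable g volume 0 x := by
        intro g
        rw [intervalIntegrable_iff_integrableOn_Ioo_of_le hx.1]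
        have hg : IntegrableOn g (Ioo 0 (ℓ e.2)) := (Lp.memLp g).integrable (by norm_num)
        exact hg.mono_set (Ioo_subset_Ioo_right hx.2)
      have hsum : ∫ t in (0 : ℝ)..x, (-(φ e + φ' e) : EdgeL2 ℓ e) t =
          (∫ t in (0 : ℝ)..x, (-(φ e) : EdgeL2 ℓ e) t) +
            ∫ t in (0 : ℝ)..x, (-(φ' e) : EdgeL2 ℓ e) t := by
        rw [← intervalIntegral.integral_add (hint _) (hint _), neg_add]
        rw [intervalIntegral.integral_of_le hx.1, intervalIntegral.integral_of_le hx.1,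
          integral_Ioc_eq_integral_Ioo, integral_Ioc_eq_integral_Ioo]
        exact integral_congr_ae (ae_restrict_of_ae_restrict_of_subset
          (Ioo_subset_Ioo_right hx.2) (Lp.coeFn_add (-(φ e)) (-(φ' e))))
      have e1 := (h e).deriv_eq x hx
      have e2 := (h' e).deriv_eq x hx
      change du e x + du' e x = du e 0 + du' e 0 + ∫ t in (0 : ℝ)..x,
        (-(φ e + φ' e) : EdgeL2 ℓ e) t
      rw [hsum, e1, e2]
      ring
    · obtain ⟨G, h1, h2⟩ := hv v
      obtain ⟨G', h1', h2'⟩ := hv' v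
      refine ⟨G + G', fun j => ⟨?_, ?_⟩, ?_⟩
      · simp only [Pi.add_apply, (h1 j).1, (h1' j).1]
      · simp only [Pi.add_apply, neg_add, (h1 j).2, (h1' j).2]
      · rw [mul_add, ← h2, ← h2', ← Finset.sum_add_distrib]
        refine Finset.sum_congr rfl fun j _ => ?_
        simp only [Pi.add_apply]
        ring
  smul_mem' := by
    rintro c ⟨ψ, φ⟩ ⟨u, du, h, hv⟩
    refine ⟨c • u, c • du, fun e => ⟨?_, ?_, ?_⟩, fun v => ?_⟩
    · filter_upwards [Lp.coeFn_smul c (ψ e), (h e).ae_eq] with x h1 h2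
      change (c • ψ e : EdgeL2 ℓ e) x = c • u e x
      rw [h1, Pi.smul_apply, h2]
    · intro x hx
      exact ((h e).hasDeriv x hx).const_smul c
    · intro x hx
      have hsum : ∫ t in (0 : ℝ)..x, (-(c • φ e) : EdgeL2 ℓ e) t =
          c • ∫ t in (0 : ℝ)..x, (-(φ e) : EdgeL2 ℓ e) t := by
        rw [← intervalIntegral.integral_smul, ← smul_neg]
        rw [intervalIntegral.integral_of_le hx.1, intervalIntegral.integral_of_le hx.1,
          integral_Ioc_eq_integral_Ioo, integral_Ioc_eq_integral_Ioo]
        exact integral_congr_ae (ae_restrict_of_ae_restrict_of_subset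
          (Ioo_subset_Ioo_right hx.2) (Lp.coeFn_smul c (-(φ e))))
      have e1 := (h e).deriv_eq x hx
      change c • du e x = c • du e 0 + ∫ t in (0 : ℝ)..x, (-(c • φ e) : EdgeL2 ℓ e) t
      rw [hsum, e1, smul_add]
    · obtain ⟨G, h1, h2⟩ := hv v
      refine ⟨c * G, fun j => ⟨?_, ?_⟩, ?_⟩
      · simp only [Pi.smul_apply, smul_eq_mul, (h1 j).1]
      · simp only [Pi.smul_apply, smul_eq_mul, ← (h1 j).2, mul_neg]
      · rw [mul_left_comm, ← h2, Finset.mul_sum]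
        refine Finset.sum_congr rfl fun j _ => ?_
        simp only [Pi.smul_apply, smul_eq_mul]
        ring

/-- The second derivative is determined by the function. -/
theorem IsH2Representative.eq_zero {a : ℝ} {g : Lp ℂ 2 (volume.restrict (Ioo (0 : ℝ) a))}
    {u du : ℝ → ℂ} (h : IsH2Representative a 0 g u du) : g = 0 := by
  rcases le_or_gt a 0 with ha | ha
  · rw [Lp.eq_zero_iff_ae_eq_zero]
    refine (ae_restrict_iff' measurableSet_Ioo).2 (Filter.Eventually.of_forall fun x hx => ?_)
    exact absurd (hx.1.trans hx.2) (not_lt.2 ha)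
  have hgi : IntegrableOn g (Ioo 0 a) := (Lp.memLp g).integrable (by norm_num)
  have hcont : ContinuousOn u (Icc 0 a) := fun x hx => (h.hasDeriv x hx).continuousWithinAt
  have hu : EqOn u 0 (Ioo 0 a) := by
    refine MeasureTheory.Measure.eqOn_open_of_ae_eq (μ := volume) ?_ isOpen_Ioo
      (hcont.mono Ioo_subset_Icc_self) continuousOn_const
    filter_upwards [h.ae_eq, Lp.coeFn_zero ℂ 2 (volume.restrict (Ioo (0 : ℝ) a))] with x h1 h2
    rw [← h1, h2]
  have hdu : ∀ x ∈ Ioo 0 a, du x = 0 := by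
    intro x hx
    have h1 : HasDerivAt u (du x) x :=
      (h.hasDeriv x (Ioo_subset_Icc_self hx)).hasDerivAt (Icc_mem_nhds hx.1 hx.2)
    have h2 : u =ᶠ[nhds x] fun _ => 0 := by
      filter_upwards [Ioo_mem_nhds hx.1 hx.2] with y hy using hu hy
    exact h1.unique ((hasDerivAt_const x (0 : ℂ)).congr_of_eventuallyEq h2)
  have hii : IntervalIntegrable g volume 0 a :=
    (intervalIntegrable_iff_integrableOn_Ioo_of_le ha.le).2 hgi
  rw [Lp.eq_zero_iff_ae_eq_zero]
  refine (ae_restrict_iff' measurableSet_Ioo).2 ?_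
  filter_upwards [hii.ae_hasDerivAt_integral] with x hx hxa
  have hx' := hx (by rw [uIcc_of_le ha.le]; exact Ioo_subset_Icc_self hxa) 0 (by simp)
  have h2 : (fun y => ∫ t in (0 : ℝ)..y, g t) =ᶠ[nhds x] fun _ => -du 0 := by
    filter_upwards [Ioo_mem_nhds hxa.1 hxa.2] with y hy
    have := h.deriv_eq y (Ioo_subset_Icc_self hy)
    rw [hdu y hy] at this
    exact eq_neg_of_add_eq_zero_right this.symm
  exact hx'.unique ((hasDerivAt_const x (-du 0)).congr_of_eventuallyEq h2)

/-- The `δ'_s` lattice Hamiltonian `ψ ↦ -ψ''`, as an unbounded operator in the state space. -/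
noncomputable def deltaPrimeSHamiltonian (ℓ : Fin 2 → ℝ) (D : ℝ) :
    LatticeL2 ℓ →ₗ.[ℂ] LatticeL2 ℓ :=
  (deltaPrimeSGraph ℓ D).toLinearPMap

/-- The Hamiltonian is well defined: its graph is the one described above. -/
theorem deltaPrimeSHamiltonian_graph (ℓ : Fin 2 → ℝ) (D : ℝ) :
    (deltaPrimeSHamiltonian ℓ D).graph = deltaPrimeSGraph ℓ D := by
  refine Submodule.toLinearPMap_graph_eq _ ?_
  rintro ⟨ψ, φ⟩ ⟨u, du, h, -⟩ (rfl : ψ = 0)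
  change φ = 0
  ext1
  funext e
  have h0 : (-(φ e) : EdgeL2 ℓ e) = 0 := (h e).eq_zero
  simpa using h0

/-- The resolvent set of an unbounded operator `T`: those `z` for which `T - z` is a bijection of
the domain of `T` onto the whole space with a bounded inverse `R`. -/
def unboundedResolventSet {H : Type*} [NormedAddCommGroup H] [NormedSpace ℂ H]
    (T : H →ₗ.[ℂ] H) : Set ℂ :=
  {z | ∃ R : H →L[ℂ] H,
    (∀ φ : H, ∃ h : R φ ∈ T.domain, T ⟨R φ, h⟩ - z • R φ = φ) ∧
    ∀ ψ : T.domain, R (T ψ - z • (ψ : H)) = ψ}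

/-- The (real) spectrum of the `δ'_s` lattice Hamiltonian with spacings `ℓ 0`, `ℓ 1` and coupling
parameter `D`. -/
def deltaPrimeSSpectrum (ℓ : Fin 2 → ℝ) (D : ℝ) : Set ℝ :=
  {E | (E : ℂ) ∉ unboundedResolventSet (deltaPrimeSHamiltonian ℓ D)}

/-- `S` is the union of the infinitely many bands `[α r, β r]`, which are non-degenerate, are
separated by gaps and are numbered upwards; the band numbered `r : ℕ` is the `(r + 1)`-st one. -/
structure IsBandStructure (S : Set ℝ) (α β : ℕ → ℝ) : Prop where
  eq_iUnion : S = ⋃ r, Icc (α r) (β r)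
  band : ∀ r, α r < β r
  gap : ∀ r, β r < α (r + 1)

/-- `g(θ) = (2θ + 1 + √(1 + 4θ)) / (2(θ + 1))`. -/
noncomputable def conspiracyG (θ : ℝ) : ℝ :=
  (2 * θ + 1 + Real.sqrt (1 + 4 * θ)) / (2 * (θ + 1))

/-- `e(θ) = max {g(θ), g(θ⁻¹)}`. -/
noncomputable def conspiracyE (θ : ℝ) : ℝ := max (conspiracyG θ) (conspiracyG θ⁻¹)

/-! Unless some sin(kℓ_j) vanishes, a solution of -ψ'' = Eψ on an edge is determined by its two
outward end derivatives, hence by the common derivatives G(v) at the vertices. The coupling then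
becomes a difference equation on ℤ² with symbol Σ_j (2C(ℓ_j) + 2 cos φ_j)/(E S(ℓ_j)) - D, where C, S
are the cosine- and sine-like solutions. E is in the spectrum iff this symbol has a zero
(`mem_deltaPrimeSSpectrum_iff`): without a zero the vertex operator is diagonally dominant and
invertible, with a zero damped plane waves are approximate eigenvectors.

Write E = q² with q of the sign of D. The condition becomes qD/2 ≤ Σ_j h(qℓ_j), where h(x) =
cot(x/2) on (0, π], continued with period π (`sq_mem_deltaPrimeSSpectrum_iff`). On each period h
falls from +∞ to 0. Hence each point q = nπ/ℓ_j, called an anchor below, has spectrum directly to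
its right, over a length of about 4/(|D|ℓ_j|q|) in q and 8/(|D|ℓ_j) in energy. This is the lower
bound (`sq_mem_right_of_anchor`, `exists_anchor_width`).

Convexity of cot joins every positive point of the spectrum to an anchor inside the spectrum
(`joined_to_anchor`). The negative spectrum, if there is any, is an interval with lowest point e₀,
which serves as one more anchor (`exists_ground_anchor`). Anchors are discrete and gaps occur at
arbitrarily high energies, so the components of the spectrum can be numbered upwards
(`exists_isBandStructure`).

The upper bound rests on h(x) ≤ 2/x (`band_width_aux`). With κ = |D|k/2, a = 2/A, b = 2/B for the
two lengths A, B in either order, a band containing no second anchor in its interior satisfies κ ·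
width ≤ a + b. Two close anchors may cooperate; this leads to a quadratic inequality whose larger
root is (a + b) g(B/A). For θ = 2 or 1/2 distinct anchors keep a fixed distance, so at high energy
the cooperation is impossible and the factor drops to 1.

Distinct bands contain distinct anchors, and the anchors up to k number O(k). Hence k grows at least
linearly in r, errors O(1/k) become O(1/r), and the finitely many low bands are absorbed into the
constant. -/

/-! ### Resolvent sets of unbounded operators -/

section Resolvent

variable {H : Type*} [NormedAddCommGroup H] [NormedSpace ℂ H]

/-- Injectivity makes the chosen solutions unique, hence the choice is linear in the right-hand
side; the estimate makes it bounded. -/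
theorem mem_unboundedResolventSet_of_bound {T : H →ₗ.[ℂ] H} {z : ℂ} {K : ℝ}
    (hs : ∀ φ : H, ∃ ψ : T.domain, T ψ - z • (ψ : H) = φ ∧ ‖(ψ : H)‖ ≤ K * ‖φ‖)
    (hi : ∀ ψ : T.domain, T ψ - z • (ψ : H) = 0 → ψ = 0) :
    z ∈ unboundedResolventSet T := by
  choose f hf hfK using hs
  have huniq : ∀ ψ ψ' : T.domain, T ψ - z • (ψ : H) = T ψ' - z • (ψ' : H) → ψ = ψ' := by
    intro ψ ψ' h
    refine sub_eq_zero.1 (hi (ψ - ψ') ?_)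
    rw [T.map_sub, Submodule.coe_sub, smul_sub]
    rw [← sub_eq_zero] at h
    rw [← h]
    abel
  let R : H →ₗ[ℂ] H :=
    { toFun := fun φ => f φ
      map_add' := by
        intro x y
        have : f (x + y) = f x + f y := by
          apply huniq
          rw [hf, T.map_add, Submodule.coe_add, smul_add]
          nth_rw 1 [← hf x, ← hf y]
          abel
        rw [this, Submodule.coe_add]
      map_smul' := by
        intro c x
        have : f (c • x) = c • f x := by
          apply huniq
          rw [hf, T.map_smul, Submodule.coe_smul, smul_comm z c, ← smul_sub, hf]
        rw [this, Submodule.coe_smul, RingHom.id_apply] }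
  refine ⟨R.mkContinuous K hfK, fun φ => ⟨(f φ).2, hf φ⟩, fun ψ => ?_⟩
  exact congrArg Subtype.val (huniq _ ψ (hf _))

theorem notMem_unboundedResolventSet_of_approx {T : H →ₗ.[ℂ] H} {z : ℂ}
    (h : ∀ ε : ℝ, 0 < ε → ∃ ψ : T.domain, (ψ : H) ≠ 0 ∧ ‖T ψ - z • (ψ : H)‖ ≤ ε * ‖(ψ : H)‖) :
    z ∉ unboundedResolventSet T := by
  rintro ⟨R, -, hR⟩
  obtain ⟨ψ, h0, hψ⟩ := h (‖R‖ + 1)⁻¹ (by positivity)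
  have h1 : ‖(ψ : H)‖ ≤ ‖R‖ * ((‖R‖ + 1)⁻¹ * ‖(ψ : H)‖) := by
    calc ‖(ψ : H)‖ = ‖R (T ψ - z • (ψ : H))‖ := by rw [hR]
      _ ≤ ‖R‖ * ‖T ψ - z • (ψ : H)‖ := R.le_opNorm _
      _ ≤ _ := by gcongr
  have h2 : 0 < ‖(ψ : H)‖ := norm_pos_iff.2 h0
  have h3 : ‖R‖ * (‖R‖ + 1)⁻¹ < 1 := by
    rw [← div_eq_mul_inv, div_lt_one (by positivity)]
    linarith
  nlinarith

/-- Neumann series: R(1 - (w - z)R)⁻¹ inverts T - w for w near z. The resulting closedness of the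
spectrum is what reaches the energies at which a sine vanishes, where the vertex equation is
singular. -/
theorem isOpen_unboundedResolventSet [CompleteSpace H] (T : H →ₗ.[ℂ] H) :
    IsOpen (unboundedResolventSet T) := by
  rw [Metric.isOpen_iff]
  rintro z ⟨R, h1, h2⟩
  refine ⟨(‖R‖ + 1)⁻¹, by positivity, fun w hw => ?_⟩
  rw [Metric.mem_ball, dist_eq_norm] at hw
  have hn : ‖(w - z) • R‖ < 1 := by
    rw [norm_smul]
    calc ‖w - z‖ * ‖R‖ ≤ (‖R‖ + 1)⁻¹ * ‖R‖ := by gcongr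
      _ < 1 := by
        rw [inv_mul_eq_div, div_lt_one (by positivity)]
        linarith
  obtain ⟨U, hU⟩ := isUnit_one_sub_of_norm_lt_one hn
  have hUapp : ∀ x, (U : H →L[ℂ] H) x = x - (w - z) • R x := fun x => by rw [hU]; rfl
  have hUV : ∀ x, (U : H →L[ℂ] H) ((U⁻¹ : (H →L[ℂ] H)ˣ).1 x) = x := fun x => by
    rw [← mul_apply_eq_comp, Units.mul_inv]; rfl
  have hVU : ∀ x, (U⁻¹ : (H →L[ℂ] H)ˣ).1 ((U : H →L[ℂ] H) x) = x := fun x => by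
    rw [← mul_apply_eq_comp]
    have := U.inv_mul
    exact congrArg (fun A : H →L[ℂ] H => A x) this
  refine ⟨R.comp (U⁻¹ : (H →L[ℂ] H)ˣ).1, fun φ => ?_, fun ψ => ?_⟩
  · obtain ⟨hd, he⟩ := h1 ((U⁻¹ : (H →L[ℂ] H)ˣ).1 φ)
    refine ⟨hd, ?_⟩
    have h3 := hUV φ
    rw [hUapp] at h3
    rw [sub_eq_iff_eq_add] at he
    refine Eq.trans ?_ h3
    change T ⟨R ((U⁻¹ : (H →L[ℂ] H)ˣ).1 φ), hd⟩ - w • R ((U⁻¹ : (H →L[ℂ] H)ˣ).1 φ) = _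
    rw [he, sub_smul]
    abel
  · have h3 := h2 ψ
    have h4 : T ψ - w • (ψ : H) = (U : H →L[ℂ] H) (T ψ - z • (ψ : H)) := by
      rw [hUapp, h3, sub_smul]
      abel
    rw [h4, ContinuousLinearMap.comp_apply, hVU, h3]

end Resolvent

/-! ### Square summable families and difference operators on the lattice -/

section SquareSummable

variable {ι : Type*} {E : ι → Type*} [∀ i, NormedAddCommGroup (E i)]

theorem memℓp_two_of_sq_le {f : ∀ i, E i} {a : ι → ℝ} (ha : Summable a)
    (h : ∀ i, ‖f i‖ ^ 2 ≤ a i) : Memℓp f 2 := by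
  refine memℓp_gen (Summable.of_nonneg_of_le (fun i => by positivity) (fun i => ?_) ha)
  simpa using h i

theorem lp_two_hasSum_sq (f : lp E 2) : HasSum (fun i => ‖f i‖ ^ 2) (‖f‖ ^ 2) := by
  simpa using lp.hasSum_norm (p := 2) (by simp) f

end SquareSummable

/-- The space of square summable functions on the vertices. -/
abbrev VertexL2 : Type := lp (fun _ : LatticeVertex => ℂ) 2

/-- Translation of square summable functions on the vertices. -/
noncomputable def vertexShift (w : LatticeVertex) : VertexL2 →L[ℂ] VertexL2 :=
  LinearMap.mkContinuous
    { toFun := fun G => ⟨fun v => G (v + w), memℓp_two_of_sq_le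
        (((Equiv.addRight w).summable_iff).2 (lp_two_hasSum_sq G).summable) fun v => le_rfl⟩
      map_add' := fun G G' => by ext v; rfl
      map_smul' := fun c G => by ext v; rfl } 1 fun G => by
    rw [one_mul]
    refine le_of_eq ((sq_eq_sq₀ (norm_nonneg _) (norm_nonneg _)).1 ?_)
    exact (lp_two_hasSum_sq _).unique
      (((Equiv.addRight w).hasSum_iff).2 (lp_two_hasSum_sq G))

theorem norm_vertexShift_le (w : LatticeVertex) : ‖vertexShift w‖ ≤ 1 :=
  LinearMap.mkContinuous_norm_le _ zero_le_one _

/-- The difference operator on the vertices with diagonal coefficient `c` and the coefficient `t j`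
for both neighbours in the `j`-th direction. -/
noncomputable def vertexOperator (c : ℝ) (t : Fin 2 → ℝ) : VertexL2 →L[ℂ] VertexL2 :=
  (c : ℂ) • 1 + ∑ j, (t j : ℂ) • (vertexShift (Pi.single j 1) + vertexShift (-Pi.single j 1))

theorem vertexOperator_apply (c : ℝ) (t : Fin 2 → ℝ) (G : VertexL2) (v : LatticeVertex) :
    vertexOperator c t G v =
      c * G v + ∑ j, (t j : ℂ) * (G (v + Pi.single j 1) + G (v - Pi.single j 1)) := by
  simp only [vertexOperator, Fin.sum_univ_two, sub_eq_add_neg]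
  rfl

/-- Diagonal dominance: the operator is c times a perturbation of the identity of norm less than 1.
-/
theorem isUnit_vertexOperator {c : ℝ} {t : Fin 2 → ℝ} (h : ∑ j, 2 * |t j| < |c|) :
    IsUnit (vertexOperator c t) := by
  have hc : 0 < |c| := lt_of_le_of_lt (Finset.sum_nonneg fun j _ => by positivity) h
  have hc0 : (c : ℂ) ≠ 0 := by
    have := abs_pos.1 hc
    exact_mod_cast this
  set N : VertexL2 →L[ℂ] VertexL2 :=
    ∑ j, (t j : ℂ) • (vertexShift (Pi.single j 1) + vertexShift (-Pi.single j 1)) with hN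
  have hNn : ‖N‖ ≤ ∑ j, 2 * |t j| := by
    refine (norm_sum_le _ _).trans (Finset.sum_le_sum fun j _ => ?_)
    rw [norm_smul, Complex.norm_real, Real.norm_eq_abs, mul_comm]
    gcongr
    refine (norm_add_le _ _).trans ?_
    linarith [norm_vertexShift_le (Pi.single j 1), norm_vertexShift_le (-Pi.single j 1)]
  have h1 : ‖-((c : ℂ)⁻¹ • N)‖ < 1 := by
    rw [norm_neg, norm_smul, norm_inv, Complex.norm_real, Real.norm_eq_abs, inv_mul_eq_div,
      div_lt_one hc]
    exact hNn.trans_lt h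
  have h2 : vertexOperator c t = (c : ℂ) • (1 - -((c : ℂ)⁻¹ • N)) := by
    rw [sub_neg_eq_add, smul_add, smul_smul, mul_inv_cancel₀ hc0, one_smul]
    rfl
  rw [h2]
  exact (isUnit_one_sub_of_norm_lt_one h1).smul (Units.mk0 _ hc0)

/-! ### The differential equation on a single edge -/

/-- `C` and `S` solve `-y'' = E y` with initial data `(1, 0)` and `(0, 1)`. -/
structure IsFundamentalSystem (E : ℝ) (C S : ℝ → ℝ) : Prop where
  C_zero : C 0 = 1
  S_zero : S 0 = 0
  hasDerivAt_C : ∀ x, HasDerivAt C (-(E * S x)) x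
  hasDerivAt_S : ∀ x, HasDerivAt S (C x) x

namespace IsFundamentalSystem

variable {E : ℝ} {C S : ℝ → ℝ}

theorem continuous_C (h : IsFundamentalSystem E C S) : Continuous C :=
  continuous_iff_continuousAt.2 fun x => (h.hasDerivAt_C x).continuousAt

theorem continuous_S (h : IsFundamentalSystem E C S) : Continuous S :=
  continuous_iff_continuousAt.2 fun x => (h.hasDerivAt_S x).continuousAt

theorem sq_add (h : IsFundamentalSystem E C S) (x : ℝ) : C x ^ 2 + E * S x ^ 2 = 1 := by
  have hd : ∀ x, HasDerivAt (fun x => C x ^ 2 + E * S x ^ 2) 0 x := by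
    intro x
    convert! ((h.hasDerivAt_C x).pow 2).add (((h.hasDerivAt_S x).pow 2).const_mul E) using 1
    simp
    ring
  have := is_const_of_deriv_eq_zero (fun x => (hd x).differentiableAt) (fun x => (hd x).deriv) x 0
  simpa [h.C_zero, h.S_zero] using this

theorem sq_add_complex (h : IsFundamentalSystem E C S) (x : ℝ) :
    (C x : ℂ) ^ 2 + E * (S x : ℂ) ^ 2 = 1 := by
  exact_mod_cast h.sq_add x

theorem hasDerivAt_C_complex (h : IsFundamentalSystem E C S) (x : ℝ) :
    HasDerivAt (fun x => (C x : ℂ)) (-(E * S x : ℂ)) x := by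
  simpa using (h.hasDerivAt_C x).ofReal_comp

theorem hasDerivAt_S_complex (h : IsFundamentalSystem E C S) (x : ℝ) :
    HasDerivAt (fun x => (S x : ℂ)) (C x : ℂ) x :=
  (h.hasDerivAt_S x).ofReal_comp

theorem exists_bound (h : IsFundamentalSystem E C S) (a : ℝ) :
    ∃ B : ℝ, 0 ≤ B ∧ ∀ x ∈ Icc 0 a, ‖(C x : ℂ)‖ ≤ B ∧ ‖(S x : ℂ)‖ ≤ B := by
  obtain ⟨B₁, h₁⟩ := isCompact_Icc.exists_bound_of_continuousOn
    (s := Icc 0 a) (f := fun x => (C x : ℂ)) (Complex.continuous_ofReal.comp h.continuous_C).continuousOn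
  obtain ⟨B₂, h₂⟩ := isCompact_Icc.exists_bound_of_continuousOn
    (s := Icc 0 a) (f := fun x => (S x : ℂ)) (Complex.continuous_ofReal.comp h.continuous_S).continuousOn
  refine ⟨max 0 (max B₁ B₂), le_max_left _ _, fun x hx => ⟨?_, ?_⟩⟩
  · exact (h₁ x hx).trans ((le_max_left _ _).trans (le_max_right _ _))
  · exact (h₂ x hx).trans ((le_max_right _ _).trans (le_max_right _ _))

end IsFundamentalSystem

/-- `L²(0, a)`. -/
abbrev IntervalL2 (a : ℝ) : Type := Lp ℂ 2 (volume.restrict (Ioo (0 : ℝ) a))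

theorem integrableOn_intervalL2 {a : ℝ} (φ : IntervalL2 a) : IntegrableOn φ (Ioo 0 a) :=
  (Lp.memLp φ).integrable (by norm_num)

theorem integral_norm_intervalL2_le (a : ℝ) :
    ∃ K : ℝ, 0 ≤ K ∧ ∀ φ : IntervalL2 a, ∫ x in Ioo 0 a, ‖φ x‖ ≤ K * ‖φ‖ := by
  refine ⟨((volume.restrict (Ioo 0 a)) univ ^ (1 / (1 : ℝ≥0∞).toReal - 1 / (2 : ℝ≥0∞).toReal)).toReal,
    ENNReal.toReal_nonneg, fun φ => ?_⟩
  rw [integral_norm_eq_lintegral_enorm (Lp.aestronglyMeasurable φ), ← eLpNorm_one_eq_lintegral_enorm,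
    Lp.norm_def, mul_comm, ← ENNReal.toReal_mul]
  refine ENNReal.toReal_mono ?_
    (eLpNorm_le_eLpNorm_mul_rpow_measure_univ (by norm_num) (Lp.aestronglyMeasurable φ))
  refine ENNReal.mul_ne_top (Lp.eLpNorm_ne_top φ) ?_
  refine ENNReal.rpow_ne_top_of_nonneg (by norm_num) ?_
  simp

theorem memLp_of_continuous {a : ℝ} {u : ℝ → ℂ} (hu : Continuous u) :
    MemLp u 2 (volume.restrict (Ioo (0 : ℝ) a)) := by
  obtain ⟨B, hB⟩ := isCompact_Icc.exists_bound_of_continuousOn (s := Icc 0 a) hu.continuousOn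
  refine MemLp.of_bound hu.aestronglyMeasurable B ?_
  exact (ae_restrict_iff' measurableSet_Ioo).2
    (Filter.Eventually.of_forall fun x hx => hB x (Ioo_subset_Icc_self hx))

theorem norm_intervalL2_le {a : ℝ} {φ : IntervalL2 a} {u : ℝ → ℂ} {B : ℝ} (hB : 0 ≤ B)
    (hu : φ =ᵐ[volume.restrict (Ioo (0 : ℝ) a)] u) (h : ∀ x ∈ Icc 0 a, ‖u x‖ ≤ B) :
    ‖φ‖ ≤ (measureUnivNNReal (volume.restrict (Ioo (0 : ℝ) a)) : ℝ) ^ ((2 : ℝ≥0∞).toReal⁻¹) * B := by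
  refine Lp.norm_le_of_ae_bound hB ?_
  filter_upwards [hu, (ae_restrict_iff' measurableSet_Ioo).2 (Filter.Eventually.of_forall
    fun x (hx : x ∈ Ioo 0 a) => h x (Ioo_subset_Icc_self hx))] with x h1 h2
  rwa [h1]

theorem isH2Representative_of {a : ℝ} {u du g : ℝ → ℂ} {ψ φ : IntervalL2 a}
    (hψ : ψ =ᵐ[volume.restrict (Ioo (0 : ℝ) a)] u)
    (hφ : φ =ᵐ[volume.restrict (Ioo (0 : ℝ) a)] g)
    (hu : ∀ x, HasDerivAt u (du x) x)
    (hdu : ∀ x ∈ Icc 0 a, du x = du 0 + ∫ t in (0 : ℝ)..x, g t) :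
    IsH2Representative a ψ φ u du := by
  refine ⟨hψ, fun x _ => (hu x).hasDerivWithinAt, fun x hx => ?_⟩
  rw [hdu x hx, intervalIntegral.integral_of_le hx.1, intervalIntegral.integral_of_le hx.1,
    integral_Ioc_eq_integral_Ioo, integral_Ioc_eq_integral_Ioo]
  congr 1
  exact integral_congr_ae (ae_restrict_of_ae_restrict_of_subset
    (Ioo_subset_Ioo_right hx.2) hφ.symm)

theorem hasDerivAt_primitive {f : ℝ → ℂ} (hf : Continuous f) (x : ℝ) :
    HasDerivAt (fun x => ∫ t in (0 : ℝ)..x, f t) (f x) x :=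
  intervalIntegral.integral_hasDerivAt_right (hf.intervalIntegrable _ _)
    (hf.stronglyMeasurableAtFilter _ _) hf.continuousAt

/-- Variation of constants, integrated by parts once. As φ is only L², the formula uses its
continuous primitive Φ, so that u is differentiable at every point. Its derivative is z - Φ, where z
is differentiable with z' = -E u. -/
theorem exists_particular_solution {E : ℝ} {C S : ℝ → ℝ} (h : IsFundamentalSystem E C S)
    {a : ℝ} (ha : 0 < a) :
    ∃ K : ℝ, 0 ≤ K ∧ ∀ φ : IntervalL2 a, ∃ u du : ℝ → ℂ,
      (∀ x, HasDerivAt u (du x) x) ∧ u 0 = 0 ∧ du 0 = 0 ∧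
      (∀ x ∈ Icc 0 a, du x = ∫ t in (0 : ℝ)..x, -((Ioo 0 a).indicator φ t + E * u t)) ∧
      ∀ x ∈ Icc 0 a, ‖u x‖ ≤ K * ‖φ‖ ∧ ‖du x‖ ≤ K * ‖φ‖ := by
  obtain ⟨K₁, hK₁, hφK⟩ := integral_norm_intervalL2_le a
  obtain ⟨B, hB0, hB⟩ := h.exists_bound a
  refine ⟨B * (B * K₁ * a) + |E| * (B * (B * K₁ * a)) + (|E| * (B * (B * K₁ * a) + B * (B * K₁ * a)) + K₁),
    by positivity, fun φ => ?_⟩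
  set f : ℝ → ℂ := (Ioo 0 a).indicator φ with hf
  have hfi : Integrable f := (integrable_indicator_iff measurableSet_Ioo).2 (integrableOn_intervalL2 φ)
  set Φ : ℝ → ℂ := fun x => ∫ t in (0 : ℝ)..x, f t with hΦ
  have hΦc : Continuous Φ := intervalIntegral.continuous_primitive (fun a b => hfi.intervalIntegrable) 0
  have hC : Continuous fun x => (C x : ℂ) := Complex.continuous_ofReal.comp h.continuous_C
  have hS : Continuous fun x => (S x : ℂ) := Complex.continuous_ofReal.comp h.continuous_S
  set J : ℝ → ℂ := fun x => ∫ t in (0 : ℝ)..x, C t * Φ t with hJ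
  set I : ℝ → ℂ := fun x => ∫ t in (0 : ℝ)..x, S t * Φ t with hI
  have hJd : ∀ x, HasDerivAt J (C x * Φ x) x := hasDerivAt_primitive (hC.mul hΦc)
  have hId : ∀ x, HasDerivAt I (S x * Φ x) x := hasDerivAt_primitive (hS.mul hΦc)
  have hJ0 : J 0 = 0 := by simp [hJ]
  have hI0 : I 0 = 0 := by simp [hI]
  have hΦ0 : Φ 0 = 0 := by simp [hΦ]
  set u : ℝ → ℂ := fun x => -(C x * J x + E * (S x * I x)) with hu
  set z : ℝ → ℂ := fun x => E * (S x * J x - C x * I x) with hz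
  have hud : ∀ x, HasDerivAt u (z x - Φ x) x := by
    intro x
    convert! (((h.hasDerivAt_C_complex x).mul (hJd x)).add
      (((h.hasDerivAt_S_complex x).mul (hId x)).const_mul (E : ℂ))).neg using 1
    simp only [hz]
    linear_combination (-Φ x) * (h.sq_add_complex x).symm
  have hzd : ∀ x, HasDerivAt z (-(E * u x)) x := by
    intro x
    convert! (((h.hasDerivAt_S_complex x).mul (hJd x)).sub
      ((h.hasDerivAt_C_complex x).mul (hId x))).const_mul (E : ℂ) using 1
    simp only [hu]
    ring
  have huc : Continuous u := continuous_iff_continuousAt.2 fun x => (hud x).continuousAt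
  have hEu : Continuous fun t => -((E : ℂ) * u t) := (continuous_const.mul huc).neg
  have hz0 : z 0 = 0 := by simp [hz, hJ0, hI0]
  have hΦb : ∀ x ∈ Icc 0 a, ‖Φ x‖ ≤ K₁ * ‖φ‖ := by
    intro x hx
    refine le_trans ?_ (hφK φ)
    simp only [hΦ]
    refine (intervalIntegral.norm_integral_le_integral_norm hx.1).trans ?_
    rw [intervalIntegral.integral_of_le hx.1, ← integral_indicator measurableSet_Ioo,
      ← integral_indicator measurableSet_Ioc]
    refine integral_mono (hfi.norm.indicator measurableSet_Ioc)
      ((integrable_indicator_iff measurableSet_Ioo).2 (integrableOn_intervalL2 φ).norm) fun t => ?_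
    simp only [hf, indicator]
    split_ifs <;> simp
  have hJb : ∀ x ∈ Icc 0 a, ‖J x‖ ≤ B * K₁ * a * ‖φ‖ := by
    intro x hx
    have := intervalIntegral.norm_integral_le_of_norm_le_const (a := 0) (b := x)
      (f := fun t => C t * Φ t) (C := B * (K₁ * ‖φ‖)) (fun t ht => by
        rw [uIoc_of_le hx.1] at ht
        have ht' : t ∈ Icc 0 a := ⟨ht.1.le, ht.2.trans hx.2⟩
        rw [norm_mul]
        exact mul_le_mul (hB t ht').1 (hΦb t ht') (norm_nonneg _) hB0)
    refine this.trans ?_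
    rw [sub_zero, abs_of_nonneg hx.1]
    calc B * (K₁ * ‖φ‖) * x ≤ B * (K₁ * ‖φ‖) * a := by gcongr; exact hx.2
      _ = _ := by ring
  have hIb : ∀ x ∈ Icc 0 a, ‖I x‖ ≤ B * K₁ * a * ‖φ‖ := by
    intro x hx
    have := intervalIntegral.norm_integral_le_of_norm_le_const (a := 0) (b := x)
      (f := fun t => S t * Φ t) (C := B * (K₁ * ‖φ‖)) (fun t ht => by
        rw [uIoc_of_le hx.1] at ht
        have ht' : t ∈ Icc 0 a := ⟨ht.1.le, ht.2.trans hx.2⟩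
        rw [norm_mul]
        exact mul_le_mul (hB t ht').2 (hΦb t ht') (norm_nonneg _) hB0)
    refine this.trans ?_
    rw [sub_zero, abs_of_nonneg hx.1]
    calc B * (K₁ * ‖φ‖) * x ≤ B * (K₁ * ‖φ‖) * a := by gcongr; exact hx.2
      _ = _ := by ring
  have hE : ‖(E : ℂ)‖ = |E| := by rw [Complex.norm_real, Real.norm_eq_abs]
  refine ⟨u, fun x => z x - Φ x, hud, by simp [hu, hJ0, hI0], by simp [hz0, hΦ0], ?_, ?_⟩
  · intro x hx
    have h1 : z x = ∫ t in (0 : ℝ)..x, -(E * u t) := by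
      rw [intervalIntegral.integral_eq_sub_of_hasDerivAt (fun t _ => hzd t)
        (hEu.intervalIntegrable _ _), hz0, sub_zero]
    have h2 : ∀ t, -(f t + E * u t) = -(E * u t) - f t := fun t => by ring
    simp only [h2]
    rw [intervalIntegral.integral_sub (hEu.intervalIntegrable _ _)
      hfi.intervalIntegrable, ← h1]
  · intro x hx
    have h1 : ∀ p q : ℂ, ‖p‖ ≤ B → ‖q‖ ≤ B * K₁ * a * ‖φ‖ → ‖p * q‖ ≤ B * (B * K₁ * a * ‖φ‖) := by
      intro p q hp hq
      rw [norm_mul]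
      exact mul_le_mul hp hq (norm_nonneg _) hB0
    have hub : ‖u x‖ ≤ B * (B * K₁ * a * ‖φ‖) + |E| * (B * (B * K₁ * a * ‖φ‖)) := by
      simp only [hu, norm_neg]
      refine (norm_add_le _ _).trans (add_le_add (h1 _ _ (hB x hx).1 (hJb x hx)) ?_)
      rw [norm_mul, hE]
      exact mul_le_mul_of_nonneg_left (h1 _ _ (hB x hx).2 (hIb x hx)) (abs_nonneg _)
    have hzb : ‖z x - Φ x‖ ≤
        |E| * (B * (B * K₁ * a * ‖φ‖) + B * (B * K₁ * a * ‖φ‖)) + K₁ * ‖φ‖ := by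
      refine (norm_sub_le _ _).trans (add_le_add ?_ (hΦb x hx))
      simp only [hz]
      rw [norm_mul, hE]
      refine mul_le_mul_of_nonneg_left ?_ (abs_nonneg _)
      exact (norm_sub_le _ _).trans (add_le_add (h1 _ _ (hB x hx).2 (hJb x hx))
        (h1 _ _ (hB x hx).1 (hIb x hx)))
    have p1 : 0 ≤ B * (B * K₁ * a * ‖φ‖) + |E| * (B * (B * K₁ * a * ‖φ‖)) := by positivity
    have p2 : 0 ≤ |E| * (B * (B * K₁ * a * ‖φ‖) + B * (B * K₁ * a * ‖φ‖)) + K₁ * ‖φ‖ := by positivity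
    constructor <;> linarith

/-- The solution is v + C·A + S·g₀ with v the particular solution; the derivative at a fixes A
because E S(a) ≠ 0. The numbers b₀, b₁ are chosen before g₀, g₁: the boundary values are affine in
the end derivatives, and φ enters them only through b₀, b₁. -/
theorem exists_edge_solution {E : ℝ} {C S : ℝ → ℝ} (h : IsFundamentalSystem E C S)
    {a : ℝ} (ha : 0 < a) (hs : E * S a ≠ 0) :
    ∃ K : ℝ, 0 ≤ K ∧ ∀ φ : IntervalL2 a, ∃ b₀ b₁ : ℂ, ‖b₀‖ ≤ K * ‖φ‖ ∧ ‖b₁‖ ≤ K * ‖φ‖ ∧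
      ∀ g₀ g₁ : ℂ, ∃ (ψ : IntervalL2 a) (u du : ℝ → ℂ),
        IsH2Representative a ψ (-(φ + (E : ℂ) • ψ)) u du ∧ du 0 = g₀ ∧ -du a = g₁ ∧
        u 0 = (g₁ + C a * g₀) / (E * S a : ℝ) + b₀ ∧
        u a = (g₀ + C a * g₁) / (E * S a : ℝ) + b₁ ∧
        ‖ψ‖ ≤ K * (‖φ‖ + ‖g₀‖ + ‖g₁‖) := by
  obtain ⟨K₁, hK₁, hpart⟩ := exists_particular_solution h ha
  obtain ⟨B, hB0, hB⟩ := h.exists_bound a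
  set s : ℝ := E * S a with hsdef
  have hsC : (s : ℂ) ≠ 0 := by exact_mod_cast hs
  have hsn : ‖(s : ℂ)‖ = |s| := by rw [Complex.norm_real, Real.norm_eq_abs]
  have hspos : 0 < |s| := abs_pos.2 hs
  set m : ℝ := (measureUnivNNReal (volume.restrict (Ioo (0 : ℝ) a)) : ℝ) ^ ((2 : ℝ≥0∞).toReal⁻¹)
    with hm
  have hm0 : 0 ≤ m := by positivity
  set K₂ : ℝ := (1 + B) * (1 + K₁) / |s| with hK₂
  have hK₂0 : 0 ≤ K₂ := by positivity
  set K₃ : ℝ := K₁ + K₂ * B + B with hK₃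
  have hK₃0 : 0 ≤ K₃ := by positivity
  refine ⟨K₁ + K₂ + m * K₃, by positivity, fun φ => ?_⟩
  obtain ⟨v, dv, hv, hv0, hdv0, hdv, hvb⟩ := hpart φ
  have haI : a ∈ Icc 0 a := ⟨ha.le, le_rfl⟩
  have hsp := h.sq_add_complex a
  have hsC' : (s : ℂ) = E * S a := by rw [hsdef]; push_cast; ring
  have hdiv : ∀ p q : ℂ, ∀ N : ℝ, 0 ≤ N → ‖p‖ ≤ (1 + B) * ((1 + K₁) * N) → ‖p / (s : ℂ)‖ ≤ K₂ * N := by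
    intro p q N hN hp
    rw [norm_div, hsn, hK₂, div_mul_eq_mul_div, div_le_div_iff_of_pos_right hspos]
    linarith
  have hφ0 := norm_nonneg φ
  have hb0 : ‖dv a / (s : ℂ)‖ ≤ K₂ * ‖φ‖ := by
    refine hdiv _ 0 _ hφ0 ((hvb a haI).2.trans ?_)
    nlinarith [mul_nonneg hB0 hφ0, mul_nonneg hB0 (mul_nonneg hK₁ hφ0)]
  have hb1 : ‖C a * dv a / (s : ℂ)‖ ≤ K₂ * ‖φ‖ := by
    refine hdiv _ 0 _ hφ0 ?_
    rw [norm_mul]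
    have := mul_le_mul (hB a haI).1 (hvb a haI).2 (norm_nonneg _) hB0
    nlinarith [mul_nonneg hB0 hφ0, mul_nonneg hK₁ hφ0]
  have hmK : 0 ≤ m * K₃ * ‖φ‖ := by positivity
  refine ⟨dv a / s, v a + C a * dv a / s, ?_, ?_, fun g₀ g₁ => ?_⟩
  · nlinarith [mul_nonneg hK₁ hφ0]
  · refine (norm_add_le _ _).trans ?_
    have := (hvb a haI).1
    nlinarith
  set A : ℂ := (g₁ + C a * g₀ + dv a) / s with hA
  set u : ℝ → ℂ := fun x => v x + (C x * A + S x * g₀) with hu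
  set du : ℝ → ℂ := fun x => dv x + (-(E * S x) * A + C x * g₀) with hdu
  have hud : ∀ x, HasDerivAt u (du x) x := fun x =>
    (hv x).add (((h.hasDerivAt_C_complex x).mul_const A).add
      ((h.hasDerivAt_S_complex x).mul_const g₀))
  have huc : Continuous u := continuous_iff_continuousAt.2 fun x => (hud x).continuousAt
  have hvc : Continuous v := continuous_iff_continuousAt.2 fun x => (hv x).continuousAt
  set ψ : IntervalL2 a := (memLp_of_continuous huc).toLp u with hψ
  have hψu : ψ =ᵐ[volume.restrict (Ioo (0 : ℝ) a)] u := MemLp.coeFn_toLp _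
  have hfi : Integrable ((Ioo 0 a).indicator φ) :=
    (integrable_indicator_iff measurableSet_Ioo).2 (integrableOn_intervalL2 φ)
  refine ⟨ψ, u, du, isH2Representative_of
    (g := fun t => -((Ioo 0 a).indicator φ t + E * u t)) hψu ?_ hud ?_, ?_, ?_, ?_, ?_, ?_⟩
  · filter_upwards [Lp.coeFn_neg (φ + (E : ℂ) • ψ), Lp.coeFn_add φ ((E : ℂ) • ψ),
      Lp.coeFn_smul (E : ℂ) ψ, hψu, ae_restrict_mem measurableSet_Ioo] with x h1 h2 h3 h4 h5
    rw [h1, Pi.neg_apply, h2, Pi.add_apply, h3, Pi.smul_apply, h4, smul_eq_mul,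
      indicator_of_mem h5]
  · intro x hx
    set w : ℝ → ℂ := fun x => C x * A + S x * g₀ with hw
    have hwc : Continuous w := by
      have hC : Continuous fun x => (C x : ℂ) := Complex.continuous_ofReal.comp h.continuous_C
      have hS : Continuous fun x => (S x : ℂ) := Complex.continuous_ofReal.comp h.continuous_S
      fun_prop
    have hdw : ∀ x, HasDerivAt (fun x => -((E : ℂ) * S x) * A + C x * g₀) (-(E * w x)) x := by
      intro x
      convert! ((((h.hasDerivAt_S_complex x).const_mul (E : ℂ)).neg).mul_const A).add
        ((h.hasDerivAt_C_complex x).mul_const g₀) using 1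
      simp only [hw]
      ring
    have hEw : Continuous fun t => -((E : ℂ) * w t) := (continuous_const.mul hwc).neg
    have hEv : Continuous fun t => ((E : ℂ) * v t) := continuous_const.mul hvc
    have h1 := intervalIntegral.integral_eq_sub_of_hasDerivAt (fun t (_ : t ∈ uIcc 0 x) => hdw t)
      (hEw.intervalIntegrable _ _)
    have h2 : ∀ t, -((Ioo 0 a).indicator φ t + E * u t) =
        -((Ioo 0 a).indicator φ t + E * v t) + -(E * w t) := fun t => by
      simp only [hu, hw]; ring
    simp only [h2]
    rw [intervalIntegral.integral_add _ (hEw.intervalIntegrable _ _), ← hdv x hx, h1]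
    · simp only [hdu, hdv0]
      ring
    · exact (hfi.intervalIntegrable.add (hEv.intervalIntegrable _ _)).neg
  · simp [hdu, hdv0, h.C_zero, h.S_zero]
  · simp only [hdu]
    rw [← hsC', hA]
    field_simp
    ring
  · simp only [hu, hv0, hA, h.C_zero, h.S_zero, Complex.ofReal_one, Complex.ofReal_zero]
    field_simp
    ring
  · simp only [hu, hA]
    field_simp
    rw [hsC']
    linear_combination g₀ * hsp
  · have hAn : ‖A‖ ≤ K₂ * (‖φ‖ + ‖g₀‖ + ‖g₁‖) := by
      refine hdiv _ 0 _ (by positivity) ?_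
      refine (norm_add_le _ _).trans ((add_le_add (norm_add_le _ _) le_rfl).trans ?_)
      rw [norm_mul]
      have e1 := mul_le_mul_of_nonneg_right (hB a haI).1 (norm_nonneg g₀)
      have e2 := (hvb a haI).2
      have e3 := norm_nonneg g₀
      have e4 := norm_nonneg g₁
      nlinarith [mul_nonneg hB0 e3, mul_nonneg hB0 e4, mul_nonneg hK₁ e3, mul_nonneg hK₁ e4,
        mul_nonneg hB0 hφ0, mul_nonneg (mul_nonneg hB0 hK₁) hφ0,
        mul_nonneg (mul_nonneg hB0 hK₁) e3, mul_nonneg (mul_nonneg hB0 hK₁) e4]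
    have hub : ∀ x ∈ Icc 0 a, ‖u x‖ ≤ K₃ * (‖φ‖ + ‖g₀‖ + ‖g₁‖) := by
      intro x hx
      have e1 := norm_add_le (v x) (C x * A + S x * g₀)
      have e2 := norm_add_le ((C x : ℂ) * A) (S x * g₀)
      rw [norm_mul, norm_mul] at e2
      have e3 := mul_le_mul (hB x hx).1 hAn (norm_nonneg _) hB0
      have e4 := mul_le_mul_of_nonneg_right (hB x hx).2 (norm_nonneg g₀)
      have e5 := (hvb x hx).1
      have e6 := norm_nonneg g₀
      have e7 := norm_nonneg g₁
      rw [hK₃]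
      nlinarith [mul_nonneg hB0 e7, mul_nonneg hB0 hφ0, mul_nonneg hK₁ e6, mul_nonneg hK₁ e7]
    have := norm_intervalL2_le (by positivity) hψu hub
    rw [← hm] at this
    refine this.trans ?_
    have e8 : 0 ≤ (K₁ + K₂) * (‖φ‖ + ‖g₀‖ + ‖g₁‖) := by positivity
    nlinarith

/-- The cubic Hermite polynomial with value `1` at `0`. -/
theorem exists_hermite {a : ℝ} (ha : 0 < a) :
    ∃ p dp ddp : ℝ → ℂ, Continuous ddp ∧ (∀ x, HasDerivAt p (dp x) x) ∧
      (∀ x, HasDerivAt dp (ddp x) x) ∧ p 0 = 1 ∧ dp 0 = 0 ∧ p a = 0 ∧ dp a = 0 := by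
  have haC : (a : ℂ) ≠ 0 := by exact_mod_cast ha.ne'
  have hx : ∀ x : ℝ, HasDerivAt (fun x : ℝ => (x / a : ℂ)) (1 / a) x := fun x =>
    (Complex.ofRealCLM.hasDerivAt (x := x)).div_const (a : ℂ)
  refine ⟨fun x => 1 - 3 * (x / a) ^ 2 + 2 * (x / a) ^ 3,
    fun x => (-6 * (x / a) + 6 * (x / a) ^ 2) / a, fun x => (-6 + 12 * (x / a)) / a ^ 2,
    by fun_prop, fun x => ?_, fun x => ?_, by simp, by simp, ?_, ?_⟩
  · refine (((((hx x).pow 2).const_mul 3).const_sub 1).add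
      (((hx x).pow 3).const_mul 2)).congr_deriv ?_
    norm_num
    field_simp
    ring
  · refine ((((hx x).const_mul (-6)).add (((hx x).pow 2).const_mul 6)).div_const
      (a : ℂ)).congr_deriv ?_
    norm_num
    field_simp
    ring
  · simp only [div_self haC]; norm_num
  · simp only [div_self haC]; norm_num

/-- Lagrange's identity for u and the Hermite polynomial p, whose boundary data at 0 and a vanish
except p(0) = 1: integrating (E p + p'')u over the edge leaves exactly u'(0) = B. So the end
derivative is controlled by the norm of u alone. -/
theorem exists_trace_bound {E : ℝ} {C S : ℝ → ℝ} (h : IsFundamentalSystem E C S)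
    {a : ℝ} (ha : 0 < a) :
    ∃ K : ℝ, 0 ≤ K ∧ ∀ (ψ : IntervalL2 a) (A B : ℂ),
      ψ =ᵐ[volume.restrict (Ioo (0 : ℝ) a)] (fun x => C x * A + S x * B) → ‖B‖ ≤ K * ‖ψ‖ := by
  obtain ⟨K₁, hK₁, hφK⟩ := integral_norm_intervalL2_le a
  obtain ⟨p, dp, ddp, hddp, hpd, hdpd, hp0, hdp0, hpa, hdpa⟩ := exists_hermite ha
  have hqc : Continuous fun x => E * p x + ddp x :=
    (continuous_const.mul (continuous_iff_continuousAt.2 fun x => (hpd x).continuousAt)).add hddp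
  obtain ⟨Q, hQ⟩ := isCompact_Icc.exists_bound_of_continuousOn (s := Icc 0 a) hqc.continuousOn
  refine ⟨max Q 0 * K₁, by positivity, fun ψ A B hψ => ?_⟩
  set u : ℝ → ℂ := fun x => C x * A + S x * B with hu
  have hC : Continuous fun x => (C x : ℂ) := Complex.continuous_ofReal.comp h.continuous_C
  have hS : Continuous fun x => (S x : ℂ) := Complex.continuous_ofReal.comp h.continuous_S
  have huc : Continuous u := by fun_prop
  have hF : ∀ x, HasDerivAt (fun x => (C x * B - E * S x * A) * p x - u x * dp x)
      (-((E * p x + ddp x) * u x)) x := by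
    intro x
    convert! ((((h.hasDerivAt_C_complex x).mul_const B).sub
      (((h.hasDerivAt_S_complex x).const_mul (E : ℂ)).mul_const A)).mul (hpd x)).sub
      ((((h.hasDerivAt_C_complex x).mul_const A).add
        ((h.hasDerivAt_S_complex x).mul_const B)).mul (hdpd x)) using 1
    simp only [hu, Pi.add_apply, Pi.sub_apply]
    ring
  have h1 := intervalIntegral.integral_eq_sub_of_hasDerivAt (fun t (_ : t ∈ uIcc 0 a) => hF t)
    ((hqc.mul huc).neg.intervalIntegrable _ _)
  have h2 : ∫ t in (0 : ℝ)..a, (E * p t + ddp t) * u t = B := by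
    rw [intervalIntegral.integral_neg] at h1
    rw [eq_comm, ← neg_inj, h1]
    simp [hp0, hdp0, hpa, hdpa, h.C_zero, h.S_zero]
  rw [← h2, intervalIntegral.integral_of_le ha.le, integral_Ioc_eq_integral_Ioo]
  have h3 : ∫ t in Ioo 0 a, (E * p t + ddp t) * u t = ∫ t in Ioo 0 a, (E * p t + ddp t) * ψ t :=
    integral_congr_ae (by filter_upwards [hψ] with x hx; rw [hx])
  rw [h3]
  calc ‖∫ t in Ioo 0 a, (E * p t + ddp t) * ψ t‖ ≤ ∫ t in Ioo 0 a, max Q 0 * ‖ψ t‖ := by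
        refine norm_integral_le_of_norm_le ((integrableOn_intervalL2 ψ).norm.const_mul _) ?_
        filter_upwards [ae_restrict_mem measurableSet_Ioo] with t ht
        rw [norm_mul]
        gcongr
        exact (hQ t (Ioo_subset_Icc_self ht)).trans (le_max_left _ _)
    _ = max Q 0 * ∫ t in Ioo 0 a, ‖ψ t‖ := integral_const_mul _ _
    _ ≤ max Q 0 * (K₁ * ‖ψ‖) := by gcongr; exact hφK ψ
    _ = _ := by ring

/-- The combinations u C - u' S and u' C + E u S are constant, and C² + E S² = 1 allows solving them
for u and u'. -/
theorem exists_edge_kernel {E : ℝ} {C S : ℝ → ℝ} (h : IsFundamentalSystem E C S)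
    {a : ℝ} (ha : 0 < a) {ψ : IntervalL2 a} {u du : ℝ → ℂ}
    (hψ : IsH2Representative a ψ (-((E : ℂ) • ψ)) u du) :
    (∀ x ∈ Icc 0 a, u x = C x * u 0 + S x * du 0) ∧
      ∀ x ∈ Icc 0 a, du x = C x * du 0 - E * S x * u 0 := by
  have hucI : ContinuousOn u (Icc 0 a) := fun x hx => (hψ.hasDeriv x hx).continuousWithinAt
  -- Only u on [0, a] is under control; a continuous extension to ℝ makes the fundamental theorem of
  -- calculus applicable up to the ends.
  set w : ℝ → ℂ := IccExtend ha.le ((Icc 0 a).domRestrict u) with hw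
  have hwc : Continuous w := hucI.domRestrict.Icc_extend'
  have hwu : ∀ x ∈ Icc 0 a, w x = u x := fun x hx => by
    rw [hw, IccExtend_of_mem _ _ hx]; rfl
  have hEw : Continuous fun t => -((E : ℂ) * w t) := (continuous_const.mul hwc).neg
  have hae : (-((E : ℂ) • ψ) : IntervalL2 a) =ᵐ[volume.restrict (Ioo (0 : ℝ) a)]
      fun t => -((E : ℂ) * w t) := by
    filter_upwards [Lp.coeFn_neg ((E : ℂ) • ψ), Lp.coeFn_smul (E : ℂ) ψ, hψ.ae_eq,
      ae_restrict_mem measurableSet_Ioo] with x h1 h2 h3 h4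
    rw [h1, Pi.neg_apply, h2, Pi.smul_apply, h3, smul_eq_mul, hwu x (Ioo_subset_Icc_self h4)]
  have hdu : ∀ x ∈ Icc 0 a, du x = du 0 + ∫ t in (0 : ℝ)..x, -((E : ℂ) * w t) := by
    intro x hx
    rw [hψ.deriv_eq x hx, intervalIntegral.integral_of_le hx.1,
      intervalIntegral.integral_of_le hx.1, integral_Ioc_eq_integral_Ioo,
      integral_Ioc_eq_integral_Ioo]
    congr 1
    exact integral_congr_ae (ae_restrict_of_ae_restrict_of_subset (Ioo_subset_Ioo_right hx.2) hae)
  have hdud : ∀ x ∈ Icc 0 a, HasDerivWithinAt du (-(E * u x)) (Icc 0 a) x := by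
    intro x hx
    rw [← hwu x hx]
    exact ((hasDerivAt_primitive hEw x).const_add (du 0)).hasDerivWithinAt.congr_of_mem hdu hx
  have hconst : ∀ f : ℝ → ℂ, (∀ x ∈ Icc 0 a, HasDerivWithinAt f 0 (Icc 0 a) x) →
      ∀ x ∈ Icc 0 a, f x = f 0 := by
    intro f hf
    refine constant_of_derivWithin_zero (fun x hx => (hf x hx).differentiableWithinAt)
      fun x hx => ?_
    exact (hf x (Ico_subset_Icc_self hx)).derivWithin
      (uniqueDiffOn_Icc ha x (Ico_subset_Icc_self hx))
  have h1 := hconst (fun x => u x * C x - du x * S x) fun x hx => by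
    refine (((hψ.hasDeriv x hx).mul (h.hasDerivAt_C_complex x).hasDerivWithinAt).sub
      ((hdud x hx).mul (h.hasDerivAt_S_complex x).hasDerivWithinAt)).congr_deriv ?_
    ring
  have h2 := hconst (fun x => du x * C x + E * (u x * S x)) fun x hx => by
    refine (((hdud x hx).mul (h.hasDerivAt_C_complex x).hasDerivWithinAt).add
      (((hψ.hasDeriv x hx).mul (h.hasDerivAt_S_complex x).hasDerivWithinAt).const_mul
        (E : ℂ))).congr_deriv ?_
    ring
  simp only [h.C_zero, h.S_zero, Complex.ofReal_one, Complex.ofReal_zero, mul_one, mul_zero,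
    sub_zero, add_zero] at h1 h2
  refine ⟨fun x hx => ?_, fun x hx => ?_⟩
  · rw [← h1 x hx, ← h2 x hx]
    linear_combination (-u x) * h.sq_add_complex x
  · rw [← h1 x hx, ← h2 x hx]
    linear_combination (-du x) * h.sq_add_complex x

/-- Adding r times the Hermite polynomial shifts the value at 0 by r and leaves the value at a and
both end derivatives alone. The price is a defect φ proportional to r. In this way an approximate
solution of the vertex equation yields an element of the domain that satisfies the coupling exactly.
-/
theorem exists_edge_quasimode {E : ℝ} {C S : ℝ → ℝ} (h : IsFundamentalSystem E C S)
    {a : ℝ} (ha : 0 < a) (hs : E * S a ≠ 0) :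
    ∃ K : ℝ, 0 ≤ K ∧ ∀ g₀ g₁ r : ℂ, ∃ (ψ φ : IntervalL2 a) (u du : ℝ → ℂ),
        IsH2Representative a ψ (-(φ + (E : ℂ) • ψ)) u du ∧ du 0 = g₀ ∧ -du a = g₁ ∧
        u 0 = (g₁ + C a * g₀) / (E * S a : ℝ) + r ∧
        u a = (g₀ + C a * g₁) / (E * S a : ℝ) ∧
        ‖ψ‖ ≤ K * (‖g₀‖ + ‖g₁‖ + ‖r‖) ∧ ‖φ‖ ≤ K * ‖r‖ ∧ ‖g₀‖ ≤ K * (‖ψ‖ + ‖r‖) := by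
  obtain ⟨B, hB0, hB⟩ := h.exists_bound a
  obtain ⟨K₁, hK₁, htr⟩ := exists_trace_bound h ha
  obtain ⟨p, dp, ddp, hddp, hpd, hdpd, hp0, hdp0, hpa, hdpa⟩ := exists_hermite ha
  have hpc : Continuous p := continuous_iff_continuousAt.2 fun x => (hpd x).continuousAt
  have hqc : Continuous fun x => -(E * p x + ddp x) := ((continuous_const.mul hpc).add hddp).neg
  set P : IntervalL2 a := (memLp_of_continuous hpc).toLp p with hP
  set Q : IntervalL2 a := (memLp_of_continuous hqc).toLp _ with hQ
  have hPae : P =ᵐ[volume.restrict (Ioo (0 : ℝ) a)] p := MemLp.coeFn_toLp _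
  have hQae : Q =ᵐ[volume.restrict (Ioo (0 : ℝ) a)] fun x => -(E * p x + ddp x) :=
    MemLp.coeFn_toLp _
  set s : ℝ := E * S a with hsdef
  have hsC : (s : ℂ) ≠ 0 := by exact_mod_cast hs
  have hsn : ‖(s : ℂ)‖ = |s| := by rw [Complex.norm_real, Real.norm_eq_abs]
  have hspos : 0 < |s| := abs_pos.2 hs
  have hsp := h.sq_add_complex a
  have hsC' : (s : ℂ) = E * S a := by rw [hsdef]; push_cast; ring
  set m : ℝ := (measureUnivNNReal (volume.restrict (Ioo (0 : ℝ) a)) : ℝ) ^ ((2 : ℝ≥0∞).toReal⁻¹)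
    with hm
  have hm0 : 0 ≤ m := by positivity
  set K₂ : ℝ := (1 + B) / |s| with hK₂
  have hK₂0 : 0 ≤ K₂ := by positivity
  have hC : Continuous fun x => (C x : ℂ) := Complex.continuous_ofReal.comp h.continuous_C
  have hS : Continuous fun x => (S x : ℂ) := Complex.continuous_ofReal.comp h.continuous_S
  refine ⟨m * (B * K₂ + B) + ‖P‖ + ‖Q‖ + K₁ + K₁ * ‖P‖, by positivity, fun g₀ g₁ r => ?_⟩
  set A : ℂ := (g₁ + C a * g₀) / s with hA
  set w : ℝ → ℂ := fun x => C x * A + S x * g₀ with hw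
  have hwc : Continuous w := by fun_prop
  have hwd : ∀ x, HasDerivAt w (-(E * S x) * A + C x * g₀) x := fun x =>
    ((h.hasDerivAt_C_complex x).mul_const A).add ((h.hasDerivAt_S_complex x).mul_const g₀)
  have hdw : ∀ x, HasDerivAt (fun x => -((E : ℂ) * S x) * A + C x * g₀) (-(E * w x)) x := by
    intro x
    refine (((((h.hasDerivAt_S_complex x).const_mul (E : ℂ)).neg).mul_const A).add
      ((h.hasDerivAt_C_complex x).mul_const g₀)).congr_deriv ?_
    simp only [hw]
    ring
  set W : IntervalL2 a := (memLp_of_continuous hwc).toLp w with hW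
  have hWae : W =ᵐ[volume.restrict (Ioo (0 : ℝ) a)] w := MemLp.coeFn_toLp _
  have hud : ∀ x, HasDerivAt (fun x => w x + r * p x)
      (-(E * S x) * A + C x * g₀ + r * dp x) x := fun x =>
    (hwd x).add ((hpd x).const_mul r)
  have hdud : ∀ x, HasDerivAt (fun x => -((E : ℂ) * S x) * A + C x * g₀ + r * dp x)
      (-(E * w x) + r * ddp x) x := fun x =>
    (hdw x).add ((hdpd x).const_mul r)
  have hA1 : ‖A‖ ≤ K₂ * (‖g₀‖ + ‖g₁‖) := by
    rw [hA, norm_div, hsn, hK₂, div_mul_eq_mul_div, div_le_div_iff_of_pos_right hspos]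
    refine (norm_add_le _ _).trans ?_
    rw [norm_mul]
    have e1 := mul_le_mul_of_nonneg_right (hB a ⟨ha.le, le_rfl⟩).1 (norm_nonneg g₀)
    nlinarith [norm_nonneg g₀, norm_nonneg g₁, mul_nonneg hB0 (norm_nonneg g₁)]
  have hWn : ‖W‖ ≤ m * (B * K₂ + B) * (‖g₀‖ + ‖g₁‖) := by
    have hb : ∀ x ∈ Icc 0 a, ‖w x‖ ≤ (B * K₂ + B) * (‖g₀‖ + ‖g₁‖) := by
      intro x hx
      have e2 := norm_add_le ((C x : ℂ) * A) (S x * g₀)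
      rw [norm_mul, norm_mul] at e2
      have e3 := mul_le_mul (hB x hx).1 hA1 (norm_nonneg _) hB0
      have e4 := mul_le_mul_of_nonneg_right (hB x hx).2 (norm_nonneg g₀)
      nlinarith [mul_nonneg hB0 (norm_nonneg g₁)]
    have := norm_intervalL2_le (by positivity) hWae hb
    rw [← hm] at this
    linarith
  have hWt : ‖g₀‖ ≤ K₁ * ‖W‖ := htr W A g₀ hWae
  have hψn : ‖W + r • P‖ ≤ ‖W‖ + ‖r‖ * ‖P‖ := (norm_add_le _ _).trans (by rw [norm_smul])
  have hWn' : ‖W‖ ≤ ‖W + r • P‖ + ‖r‖ * ‖P‖ := by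
    have := norm_sub_le (W + r • P) (r • P)
    rwa [add_sub_cancel_right, norm_smul] at this
  refine ⟨W + r • P, r • Q, _, _, isH2Representative_of (u := fun x => w x + r * p x)
    (g := fun x => -(E * w x) + r * ddp x) ?_ ?_ hud ?_, ?_, ?_, ?_, ?_, ?_, ?_, ?_⟩
  · filter_upwards [Lp.coeFn_add W (r • P), Lp.coeFn_smul r P, hPae, hWae] with x h1 h2 h3 h4
    rw [h1, Pi.add_apply, h2, Pi.smul_apply, h3, h4, smul_eq_mul]
  · filter_upwards [Lp.coeFn_neg (r • Q + (E : ℂ) • (W + r • P)),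
      Lp.coeFn_add (r • Q) ((E : ℂ) • (W + r • P)), Lp.coeFn_smul r Q,
      Lp.coeFn_smul (E : ℂ) (W + r • P),
      Lp.coeFn_add W (r • P), Lp.coeFn_smul r P, hPae, hWae, hQae] with x f1 f2 f3 f4 h1 h2 h3 h4 h5
    rw [f1, Pi.neg_apply, f2, Pi.add_apply, f3, f4, Pi.smul_apply, Pi.smul_apply, h1,
      Pi.add_apply, h2, Pi.smul_apply, h3, h4, h5]
    simp only [smul_eq_mul]
    ring
  · intro x hx
    rw [intervalIntegral.integral_eq_sub_of_hasDerivAt (fun t _ => hdud t)]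
    · ring
    · exact Continuous.intervalIntegrable (by fun_prop) _ _
  · simp [h.C_zero, h.S_zero, hdp0]
  · simp only [hdpa]
    rw [← hsC', hA]
    field_simp
    ring
  · simp only [hw, h.C_zero, h.S_zero, hp0, hA]
    simp
  · simp only [hw, hpa, hA]
    field_simp
    rw [hsC']
    linear_combination g₀ * hsp
  · refine hψn.trans ?_
    have f1 := norm_nonneg g₀
    have f2 := norm_nonneg g₁
    have f3 := norm_nonneg r
    have e1 : 0 ≤ m * (B * K₂ + B) * ‖r‖ := by positivity
    have e2 : 0 ≤ ‖P‖ * (‖g₀‖ + ‖g₁‖) := by positivity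
    have e3 : 0 ≤ (‖Q‖ + K₁ + K₁ * ‖P‖) * (‖g₀‖ + ‖g₁‖ + ‖r‖) := by positivity
    nlinarith
  · rw [norm_smul]
    have e1 : 0 ≤ (m * (B * K₂ + B) + ‖P‖ + K₁ + K₁ * ‖P‖) * ‖r‖ := by positivity
    nlinarith
  · have e1 := mul_le_mul_of_nonneg_left hWn' hK₁
    have f3 := norm_nonneg r
    have f4 := norm_nonneg (W + r • P)
    have e3 : 0 ≤ (m * (B * K₂ + B) + ‖P‖ + ‖Q‖) * (‖W + r • P‖ + ‖r‖) := by positivity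
    have e4 : 0 ≤ K₁ * ‖r‖ := by positivity
    have e5 : 0 ≤ K₁ * ‖P‖ * ‖W + r • P‖ := by positivity
    nlinarith

/-! ### Reduction from the edges to the vertices, and the spectral criterion -/

theorem mem_domain_of_mem_deltaPrimeSGraph {ℓ : Fin 2 → ℝ} {D : ℝ} {ψ φ : LatticeL2 ℓ}
    (h : (ψ, φ) ∈ deltaPrimeSGraph ℓ D) :
    ∃ hψ : ψ ∈ (deltaPrimeSHamiltonian ℓ D).domain, deltaPrimeSHamiltonian ℓ D ⟨ψ, hψ⟩ = φ := by
  rw [← deltaPrimeSHamiltonian_graph, LinearPMap.mem_graph_iff] at h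
  obtain ⟨y, rfl, hy⟩ := h
  exact ⟨y.2, hy⟩

theorem deltaPrimeSHamiltonian_mem_graph {ℓ : Fin 2 → ℝ} {D : ℝ}
    (ψ : (deltaPrimeSHamiltonian ℓ D).domain) :
    ((ψ : LatticeL2 ℓ), deltaPrimeSHamiltonian ℓ D ψ) ∈ deltaPrimeSGraph ℓ D := by
  rw [← deltaPrimeSHamiltonian_graph]
  exact LinearPMap.mem_graph _ ψ

theorem lp_two_norm_sq_le {ι : Type*} {E : ι → Type*} [∀ i, NormedAddCommGroup (E i)]
    (f : lp E 2) {a : ι → ℝ} {A : ℝ} (ha : HasSum a A) (h : ∀ i, ‖f i‖ ^ 2 ≤ a i) :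
    ‖f‖ ^ 2 ≤ A :=
  hasSum_le h (lp_two_hasSum_sq f) ha

theorem hasSum_edge_fst {a : LatticeVertex → ℝ} {A : ℝ} (h : HasSum a A) :
    HasSum (fun e : LatticeEdge => a e.1) (2 * A) := by
  have hj : ∀ j : Fin 2, HasSum (fun e : LatticeEdge => if e.2 = j then a e.1 else 0) A := by
    intro j
    have hinj : Function.Injective fun v : LatticeVertex => ((v, j) : LatticeEdge) :=
      fun v w hvw => congrArg Prod.fst hvw
    refine (hinj.hasSum_iff (fun e he => ?_)).1 ?_
    · rw [if_neg]
      rintro rfl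
      exact he ⟨e.1, rfl⟩
    · simpa [Function.comp_def] using h
  have h2 := (hj 0).add (hj 1)
  rw [← two_mul] at h2
  convert! h2 using 2 with e
  obtain ⟨v, j⟩ := e
  fin_cases j <;> simp

/-- The permutation of the edges which moves each edge by one step in its own direction. -/
def edgeSucc : LatticeEdge ≃ LatticeEdge where
  toFun e := (e.1 + Pi.single e.2 1, e.2)
  invFun e := (e.1 - Pi.single e.2 1, e.2)
  left_inv e := by simp
  right_inv e := by simp

theorem hasSum_edge_snd {a : LatticeVertex → ℝ} {A : ℝ} (h : HasSum a A) :
    HasSum (fun e : LatticeEdge => a (e.1 + Pi.single e.2 1)) (2 * A) :=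
  (edgeSucc.hasSum_iff (f := fun e : LatticeEdge => a e.1)).2 (hasSum_edge_fst h)

theorem hasSum_star_out {a : LatticeEdge → ℝ} {A : ℝ} (h : HasSum a A) :
    HasSum (fun v : LatticeVertex => ∑ j, a (v, j)) A :=
  h.prod_fiberwise fun v => hasSum_fintype fun j => a (v, j)

theorem hasSum_edge_pred {a : LatticeEdge → ℝ} {A : ℝ} (h : HasSum a A) :
    HasSum (fun e : LatticeEdge => a (e.1 - Pi.single e.2 1, e.2)) A :=
  (edgeSucc.symm.hasSum_iff (f := a)).2 h

theorem hasSum_star_in {a : LatticeEdge → ℝ} {A : ℝ} (h : HasSum a A) :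
    HasSum (fun v : LatticeVertex => ∑ j, a (v - Pi.single j 1, j)) A := by
  have h2 := hasSum_star_out (hasSum_edge_pred h)
  exact h2

/-- The diagonal coefficient of the vertex operator at energy `E`. -/
noncomputable def vertexDiagonal (ℓ : Fin 2 → ℝ) (D E : ℝ) (C S : ℝ → ℝ) : ℝ :=
  ∑ j, 2 * C (ℓ j) / (E * S (ℓ j)) - D

/-- The left side is the coupling condition at v after the boundary values have been expressed
through G; r collects the part of those values that does not depend on G. -/
theorem vertexOperator_eq_zero_iff {ℓ : Fin 2 → ℝ} {D E : ℝ} {C S : ℝ → ℝ} (G : VertexL2)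
    (r : ℂ) (v : LatticeVertex) :
    (∑ j, ((G (v + Pi.single j 1) + C (ℓ j) * G v) / (E * S (ℓ j) : ℝ) +
      (G (v - Pi.single j 1) + C (ℓ j) * G v) / (E * S (ℓ j) : ℝ)) + r = D * G v) ↔
    vertexOperator (vertexDiagonal ℓ D E C S) (fun j => (E * S (ℓ j))⁻¹) G v = -r := by
  rw [vertexOperator_apply, vertexDiagonal]
  simp only [Fin.sum_univ_two]
  push_cast
  rw [← sub_eq_zero, ← sub_eq_zero (b := -r)]
  constructor <;> intro h <;> rw [← h] <;> ring

/-- The edge solutions contribute inhomogeneous terms b to the vertex equation; inverting the vertex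
operator on -b gives the derivatives G, and these give ψ. All sums stay square summable because each
edge meets two vertices and each vertex four edges. -/
theorem exists_resolvent_solution {ℓ : Fin 2 → ℝ} (hℓ : ∀ j, 0 < ℓ j) {D E : ℝ} {C S : ℝ → ℝ}
    (hf : IsFundamentalSystem E C S) (hs : ∀ j, E * S (ℓ j) ≠ 0)
    (hM : IsUnit (vertexOperator (vertexDiagonal ℓ D E C S) fun j => (E * S (ℓ j))⁻¹)) :
    ∃ K : ℝ, ∀ φ : LatticeL2 ℓ, ∃ ψ : LatticeL2 ℓ,
      (ψ, φ + (E : ℂ) • ψ) ∈ deltaPrimeSGraph ℓ D ∧ ‖ψ‖ ≤ K * ‖φ‖ := by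
  choose K' hK'0 hK' using fun j => exists_edge_solution hf (hℓ j) (hs j)
  set K : ℝ := max (K' 0) (K' 1) with hK
  have hKj : ∀ j, K' j ≤ K := fun j => by
    fin_cases j
    · exact le_max_left _ _
    · exact le_max_right _ _
  have hK0 : 0 ≤ K := (hK'0 0).trans (hKj 0)
  obtain ⟨U, hU⟩ := hM
  set m : ℝ := ‖(U⁻¹ : (VertexL2 →L[ℂ] VertexL2)ˣ).1‖ with hm
  refine ⟨√(3 * K ^ 2 * (1 + 4 * (m * (4 * K)) ^ 2)), fun φ => ?_⟩
  choose b₀ b₁ hb₀ hb₁ hsol using fun e : LatticeEdge => hK' e.2 (φ e)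
  have hb₀' : ∀ e, ‖b₀ e‖ ≤ K * ‖φ e‖ := fun e =>
    (hb₀ e).trans (mul_le_mul_of_nonneg_right (hKj _) (norm_nonneg _))
  have hb₁' : ∀ e, ‖b₁ e‖ ≤ K * ‖φ e‖ := fun e =>
    (hb₁ e).trans (mul_le_mul_of_nonneg_right (hKj _) (norm_nonneg _))
  have hφs := lp_two_hasSum_sq φ
  have hsum : HasSum (fun v : LatticeVertex => 4 * K ^ 2 * ∑ j, ‖φ (v, j)‖ ^ 2 +
      4 * K ^ 2 * ∑ j, ‖φ (v - Pi.single j 1, j)‖ ^ 2)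
      (4 * K ^ 2 * ‖φ‖ ^ 2 + 4 * K ^ 2 * ‖φ‖ ^ 2) :=
    ((hasSum_star_out hφs).mul_left _).add ((hasSum_star_in hφs).mul_left _)
  have hbv : ∀ v, ‖∑ j, (b₀ (v, j) + b₁ (v - Pi.single j 1, j))‖ ^ 2 ≤
      4 * K ^ 2 * ∑ j, ‖φ (v, j)‖ ^ 2 + 4 * K ^ 2 * ∑ j, ‖φ (v - Pi.single j 1, j)‖ ^ 2 := by
    intro v
    have h1 : ‖∑ j, (b₀ (v, j) + b₁ (v - Pi.single j 1, j))‖ ≤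
        ∑ j, (K * ‖φ (v, j)‖ + K * ‖φ (v - Pi.single j 1, j)‖) :=
      (norm_sum_le _ _).trans (Finset.sum_le_sum fun j _ =>
        (norm_add_le _ _).trans (add_le_add (hb₀' _) (hb₁' _)))
    refine (pow_le_pow_left₀ (norm_nonneg _) h1 2).trans ?_
    simp only [Fin.sum_univ_two]
    generalize ‖φ (v, 0)‖ = x
    generalize ‖φ (v, 1)‖ = y
    generalize ‖φ (v - Pi.single 0 1, 0)‖ = z
    generalize ‖φ (v - Pi.single 1 1, 1)‖ = w
    have : (x + z + (y + w)) ^ 2 ≤ 4 * (x ^ 2 + y ^ 2) + 4 * (z ^ 2 + w ^ 2) := by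
      nlinarith [sq_nonneg (x - y), sq_nonneg (x - z), sq_nonneg (x - w), sq_nonneg (y - z),
        sq_nonneg (y - w), sq_nonneg (z - w)]
    nlinarith [mul_le_mul_of_nonneg_left this (sq_nonneg K)]
  set b : VertexL2 := ⟨fun v => ∑ j, (b₀ (v, j) + b₁ (v - Pi.single j 1, j)),
    memℓp_two_of_sq_le hsum.summable hbv⟩ with hb
  have hbn : ‖b‖ ≤ 4 * K * ‖φ‖ := by
    refine abs_le_of_sq_le_sq' ?_ (by positivity) |>.2
    have := lp_two_norm_sq_le b hsum hbv
    nlinarith [sq_nonneg (K * ‖φ‖)]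
  set G : VertexL2 := (U⁻¹ : (VertexL2 →L[ℂ] VertexL2)ˣ).1 (-b) with hG
  have hGn : ‖G‖ ≤ m * (4 * K) * ‖φ‖ := by
    refine ((U⁻¹ : (VertexL2 →L[ℂ] VertexL2)ˣ).1.le_opNorm _).trans ?_
    rw [norm_neg, mul_assoc]
    exact mul_le_mul_of_nonneg_left hbn (norm_nonneg _)
  have hMG : (U : VertexL2 →L[ℂ] VertexL2) G = -b := by
    rw [hG, ← mul_apply_eq_comp, Units.mul_inv]; rfl
  choose ψ u du hrep hd0 hd1 hu0 hu1 hψn using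
    fun e : LatticeEdge => hsol e (G e.1) (G (e.1 + Pi.single e.2 1))
  have hGs := lp_two_hasSum_sq G
  have hsum2 := ((hφs.add (hasSum_edge_fst hGs)).add (hasSum_edge_snd hGs)).mul_left (3 * K ^ 2)
  have hψe : ∀ e, ‖ψ e‖ ^ 2 ≤ 3 * K ^ 2 *
      (‖φ e‖ ^ 2 + ‖G e.1‖ ^ 2 + ‖G (e.1 + Pi.single e.2 1)‖ ^ 2) := by
    intro e
    have h1 := (hψn e).trans (mul_le_mul_of_nonneg_right (hKj e.2) (by positivity))
    refine (pow_le_pow_left₀ (norm_nonneg _) h1 2).trans ?_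
    generalize ‖φ e‖ = x
    generalize ‖G e.1‖ = y
    generalize ‖G (e.1 + Pi.single e.2 1)‖ = z
    have : (x + y + z) ^ 2 ≤ 3 * (x ^ 2 + y ^ 2 + z ^ 2) := by
      nlinarith [sq_nonneg (x - y), sq_nonneg (x - z), sq_nonneg (y - z)]
    nlinarith [mul_le_mul_of_nonneg_left this (sq_nonneg K)]
  refine ⟨⟨ψ, memℓp_two_of_sq_le hsum2.summable hψe⟩, ⟨u, du, fun e => ?_, fun v => ?_⟩, ?_⟩
  · exact hrep e
  · refine ⟨G v, fun j => ⟨hd0 (v, j), ?_⟩, ?_⟩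
    · have := hd1 (v - Pi.single j 1, j)
      simpa using this
    · have hMv := congrArg (fun F : VertexL2 => F v) hMG
      rw [hU] at hMv
      have h1 := (vertexOperator_eq_zero_iff G (b v) v).2 hMv
      rw [← h1]
      have hbv : b v = ∑ j, (b₀ (v, j) + b₁ (v - Pi.single j 1, j)) := rfl
      rw [hbv, ← Finset.sum_add_distrib]
      refine Finset.sum_congr rfl fun j _ => ?_
      rw [hu0 (v, j), hu1 (v - Pi.single j 1, j)]
      simp only [sub_add_cancel]
      ring
  · set Ψ : LatticeL2 ℓ := ⟨ψ, memℓp_two_of_sq_le hsum2.summable hψe⟩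
    have h1 := lp_two_norm_sq_le Ψ hsum2 hψe
    refine abs_le_of_sq_le_sq' ?_ (by positivity) |>.2
    rw [mul_pow, Real.sq_sqrt (by positivity)]
    refine h1.trans ?_
    have h2 := pow_le_pow_left₀ (norm_nonneg _) hGn 2
    nlinarith [mul_le_mul_of_nonneg_left h2 (sq_nonneg K)]

/-- The trace bound on the edge `(v, 0)` shows that the vertex derivatives are square summable. They
therefore lie in the kernel of the invertible vertex operator, and with them ψ vanishes on every
edge. -/
theorem eq_zero_of_mem_graph {ℓ : Fin 2 → ℝ} (hℓ : ∀ j, 0 < ℓ j) {D E : ℝ} {C S : ℝ → ℝ}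
    (hf : IsFundamentalSystem E C S) (hs : ∀ j, E * S (ℓ j) ≠ 0)
    (hM : IsUnit (vertexOperator (vertexDiagonal ℓ D E C S) fun j => (E * S (ℓ j))⁻¹))
    {ψ : LatticeL2 ℓ} (hψ : (ψ, (E : ℂ) • ψ) ∈ deltaPrimeSGraph ℓ D) : ψ = 0 := by
  obtain ⟨u, du, hrep, hcoup⟩ := hψ
  choose G' hG' hval using hcoup
  have hker : ∀ e : LatticeEdge, _ := fun e => exists_edge_kernel hf (hℓ e.2) (hrep e)
  obtain ⟨K, hK0, hK⟩ := exists_trace_bound hf (hℓ 0)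
  have hd0 : ∀ v j, du (v, j) 0 = G' v := fun v j => (hG' v j).1
  have hd1 : ∀ v j, du (v, j) (ℓ j) = -G' (v + Pi.single j 1) := fun v j => by
    have := (hG' (v + Pi.single j 1) j).2
    rw [add_sub_cancel_right] at this
    rw [← this, neg_neg]
  have hGn : ∀ v, ‖G' v‖ ≤ K * ‖ψ (v, 0)‖ := by
    intro v
    refine hK (ψ (v, 0)) (u (v, 0) 0) (G' v) ?_
    filter_upwards [(hrep (v, 0)).ae_eq, ae_restrict_mem measurableSet_Ioo] with x h1 h2
    rw [← hd0 v 0]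
    exact h1.trans ((hker (v, 0)).1 x (Ioo_subset_Icc_self h2))
  have hGs : ∀ v, ‖G' v‖ ^ 2 ≤ K ^ 2 * ∑ j, ‖ψ (v, j)‖ ^ 2 := by
    intro v
    have := pow_le_pow_left₀ (norm_nonneg _) (hGn v) 2
    rw [mul_pow] at this
    refine this.trans (mul_le_mul_of_nonneg_left ?_ (sq_nonneg K))
    rw [Fin.sum_univ_two]
    linarith [sq_nonneg ‖ψ (v, 1)‖]
  set G : VertexL2 := ⟨G', memℓp_two_of_sq_le
    ((hasSum_star_out (lp_two_hasSum_sq ψ)).mul_left (K ^ 2)).summable hGs⟩ with hG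
  have hGv : ∀ v, G v = G' v := fun v => rfl
  have hsC : ∀ j, (E : ℂ) * S (ℓ j) ≠ 0 := fun j => by exact_mod_cast hs j
  have hu0 : ∀ v j, u (v, j) 0 = (G (v + Pi.single j 1) + C (ℓ j) * G v) / (E * S (ℓ j) : ℝ) := by
    intro v j
    have h1 := (hker (v, j)).2 (ℓ j) ⟨(hℓ j).le, le_rfl⟩
    rw [hd0, hd1] at h1
    have := hsC j
    rw [hGv, hGv]
    push_cast
    rw [eq_div_iff this]
    linear_combination h1
  have hu1 : ∀ v j, u (v, j) (ℓ j) =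
      (G v + C (ℓ j) * G (v + Pi.single j 1)) / (E * S (ℓ j) : ℝ) := by
    intro v j
    have h1 := (hker (v, j)).1 (ℓ j) ⟨(hℓ j).le, le_rfl⟩
    rw [hd0, hu0, hGv, hGv] at h1
    have := hsC j
    have h2 := hf.sq_add_complex (ℓ j)
    rw [h1, hGv, hGv]
    push_cast
    have hE := left_ne_zero_of_mul this
    have hS := right_ne_zero_of_mul this
    field_simp
    linear_combination G' v * h2
  have hMG : vertexOperator (vertexDiagonal ℓ D E C S) (fun j => (E * S (ℓ j))⁻¹) G = 0 := by
    ext v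
    have h1 := hval v
    rw [← hGv] at h1
    have h2 := (vertexOperator_eq_zero_iff (ℓ := ℓ) (D := D) (E := E) (C := C) (S := S) G 0 v).1
    rw [h2, neg_zero]
    · rfl
    · rw [← h1, add_zero]
      refine Finset.sum_congr rfl fun j _ => ?_
      rw [hu0, hu1, sub_add_cancel]
  obtain ⟨U, hU⟩ := hM
  have hG0 : G = 0 := by
    have h1 : (U⁻¹ : (VertexL2 →L[ℂ] VertexL2)ˣ).1 ((U : VertexL2 →L[ℂ] VertexL2) G) = G := by
      rw [← mul_apply_eq_comp]
      exact congrArg (fun A : VertexL2 →L[ℂ] VertexL2 => A G) U.inv_mul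
    rw [← h1, hU, hMG, map_zero]
  have hz : ∀ v, G v = 0 := fun v => by rw [hG0]; rfl
  ext e : 2
  rw [Lp.ext_iff]
  have hz0 : ((0 : LatticeL2 ℓ) : ∀ e, EdgeL2 ℓ e) e = 0 := rfl
  rw [hz0]
  filter_upwards [(hrep e).ae_eq, Lp.coeFn_zero ℂ 2 (volume.restrict (Ioo (0 : ℝ) (ℓ e.2))),
    ae_restrict_mem measurableSet_Ioo] with x h1 h2 h3
  refine h1.trans ?_
  rw [h2, (hker e).1 x (Ioo_subset_Icc_self h3)]
  obtain ⟨v, j⟩ := e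
  rw [hd0, hu0, ← hGv, hz, hz]
  simp

theorem mem_resolventSet_of_abs_lt {ℓ : Fin 2 → ℝ} (hℓ : ∀ j, 0 < ℓ j) {D E : ℝ} {C S : ℝ → ℝ}
    (hf : IsFundamentalSystem E C S) (hs : ∀ j, E * S (ℓ j) ≠ 0)
    (h : ∑ j, 2 * |(E * S (ℓ j))⁻¹| < |vertexDiagonal ℓ D E C S|) :
    (E : ℂ) ∈ unboundedResolventSet (deltaPrimeSHamiltonian ℓ D) := by
  have hM := isUnit_vertexOperator h
  obtain ⟨K, hK⟩ := exists_resolvent_solution hℓ hf hs hM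
  refine mem_unboundedResolventSet_of_bound (K := K) (fun φ => ?_) fun ψ hψ => ?_
  · obtain ⟨ψ, hψ, hn⟩ := hK φ
    obtain ⟨hd, he⟩ := mem_domain_of_mem_deltaPrimeSGraph hψ
    exact ⟨⟨ψ, hd⟩, by rw [he]; exact add_sub_cancel_right _ _, hn⟩
  · have h1 := deltaPrimeSHamiltonian_mem_graph ψ
    rw [sub_eq_zero.1 hψ] at h1
    exact Subtype.ext (eq_zero_of_mem_graph hℓ hf hs hM h1)

/-- A pointwise small defect of G is moved into a small defect of -ψ'' - Eψ on the edges, while the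
trace bound keeps ψ from being small compared with G. -/
theorem notMem_resolventSet_of_approx {ℓ : Fin 2 → ℝ} (hℓ : ∀ j, 0 < ℓ j) {D E : ℝ} {C S : ℝ → ℝ}
    (hf : IsFundamentalSystem E C S) (hs : ∀ j, E * S (ℓ j) ≠ 0)
    (h : ∀ ε : ℝ, 0 < ε → ∃ G : VertexL2, G ≠ 0 ∧ ∀ v,
      ‖vertexOperator (vertexDiagonal ℓ D E C S) (fun j => (E * S (ℓ j))⁻¹) G v‖ ≤ ε * ‖G v‖) :
    (E : ℂ) ∉ unboundedResolventSet (deltaPrimeSHamiltonian ℓ D) := by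
  choose K' hK'0 hK' using fun j => exists_edge_quasimode hf (hℓ j) (hs j)
  set K : ℝ := max (K' 0) (K' 1) with hK
  have hKj : ∀ j, K' j ≤ K := fun j => by
    fin_cases j
    · exact le_max_left _ _
    · exact le_max_right _ _
  have hK0 : 0 ≤ K := (hK'0 0).trans (hKj 0)
  refine notMem_unboundedResolventSet_of_approx fun δ hδ => ?_
  -- The first condition lets the defect be absorbed in the trace bound for G, the second gives the
  -- final quotient δ.
  obtain ⟨ε, hε, hε1, hεδ⟩ : ∃ ε : ℝ, 0 < ε ∧ K * ε ≤ 1 / 2 ∧ 4 * K ^ 2 * ε ≤ δ := by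
    refine ⟨min (1 / 2 / (K + 1)) (δ / (4 * K ^ 2 + 1)), by positivity, ?_, ?_⟩
    · calc K * min (1 / 2 / (K + 1)) (δ / (4 * K ^ 2 + 1)) ≤ (K + 1) * (1 / 2 / (K + 1)) :=
          mul_le_mul (by linarith) (min_le_left _ _) (by positivity) (by positivity)
        _ = 1 / 2 := by field_simp
    · calc 4 * K ^ 2 * min (1 / 2 / (K + 1)) (δ / (4 * K ^ 2 + 1)) ≤
          (4 * K ^ 2 + 1) * (δ / (4 * K ^ 2 + 1)) :=
          mul_le_mul (by linarith) (min_le_right _ _) (by positivity) (by positivity)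
        _ = δ := by field_simp
  obtain ⟨G, hG0, hG⟩ := h ε hε
  set r : LatticeVertex → ℂ := fun v =>
    -vertexOperator (vertexDiagonal ℓ D E C S) (fun j => (E * S (ℓ j))⁻¹) G v with hr
  have hrn : ∀ v, ‖r v‖ ≤ ε * ‖G v‖ := fun v => by rw [hr, norm_neg]; exact hG v
  -- The whole defect at v is assigned to one of its four edges, the edge `(v, 0)` starting there.
  choose ψ φ u du hrep hd0 hd1 hu0 hu1 hψn hφn htr using fun e : LatticeEdge =>
    hK' e.2 (G e.1) (G (e.1 + Pi.single e.2 1)) (if e.2 = 0 then r e.1 else 0)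
  have hrn' : ∀ e : LatticeEdge, ‖(if e.2 = 0 then r e.1 else 0)‖ ≤ ε * ‖G e.1‖ := by
    intro e
    split_ifs
    · exact hrn _
    · rw [norm_zero]; positivity
  have hGs := lp_two_hasSum_sq G
  have hφe : ∀ e, ‖φ e‖ ^ 2 ≤ K ^ 2 * ε ^ 2 * ‖G e.1‖ ^ 2 := by
    intro e
    have h1 : ‖φ e‖ ≤ K * (ε * ‖G e.1‖) :=
      (hφn e).trans (mul_le_mul (hKj _) (hrn' e) (norm_nonneg _) hK0)
    refine (pow_le_pow_left₀ (norm_nonneg _) h1 2).trans (le_of_eq (by ring))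
  have hψe : ∀ e, ‖ψ e‖ ^ 2 ≤ 3 * K ^ 2 *
      (‖G e.1‖ ^ 2 + ‖G (e.1 + Pi.single e.2 1)‖ ^ 2 + ε ^ 2 * ‖G e.1‖ ^ 2) := by
    intro e
    have h1 : ‖ψ e‖ ≤ K * (‖G e.1‖ + ‖G (e.1 + Pi.single e.2 1)‖ + ε * ‖G e.1‖) :=
      (hψn e).trans (mul_le_mul (hKj _) (by linarith [hrn' e]) (by positivity) hK0)
    refine (pow_le_pow_left₀ (norm_nonneg _) h1 2).trans ?_
    generalize ‖G e.1‖ = x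
    generalize ‖G (e.1 + Pi.single e.2 1)‖ = y
    have : (x + y + ε * x) ^ 2 ≤ 3 * (x ^ 2 + y ^ 2 + ε ^ 2 * x ^ 2) := by
      nlinarith [sq_nonneg (x - y), sq_nonneg (x - ε * x), sq_nonneg (y - ε * x)]
    nlinarith [mul_le_mul_of_nonneg_left this (sq_nonneg K)]
  have hφs := (hasSum_edge_fst hGs).mul_left (K ^ 2 * ε ^ 2)
  have hψs := (((hasSum_edge_fst hGs).add (hasSum_edge_snd hGs)).add
    ((hasSum_edge_fst hGs).mul_left (ε ^ 2))).mul_left (3 * K ^ 2)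
  set Φ : LatticeL2 ℓ := ⟨φ, memℓp_two_of_sq_le hφs.summable hφe⟩ with hΦ
  set Ψ : LatticeL2 ℓ := ⟨ψ, memℓp_two_of_sq_le hψs.summable hψe⟩ with hΨ
  have hgraph : (Ψ, Φ + (E : ℂ) • Ψ) ∈ deltaPrimeSGraph ℓ D := by
    refine ⟨u, du, fun e => hrep e, fun v => ⟨G v, fun j => ⟨hd0 (v, j), ?_⟩, ?_⟩⟩
    · have := hd1 (v - Pi.single j 1, j)
      simpa using this
    · have h1 := (vertexOperator_eq_zero_iff (ℓ := ℓ) (D := D) (E := E) (C := C) (S := S)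
        G (r v) v).2 (by simp [hr])
      rw [← h1]
      simp only [Fin.sum_univ_two]
      rw [hu0, hu0, hu1, hu1]
      simp only [sub_add_cancel]
      simp
      ring
  obtain ⟨hd, he⟩ := mem_domain_of_mem_deltaPrimeSGraph hgraph
  have hΦn : ‖Φ‖ ^ 2 ≤ K ^ 2 * ε ^ 2 * (2 * ‖G‖ ^ 2) := lp_two_norm_sq_le Φ hφs hφe
  have hΨn : ‖G‖ ^ 2 ≤ 4 * K ^ 2 * ‖Ψ‖ ^ 2 := by
    refine lp_two_norm_sq_le G ((hasSum_star_out (lp_two_hasSum_sq Ψ)).mul_left (4 * K ^ 2)) ?_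
    intro v
    have h1 : ‖G v‖ ≤ K * (‖ψ (v, 0)‖ + ε * ‖G v‖) :=
      (htr (v, 0)).trans (mul_le_mul (hKj _) (by linarith [hrn' (v, 0)]) (by positivity) hK0)
    have h2 : ‖G v‖ ≤ 2 * K * ‖ψ (v, 0)‖ := by
      have := mul_le_mul_of_nonneg_right hε1 (norm_nonneg (G v))
      nlinarith
    have h3 := pow_le_pow_left₀ (norm_nonneg _) h2 2
    rw [Fin.sum_univ_two]
    have h4 : 0 ≤ 4 * K ^ 2 * ‖Ψ (v, 1)‖ ^ 2 := by positivity
    have h5 : Ψ (v, 0) = ψ (v, 0) := rfl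
    rw [h5]
    nlinarith
  refine ⟨⟨Ψ, hd⟩, ?_, ?_⟩
  · intro h0
    change Ψ = 0 at h0
    rw [h0, norm_zero] at hΨn
    refine hG0 (norm_eq_zero.1 ?_)
    nlinarith [norm_nonneg G]
  · rw [he]
    change ‖Φ + (E : ℂ) • Ψ - (E : ℂ) • Ψ‖ ≤ δ * ‖Ψ‖
    rw [add_sub_cancel_right]
    refine le_trans (b := 4 * K ^ 2 * ε * ‖Ψ‖) ?_ (by gcongr)
    refine abs_le_of_sq_le_sq' ?_ (by positivity) |>.2
    have h1 := mul_le_mul_of_nonneg_left hΨn (by positivity : 0 ≤ 2 * (K ^ 2 * ε ^ 2))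
    have h2 : 0 ≤ K ^ 4 * ε ^ 2 * ‖Ψ‖ ^ 2 := by positivity
    nlinarith

/-- The damped wave ρ^|n| zⁿ with ρ = 1/(1 + δ): neighbouring moduli differ by the factor ρ or 1 +
δ, so the defect is at most δ|q n| at every n. A pointwise relative bound, unlike a norm bound,
passes directly to products over the two coordinates. -/
theorem exists_line_quasimode {z : ℂ} (hz : ‖z‖ = 1) {δ : ℝ} (hδ : 0 < δ) :
    ∃ q : ℤ → ℂ, (∀ n, ‖q (n + 1) - z * q n‖ ≤ δ * ‖q n‖) ∧
      (∀ n, ‖q (n - 1) - z⁻¹ * q n‖ ≤ δ * ‖q n‖) ∧ q 0 ≠ 0 ∧ Summable fun n => ‖q n‖ ^ 2 := by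
  have hz0 : z ≠ 0 := norm_ne_zero_iff.1 (by rw [hz]; exact one_ne_zero)
  set ρ : ℝ := (1 + δ)⁻¹ with hρ
  have hρ0 : 0 < ρ := by positivity
  have hρ1 : ρ < 1 := inv_lt_one_of_one_lt₀ (by linarith)
  have hρδ : ρ * (1 + δ) = 1 := inv_mul_cancel₀ (by positivity)
  have hstep : ∀ m n : ℕ, (m = n + 1 ∨ n = m + 1) → |ρ ^ m - ρ ^ n| ≤ δ * ρ ^ n := by
    rintro m n (rfl | rfl)
    · have h0 : 0 < ρ ^ n := by positivity
      have h1 : ρ ^ n * ρ - ρ ^ n = -(ρ * (δ * ρ ^ n)) := by linear_combination ρ ^ n * hρδ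
      rw [pow_succ, h1, abs_neg, abs_of_pos (by positivity)]
      exact mul_le_of_le_one_left (by positivity) hρ1.le
    · have h0 : 0 < ρ ^ m := by positivity
      rw [pow_succ, abs_le]
      constructor <;> nlinarith
  have hn : ∀ n : ℤ, ‖(ρ : ℂ) ^ n.natAbs * z ^ n‖ = ρ ^ n.natAbs := fun n => by
    rw [norm_mul, norm_pow, norm_zpow, hz, one_zpow, mul_one, Complex.norm_real, Real.norm_eq_abs,
      abs_of_pos hρ0]
  refine ⟨fun n => (ρ : ℂ) ^ n.natAbs * z ^ n, fun n => ?_, fun n => ?_, by simp, ?_⟩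
  · rw [hn]
    have h1 : (ρ : ℂ) ^ (n + 1).natAbs * z ^ (n + 1) - z * ((ρ : ℂ) ^ n.natAbs * z ^ n) =
        ((ρ ^ (n + 1).natAbs - ρ ^ n.natAbs : ℝ) : ℂ) * z ^ (n + 1) := by
      rw [zpow_add_one₀ hz0]
      push_cast
      ring
    rw [h1, norm_mul, norm_zpow, hz, one_zpow, mul_one, Complex.norm_real, Real.norm_eq_abs]
    exact hstep _ _ (by omega)
  · rw [hn]
    have h1 : (ρ : ℂ) ^ (n - 1).natAbs * z ^ (n - 1) - z⁻¹ * ((ρ : ℂ) ^ n.natAbs * z ^ n) =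
        ((ρ ^ (n - 1).natAbs - ρ ^ n.natAbs : ℝ) : ℂ) * z ^ (n - 1) := by
      rw [zpow_sub_one₀ hz0]
      push_cast
      ring
    rw [h1, norm_mul, norm_zpow, hz, one_zpow, mul_one, Complex.norm_real, Real.norm_eq_abs]
    exact hstep _ _ (by omega)
  · simp only [hn, ← pow_mul, mul_comm _ 2]
    simp only [pow_mul]
    have hg : Summable fun n : ℕ => (ρ ^ 2) ^ n :=
      summable_geometric_of_lt_one (by positivity) (by nlinarith)
    refine Summable.of_nat_of_neg ?_ ?_ <;> simpa using hg

/-- The symbol c + Σ 2 t_j x_j with x_j = cos φ_j in [-1, 1] takes the value 0; the product of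
damped waves with these phases is the required vector. -/
theorem exists_vertex_quasimode {c : ℝ} {t : Fin 2 → ℝ} (h : |c| ≤ ∑ j, 2 * |t j|) {ε : ℝ}
    (hε : 0 < ε) :
    ∃ G : VertexL2, G ≠ 0 ∧ ∀ v, ‖vertexOperator c t G v‖ ≤ ε * ‖G v‖ := by
  obtain ⟨x, hx1, hx⟩ : ∃ x : Fin 2 → ℝ, (∀ j, |x j| ≤ 1) ∧ c + ∑ j, 2 * t j * x j = 0 := by
    set T : ℝ := ∑ j, 2 * |t j| with hT
    have hT0 : 0 ≤ T := (abs_nonneg c).trans h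
    -- This choice makes Σ 2 t_j x_j equal to -c. If T = 0 then c = 0, and division by zero gives x
    -- = 0.
    refine ⟨fun j => -(SignType.sign (t j) : ℝ) * (c / T), fun j => ?_, ?_⟩
    · rw [abs_mul, abs_neg]
      have h1 : |(SignType.sign (t j) : ℝ)| ≤ 1 := by
        rcases lt_trichotomy (t j) 0 with h | h | h <;> simp [h]
      have h2 : |c / T| ≤ 1 := by
        rw [abs_div, abs_of_nonneg hT0]
        exact div_le_one_of_le₀ h hT0
      nlinarith [abs_nonneg (c / T), abs_nonneg (SignType.sign (t j) : ℝ)]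
    · have h1 : ∀ j, 2 * t j * (-(SignType.sign (t j) : ℝ) * (c / T)) =
          -(2 * |t j|) * (c / T) := fun j => by
        rw [← self_mul_sign (t j)]; ring
      simp only [h1]
      rw [← Finset.sum_mul, Finset.sum_neg_distrib, ← hT]
      rcases hT0.eq_or_lt with h0 | h0
      · rw [← h0] at h
        rw [abs_eq_zero.1 (le_antisymm h (abs_nonneg c))]
        simp
      · field_simp
        ring
  set z : Fin 2 → ℂ := fun j => Complex.exp (Real.arccos (x j) * Complex.I) with hz
  have hzn : ∀ j, ‖z j‖ = 1 := fun j => Complex.norm_exp_ofReal_mul_I _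
  have hzx : ∀ j, z j + (z j)⁻¹ = 2 * x j := fun j => by
    have h1 := abs_le.1 (hx1 j)
    have h2 := Real.cos_arccos h1.1 h1.2
    rw [hz]
    simp only []
    rw [← Complex.exp_neg, ← neg_mul, ← Complex.two_cos, ← Complex.ofReal_cos, h2]
  set δ : ℝ := ε / (∑ j, 2 * |t j| + 1) with hδ
  have hT0 : 0 ≤ ∑ j, 2 * |t j| := (abs_nonneg c).trans h
  have hδ0 : 0 < δ := by positivity
  choose q hq1 hq2 hq0 hqs using fun j => exists_line_quasimode (hzn j) hδ0
  have hsum : Summable fun v : LatticeVertex => ‖q 0 (v 0) * q 1 (v 1)‖ ^ 2 := by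
    have h1 := (hqs 0).mul_of_nonneg (hqs 1) (fun _ => by positivity) (fun _ => by positivity)
    have h2 := ((finTwoArrowEquiv ℤ).summable_iff).2 h1
    refine h2.congr fun v => ?_
    simp [mul_pow]
  set G : VertexL2 := ⟨fun v => q 0 (v 0) * q 1 (v 1), memℓp_two_of_sq_le hsum fun v => le_rfl⟩
    with hG
  have hGv : ∀ v, G v = q 0 (v 0) * q 1 (v 1) := fun v => rfl
  have hp : ∀ j v, ‖G (v + Pi.single j 1) - z j * G v‖ ≤ δ * ‖G v‖ := by
    refine Fin.forall_fin_two.2 ⟨fun v => ?_, fun v => ?_⟩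
    · have h1 := mul_le_mul_of_nonneg_right (hq1 0 (v 0)) (norm_nonneg (q 1 (v 1)))
      have e0 : (v + Pi.single 0 1 : LatticeVertex) 0 = v 0 + 1 := by simp
      have e1 : (v + Pi.single 0 1 : LatticeVertex) 1 = v 1 := by simp
      rw [mul_assoc, ← norm_mul, ← norm_mul] at h1
      rw [hGv, hGv, e0, e1]
      refine (le_of_eq (congrArg _ ?_)).trans (h1.trans (le_of_eq (congrArg _ (congrArg _ ?_)))) <;> ring
    · have h1 := mul_le_mul_of_nonneg_right (hq1 1 (v 1)) (norm_nonneg (q 0 (v 0)))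
      have e0 : (v + Pi.single 1 1 : LatticeVertex) 1 = v 1 + 1 := by simp
      have e1 : (v + Pi.single 1 1 : LatticeVertex) 0 = v 0 := by simp
      rw [mul_assoc, ← norm_mul, ← norm_mul] at h1
      rw [hGv, hGv, e0, e1]
      refine (le_of_eq (congrArg _ ?_)).trans (h1.trans (le_of_eq (congrArg _ (congrArg _ ?_)))) <;> ring
  have hm : ∀ j v, ‖G (v - Pi.single j 1) - (z j)⁻¹ * G v‖ ≤ δ * ‖G v‖ := by
    refine Fin.forall_fin_two.2 ⟨fun v => ?_, fun v => ?_⟩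
    · have h1 := mul_le_mul_of_nonneg_right (hq2 0 (v 0)) (norm_nonneg (q 1 (v 1)))
      have e0 : (v - Pi.single 0 1 : LatticeVertex) 0 = v 0 - 1 := by simp
      have e1 : (v - Pi.single 0 1 : LatticeVertex) 1 = v 1 := by simp
      rw [mul_assoc, ← norm_mul, ← norm_mul] at h1
      rw [hGv, hGv, e0, e1]
      refine (le_of_eq (congrArg _ ?_)).trans (h1.trans (le_of_eq (congrArg _ (congrArg _ ?_)))) <;> ring
    · have h1 := mul_le_mul_of_nonneg_right (hq2 1 (v 1)) (norm_nonneg (q 0 (v 0)))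
      have e0 : (v - Pi.single 1 1 : LatticeVertex) 1 = v 1 - 1 := by simp
      have e1 : (v - Pi.single 1 1 : LatticeVertex) 0 = v 0 := by simp
      rw [mul_assoc, ← norm_mul, ← norm_mul] at h1
      rw [hGv, hGv, e0, e1]
      refine (le_of_eq (congrArg _ ?_)).trans (h1.trans (le_of_eq (congrArg _ (congrArg _ ?_)))) <;> ring
  refine ⟨G, fun h0 => ?_, fun v => ?_⟩
  · have h1 : G 0 = 0 := by rw [h0]; rfl
    rw [hGv] at h1
    exact mul_ne_zero (hq0 0) (hq0 1) h1
  · have h1 : vertexOperator c t G v = ∑ j, (t j : ℂ) *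
        ((G (v + Pi.single j 1) - z j * G v) + (G (v - Pi.single j 1) - (z j)⁻¹ * G v)) := by
      have hxC : (c : ℂ) + ∑ j, t j * (z j + (z j)⁻¹) = 0 := by
        simp only [hzx]
        have : ((c + ∑ j, 2 * t j * x j : ℝ) : ℂ) = 0 := by rw [hx]; simp
        push_cast at this
        rw [← this]
        congr 1
        exact Finset.sum_congr rfl fun j _ => by ring
      rw [vertexOperator_apply]
      simp only [Fin.sum_univ_two] at hxC ⊢
      linear_combination G v * hxC
    rw [h1]
    have h2 : ∀ j, ‖(t j : ℂ) * ((G (v + Pi.single j 1) - z j * G v) +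
        (G (v - Pi.single j 1) - (z j)⁻¹ * G v))‖ ≤ 2 * |t j| * (δ * ‖G v‖) := by
      intro j
      rw [norm_mul, Complex.norm_real, Real.norm_eq_abs, mul_comm 2, mul_assoc]
      refine mul_le_mul_of_nonneg_left ?_ (abs_nonneg _)
      refine (norm_add_le _ _).trans ?_
      linarith [hp j v, hm j v]
    refine (norm_sum_le _ _).trans ((Finset.sum_le_sum fun j _ => h2 j).trans ?_)
    rw [← Finset.sum_mul, ← mul_assoc]
    refine mul_le_mul_of_nonneg_right ?_ (norm_nonneg _)
    rw [hδ, ← mul_div_assoc, div_le_iff₀ (by positivity)]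
    nlinarith

theorem mem_deltaPrimeSSpectrum_iff {ℓ : Fin 2 → ℝ} (hℓ : ∀ j, 0 < ℓ j) {D E : ℝ} {C S : ℝ → ℝ}
    (hf : IsFundamentalSystem E C S) (hs : ∀ j, E * S (ℓ j) ≠ 0) :
    E ∈ deltaPrimeSSpectrum ℓ D ↔
      |vertexDiagonal ℓ D E C S| ≤ ∑ j, 2 * |(E * S (ℓ j))⁻¹| := by
  constructor
  · intro h
    by_contra hlt
    exact h (mem_resolventSet_of_abs_lt hℓ hf hs (not_le.1 hlt))
  · intro h
    exact notMem_resolventSet_of_approx hℓ hf hs fun ε hε => exists_vertex_quasimode h hε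

theorem isClosed_deltaPrimeSSpectrum (ℓ : Fin 2 → ℝ) (D : ℝ) :
    IsClosed (deltaPrimeSSpectrum ℓ D) := by
  have h := (isOpen_unboundedResolventSet (deltaPrimeSHamiltonian ℓ D)).isClosed_compl
  exact h.preimage Complex.continuous_ofReal

/-! ### The criterion for positive and for negative energies -/

theorem isFundamentalSystem_cos {q : ℝ} (hq : q ≠ 0) :
    IsFundamentalSystem (q ^ 2) (fun x => Real.cos (q * x)) fun x => Real.sin (q * x) / q := by
  refine ⟨by simp, by simp, fun x => ?_, fun x => ?_⟩
  · have := ((hasDerivAt_id x).const_mul q).cos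
    refine this.congr_deriv ?_
    simp only [id]
    field_simp
  · have := (((hasDerivAt_id x).const_mul q).sin).div_const q
    refine this.congr_deriv ?_
    simp only [id]
    field_simp

theorem isFundamentalSystem_cosh {κ : ℝ} (hκ : κ ≠ 0) :
    IsFundamentalSystem (-κ ^ 2) (fun x => Real.cosh (κ * x)) fun x => Real.sinh (κ * x) / κ := by
  refine ⟨by simp, by simp, fun x => ?_, fun x => ?_⟩
  · have := ((hasDerivAt_id x).const_mul κ).cosh
    refine this.congr_deriv ?_
    simp only [id]
    field_simp
  · have := (((hasDerivAt_id x).const_mul κ).sinh).div_const κ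
    refine this.congr_deriv ?_
    simp only [id]
    field_simp

/-- The residue of `t` modulo `π` in the interval `(0, π]`. -/
noncomputable def piMod (t : ℝ) : ℝ := toIocMod Real.pi_pos 0 t

theorem piMod_pos (t : ℝ) : 0 < piMod t := by
  exact (toIocMod_mem_Ioc Real.pi_pos 0 t).1

theorem piMod_le (t : ℝ) : piMod t ≤ Real.pi := by
  simpa [piMod] using (toIocMod_mem_Ioc Real.pi_pos 0 t).2

theorem exists_eq_piMod_add (t : ℝ) : ∃ n : ℤ, t = piMod t + n * Real.pi := by
  refine ⟨toIocDiv Real.pi_pos 0 t, ?_⟩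
  have := toIocMod_add_toIocDiv_zsmul Real.pi_pos 0 t
  rw [zsmul_eq_mul] at this
  exact this.symm

theorem piMod_eq_of {t ρ : ℝ} (h0 : 0 < ρ) (h1 : ρ ≤ Real.pi) {n : ℤ}
    (h : t = ρ + n * Real.pi) : piMod t = ρ := by
  rw [piMod, toIocMod_eq_iff]
  refine ⟨⟨h0, by simpa using h1⟩, n, ?_⟩
  rw [zsmul_eq_mul, h]

/-- The function `x ↦ cot (x / 2)` on `(0, π]`, extended periodically with period `π`. -/
noncomputable def halfCot (t : ℝ) : ℝ := Real.cot (piMod t / 2)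

theorem halfCot_nonneg (t : ℝ) : 0 ≤ halfCot t := by
  have h0 := piMod_pos t
  have h1 := piMod_le t
  rw [halfCot, Real.cot_eq_cos_div_sin]
  refine div_nonneg (Real.cos_nonneg_of_neg_pi_div_two_le_of_le (by linarith) (by linarith))
    (Real.sin_nonneg_of_nonneg_of_le_pi (by linarith) (by linarith))

theorem sin_ne_zero_iff_piMod (t : ℝ) : Real.sin t ≠ 0 ↔ piMod t < Real.pi := by
  obtain ⟨n, hn⟩ := exists_eq_piMod_add t
  constructor
  · intro h
    refine (piMod_le t).lt_of_ne fun h1 => h ?_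
    rw [hn, h1, Real.sin_add_int_mul_pi, Real.sin_pi, mul_zero]
  · intro h
    rw [hn, Real.sin_add_int_mul_pi]
    exact mul_ne_zero (zpow_ne_zero _ (by norm_num)) (Real.sin_pos_of_pos_of_lt_pi (piMod_pos t) h).ne'

/-- Both terms have period π, and on (0, π) the half-angle formula (1 + cos x)/sin x = cot(x/2)
applies. -/
theorem cot_add_inv_abs_sin {t : ℝ} (ht : Real.sin t ≠ 0) :
    Real.cos t / Real.sin t + |Real.sin t|⁻¹ = halfCot t := by
  obtain ⟨n, hn⟩ := exists_eq_piMod_add t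
  have h0 := piMod_pos t
  have h1 := (sin_ne_zero_iff_piMod t).1 ht
  have hs : 0 < Real.sin (piMod t) := Real.sin_pos_of_pos_of_lt_pi h0 h1
  have hh : 0 < Real.sin (piMod t / 2) :=
    Real.sin_pos_of_pos_of_lt_pi (by linarith) (by linarith)
  have hc : 0 < Real.cos (piMod t / 2) :=
    Real.cos_pos_of_mem_Ioo ⟨by linarith, by linarith⟩
  have e1 : Real.cos t / Real.sin t = Real.cos (piMod t) / Real.sin (piMod t) := by
    rw [hn, Real.cos_add_int_mul_pi, Real.sin_add_int_mul_pi,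
      mul_div_mul_left _ _ (zpow_ne_zero _ (by norm_num)), ← hn]
  have e2 : |Real.sin t| = Real.sin (piMod t) := by
    rw [hn, Real.sin_add_int_mul_pi, abs_mul, abs_zpow, ← hn]
    simp [abs_of_pos hs]
  rw [e1, e2, halfCot, Real.cot_eq_cos_div_sin]
  have e3 : Real.sin (piMod t) = 2 * Real.sin (piMod t / 2) * Real.cos (piMod t / 2) := by
    rw [← Real.sin_two_mul]; ring_nf
  have e4 : Real.cos (piMod t) = 2 * Real.cos (piMod t / 2) ^ 2 - 1 := by
    rw [← Real.cos_two_mul]; ring_nf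
  rw [e3, e4]
  field_simp
  ring

theorem cot_sub_inv_abs_sin_nonpos {t : ℝ} (ht : Real.sin t ≠ 0) :
    Real.cos t / Real.sin t - |Real.sin t|⁻¹ ≤ 0 := by
  have h1 : |Real.cos t / Real.sin t| ≤ |Real.sin t|⁻¹ := by
    rw [abs_div, div_eq_mul_inv]
    exact mul_le_of_le_one_left (by positivity) (Real.abs_cos_le_one t)
  linarith [(abs_le.1 h1).2]

/-- Multiplied by |q| the criterion reads |2 Σ cot(qℓ_j) - qD| ≤ 2 Σ 1/|sin(qℓ_j)|. One of its two
inequalities is automatic, because cot ≤ 1/|sin| and qD > 0. Allowing negative q treats both signs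
of D at once. -/
theorem sq_mem_deltaPrimeSSpectrum_iff {ℓ : Fin 2 → ℝ} (hℓ : ∀ j, 0 < ℓ j) {D q : ℝ}
    (hq : 0 < q * D) (hs : ∀ j, Real.sin (q * ℓ j) ≠ 0) :
    q ^ 2 ∈ deltaPrimeSSpectrum ℓ D ↔ q * D / 2 ≤ ∑ j, halfCot (q * ℓ j) := by
  have hq0 : q ≠ 0 := left_ne_zero_of_mul hq.ne'
  have hsq : ∀ j, q ^ 2 * (Real.sin (q * ℓ j) / q) = q * Real.sin (q * ℓ j) := fun j => by
    field_simp
  rw [mem_deltaPrimeSSpectrum_iff hℓ (isFundamentalSystem_cos hq0)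
    (fun j => by rw [hsq]; exact mul_ne_zero hq0 (hs j)), vertexDiagonal]
  simp only [hsq]
  rw [← mul_le_mul_iff_right₀ (abs_pos.2 hq0), ← abs_mul]
  have e1 : q * (∑ j, 2 * Real.cos (q * ℓ j) / (q * Real.sin (q * ℓ j)) - D) =
      2 * ∑ j, Real.cos (q * ℓ j) / Real.sin (q * ℓ j) - q * D := by
    simp only [Fin.sum_univ_two]
    have := hs 0
    have := hs 1
    field_simp
  have e2 : |q| * ∑ j, 2 * |(q * Real.sin (q * ℓ j))⁻¹| = 2 * ∑ j, |Real.sin (q * ℓ j)|⁻¹ := by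
    have : |q| ≠ 0 := (abs_pos.2 hq0).ne'
    simp only [Fin.sum_univ_two, mul_inv, abs_mul, abs_inv]
    field_simp
  rw [e1, e2, abs_le]
  have h0 := cot_sub_inv_abs_sin_nonpos (hs 0)
  have h1 := cot_sub_inv_abs_sin_nonpos (hs 1)
  simp only [← cot_add_inv_abs_sin (hs _), Fin.sum_univ_two]
  constructor
  · rintro ⟨h2, h3⟩
    linarith
  · intro h2
    constructor <;> linarith

/-- With t = tanh(x/2), coth x = (t + 1/t)/2 and 1/sinh x = (1/t - t)/2, so the two halves of the
criterion separate into tanh and coth sums. -/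
theorem neg_sq_mem_deltaPrimeSSpectrum_iff {ℓ : Fin 2 → ℝ} (hℓ : ∀ j, 0 < ℓ j) {D κ : ℝ}
    (hκ : 0 < κ) :
    -κ ^ 2 ∈ deltaPrimeSSpectrum ℓ D ↔ ∑ j, Real.tanh (κ * ℓ j / 2) ≤ -(κ * D / 2) ∧
      -(κ * D / 2) ≤ ∑ j, (Real.tanh (κ * ℓ j / 2))⁻¹ := by
  have hx : ∀ j, 0 < κ * ℓ j / 2 := fun j => by have := hℓ j; positivity
  have hsh : ∀ j, 0 < Real.sinh (κ * ℓ j / 2) := fun j => Real.sinh_pos_iff.2 (hx j)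
  have hch : ∀ j, 0 < Real.cosh (κ * ℓ j / 2) := fun j => Real.cosh_pos _
  have es : ∀ j, Real.sinh (κ * ℓ j) =
      2 * Real.sinh (κ * ℓ j / 2) * Real.cosh (κ * ℓ j / 2) := fun j => by
    rw [← Real.sinh_two_mul]; ring_nf
  have ec : ∀ j, Real.cosh (κ * ℓ j) =
      Real.cosh (κ * ℓ j / 2) ^ 2 + Real.sinh (κ * ℓ j / 2) ^ 2 := fun j => by
    rw [← Real.cosh_two_mul]; ring_nf
  have hss : ∀ j, 0 < Real.sinh (κ * ℓ j) := fun j => by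
    rw [es]; have := hsh j; have := hch j; positivity
  have hsq : ∀ j, -κ ^ 2 * (Real.sinh (κ * ℓ j) / κ) = -(κ * Real.sinh (κ * ℓ j)) := fun j => by
    field_simp
  rw [mem_deltaPrimeSSpectrum_iff hℓ (isFundamentalSystem_cosh hκ.ne')
    (fun j => by rw [hsq]; exact neg_ne_zero.2 (mul_pos hκ (hss j)).ne'), vertexDiagonal]
  simp only [hsq]
  rw [← mul_le_mul_iff_right₀ (abs_pos.2 hκ.ne'), ← abs_mul]
  have e1 : κ * (∑ j, 2 * Real.cosh (κ * ℓ j) / -(κ * Real.sinh (κ * ℓ j)) - D) =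
      -(∑ j, (Real.tanh (κ * ℓ j / 2) + (Real.tanh (κ * ℓ j / 2))⁻¹)) - κ * D := by
    simp only [Fin.sum_univ_two, Real.tanh_eq_sinh_div_cosh, es, ec]
    have := (hsh 0).ne'
    have := (hsh 1).ne'
    have := (hch 0).ne'
    have := (hch 1).ne'
    field_simp
    ring
  have e2 : |κ| * ∑ j, 2 * |(-(κ * Real.sinh (κ * ℓ j)))⁻¹| =
      ∑ j, ((Real.tanh (κ * ℓ j / 2))⁻¹ - Real.tanh (κ * ℓ j / 2)) := by
    have h1 : ∀ j, |(-(κ * Real.sinh (κ * ℓ j)))⁻¹| = (κ * Real.sinh (κ * ℓ j))⁻¹ := fun j => by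
      rw [abs_inv, abs_neg, abs_of_pos (mul_pos hκ (hss j))]
    simp only [h1, abs_of_pos hκ]
    simp only [Fin.sum_univ_two, Real.tanh_eq_sinh_div_cosh, es]
    have := (hsh 0).ne'
    have := (hsh 1).ne'
    have := (hch 0).ne'
    have := (hch 1).ne'
    have h3 := Real.cosh_sq (κ * ℓ 0 / 2)
    have h4 := Real.cosh_sq (κ * ℓ 1 / 2)
    field_simp
    rw [h3, h4]
    ring
  rw [e1, e2, abs_le]
  simp only [Fin.sum_univ_two]
  constructor
  · rintro ⟨h2, h3⟩
    constructor <;> linarith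
  · rintro ⟨h2, h3⟩
    constructor <;> linarith

/-! ### Numbering the components of a closed set -/

theorem exists_maximal_interval {S : Set ℝ} (hS : IsClosed S) (hb : BddBelow S)
    (hgap : ∀ R, ∃ x, R < x ∧ x ∉ S) {p : ℝ} (hp : p ∈ S) :
    ∃ lo hi, lo ≤ p ∧ p ≤ hi ∧ Icc lo hi ⊆ S ∧
      ∀ x y, x ≤ p → p ≤ y → Icc x y ⊆ S → lo ≤ x ∧ y ≤ hi := by
  obtain ⟨b, hb⟩ := hb
  obtain ⟨g, hpg, hg⟩ := hgap p
  set U : Set ℝ := {y | p ≤ y ∧ Icc p y ⊆ S} with hU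
  set V : Set ℝ := {x | x ≤ p ∧ Icc x p ⊆ S} with hV
  have hpU : p ∈ U := ⟨le_rfl, by simpa using hp⟩
  have hpV : p ∈ V := ⟨le_rfl, by simpa using hp⟩
  have hUb : BddAbove U := ⟨g, fun y hy => by
    by_contra h
    exact hg (hy.2 ⟨hpg.le, (not_le.1 h).le⟩)⟩
  have hVb : BddBelow V := ⟨b, fun x hx => hb (hx.2 ⟨le_rfl, hx.1⟩)⟩
  have h1 : p ≤ sSup U := le_csSup hUb hpU
  have h2 : sInf V ≤ p := csInf_le hVb hpV
  have hUS : Icc p (sSup U) ⊆ S := by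
    rcases h1.eq_or_lt with h | h
    · rw [← h]; simpa using hp
    · rw [← closure_Ico h.ne]
      refine closure_minimal (fun z hz => ?_) hS
      obtain ⟨y, hy, hzy⟩ := exists_lt_of_lt_csSup ⟨p, hpU⟩ hz.2
      exact hy.2 ⟨hz.1, hzy.le⟩
  have hVS : Icc (sInf V) p ⊆ S := by
    rcases h2.eq_or_lt with h | h
    · rw [h]; simpa using hp
    · rw [← closure_Ioc h.ne]
      refine closure_minimal (fun z hz => ?_) hS
      obtain ⟨y, hy, hzy⟩ := exists_lt_of_csInf_lt ⟨p, hpV⟩ hz.1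
      exact hy.2 ⟨hzy.le, hz.2⟩
  refine ⟨sInf V, sSup U, h2, h1, ?_, fun x y hx hy hxy => ⟨?_, ?_⟩⟩
  · rw [← Icc_union_Icc_eq_Icc h2 h1]
    exact union_subset hVS hUS
  · exact csInf_le hVb ⟨hx, (Icc_subset_Icc_right hy).trans hxy⟩
  · exact le_csSup hUb ⟨hy, (Icc_subset_Icc_left hx).trans hxy⟩

/-- P is a discrete set meeting every component of S. Each next anchor is the first one beyond the
top of the component of its predecessor, so no component is skipped or counted twice; discreteness
makes the sequence exhaust P. -/
theorem exists_isBandStructure {S P : Set ℝ} (hS : IsClosed S) (hb : BddBelow S) (hPS : P ⊆ S)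
    (hfin : ∀ R, (P ∩ Iic R).Finite) (hunb : ∀ R, ∃ p ∈ P, R < p)
    (hanch : ∀ x ∈ S, ∃ p ∈ P, uIcc x p ⊆ S) (hnd : ∀ p ∈ P, ∃ y, y ≠ p ∧ uIcc y p ⊆ S)
    (hgap : ∀ R, ∃ x, R < x ∧ x ∉ S) :
    ∃ α β a : ℕ → ℝ, IsBandStructure S α β ∧ StrictMono a ∧ ∀ r, a r ∈ P ∧
      a r ∈ Icc (α r) (β r) ∧
      ∀ x y, x ≤ a r → a r ≤ y → Icc x y ⊆ S → α r ≤ x ∧ y ≤ β r := by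
  have hcomp : ∀ p, p ∈ P → ∃ lo hi, lo ≤ p ∧ p ≤ hi ∧ Icc lo hi ⊆ S ∧
      ∀ x y, x ≤ p → p ≤ y → Icc x y ⊆ S → lo ≤ x ∧ y ≤ hi := fun p hp =>
    exists_maximal_interval hS hb hgap (hPS hp)
  choose! lo hi hlo hhi hsub hmax using hcomp
  have hnext : ∀ b, ∃ a, a ∈ P ∧ b < a ∧ ∀ p ∈ P, b < p → a ≤ p := by
    intro b
    obtain ⟨p, hp, hbp⟩ := hunb b
    have hf : (P ∩ Ioc b p).Finite := (hfin p).subset fun x hx => ⟨hx.1, hx.2.2⟩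
    obtain ⟨a, ha, hmin⟩ := hf.exists_minimal ⟨p, hp, hbp, le_rfl⟩
    refine ⟨a, ha.1, ha.2.1, fun x hx hbx => ?_⟩
    rcases le_or_gt x p with h | h
    · by_contra hlt
      exact hlt (hmin ⟨hx, hbx, h⟩ (not_le.1 hlt).le)
    · exact ha.2.2.trans h.le
  choose nxt hnP hnlt hnmin using hnext
  obtain ⟨b, hb⟩ := hb
  -- Since b is a lower bound of S, the search from b - 1 finds the least anchor.
  set a : ℕ → ℝ := fun r => Nat.rec (nxt (b - 1)) (fun _ x => nxt (hi x)) r with ha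
  have ha0 : a 0 = nxt (b - 1) := rfl
  have has : ∀ r, a (r + 1) = nxt (hi (a r)) := fun r => rfl
  have haP : ∀ r, a r ∈ P := by
    intro r
    cases r with
    | zero => exact hnP _
    | succ r => exact hnP _
  have hahi : ∀ r, hi (a r) < a (r + 1) := fun r => hnlt _
  have hmono : StrictMono a := strictMono_nat_of_lt_succ fun r =>
    (hhi _ (haP r)).trans_lt (hahi r)
  refine ⟨fun r => lo (a r), fun r => hi (a r), a, ⟨?_, fun r => ?_, fun r => ?_⟩, hmono,
    fun r => ⟨haP r, ⟨hlo _ (haP r), hhi _ (haP r)⟩, hmax _ (haP r)⟩⟩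
  · refine Subset.antisymm (fun x hx => ?_) (iUnion_subset fun r => hsub _ (haP r))
    obtain ⟨p, hp, hxp⟩ := hanch x hx
    have hex : ∃ r, p < a r := by
      by_contra hcon
      simp only [not_exists, not_lt] at hcon
      exact (infinite_range_of_injective hmono.injective) ((hfin p).subset (by
        rintro _ ⟨r, rfl⟩
        exact ⟨haP r, hcon r⟩))
    classical
    have h1 := Nat.find_spec hex
    have h0 : Nat.find hex ≠ 0 := by
      intro h0
      rw [h0, ha0] at h1
      exact absurd (hnmin (b - 1) p hp (by linarith [hb (hPS hp)])) (not_le.2 h1)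
    obtain ⟨r, hr⟩ := Nat.exists_eq_succ_of_ne_zero h0
    have h2 : a r ≤ p := not_lt.1 (Nat.find_min hex (m := r) (by omega))
    rw [hr, Nat.succ_eq_add_one, has] at h1
    have h3 : p ≤ hi (a r) := by
      by_contra hlt
      exact absurd (hnmin _ p hp (not_le.1 hlt)) (not_le.2 h1)
    refine mem_iUnion.2 ⟨r, ?_⟩
    have hIp : Icc (a r) (hi (a r)) ⊆ S :=
      (Icc_subset_Icc_left (hlo _ (haP r))).trans (hsub _ (haP r))
    rcases le_total x p with hx' | hx'
    · rw [uIcc_of_le hx'] at hxp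
      refine ⟨?_, hx'.trans h3⟩
      rcases le_total (a r) x with h4 | h4
      · exact (hlo _ (haP r)).trans h4
      · exact (hmax _ (haP r) x p h4 h2 hxp).1
    · rw [uIcc_of_ge hx'] at hxp
      refine ⟨(hlo _ (haP r)).trans (h2.trans hx'), ?_⟩
      refine (hmax _ (haP r) (a r) x le_rfl (h2.trans hx') ?_).2
      rw [← Icc_union_Icc_eq_Icc h2 hx']
      exact union_subset ((Icc_subset_Icc_right h3).trans hIp) hxp
  · obtain ⟨y, hy, hys⟩ := hnd _ (haP r)
    rcases lt_or_gt_of_ne hy with h | h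
    · rw [uIcc_of_le h.le] at hys
      have := (hmax _ (haP r) y (a r) h.le le_rfl hys).1
      exact (this.trans_lt h).trans_le (hhi _ (haP r))
    · rw [uIcc_of_ge h.le] at hys
      have := (hmax _ (haP r) (a r) y le_rfl h.le hys).2
      exact ((hlo _ (haP r)).trans_lt h).trans_le this
  · have h1 : hi (a r) < a (r + 1) := hahi r
    by_contra hlt
    -- Touching components would put all of [a r, a (r + 1)] into S, against the maximality of `hi
    -- (a r)`.
    have hlt : lo (a (r + 1)) ≤ hi (a r) := not_lt.1 hlt
    have h2 : Icc (a r) (a (r + 1)) ⊆ S := by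
      rw [← Icc_union_Icc_eq_Icc (hhi _ (haP r)) h1.le]
      refine union_subset ((Icc_subset_Icc_left (hlo _ (haP r))).trans (hsub _ (haP r))) ?_
      exact (Icc_subset_Icc hlt (hhi _ (haP (r + 1)))).trans (hsub _ (haP (r + 1)))
    exact absurd (hmax _ (haP r) (a r) (a (r + 1)) le_rfl (hmono (Nat.lt_succ_self r)).le h2).2
      (not_le.2 h1)

/-! ### Estimates for the cotangent, and passage to the zeros of the sines -/

theorem cot_le_inv {x : ℝ} (h0 : 0 < x) (h1 : x ≤ Real.pi / 2) : Real.cot x ≤ x⁻¹ := by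
  rcases h1.eq_or_lt with h | h
  · rw [Real.cot_eq_cos_div_sin, h, Real.cos_pi_div_two, zero_div, ← h]
    positivity
  · have ht := Real.lt_tan h0 h
    rw [← inv_inv (Real.cot x), Real.cot_inv_eq_tan]
    exact inv_anti₀ h0 ht.le

theorem inv_sub_le_cot {x : ℝ} (h0 : 0 < x) (h1 : x ≤ 1) : x⁻¹ - x ≤ Real.cot x := by
  have hs : 0 < Real.sin x := Real.sin_pos_of_pos_of_le_one h0 h1
  have hs' : Real.sin x ≤ x := Real.sin_le h0.le
  have hc := Real.one_sub_sq_div_two_le_cos (x := x)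
  have hxx : 0 ≤ 1 - x ^ 2 := by nlinarith
  rw [Real.cot_eq_cos_div_sin, le_div_iff₀ hs]
  have h2 : x⁻¹ - x = (1 - x ^ 2) / x := by field_simp
  rw [h2, div_mul_eq_mul_div, div_le_iff₀ h0]
  nlinarith [mul_le_mul_of_nonneg_left hs' hxx, mul_le_mul_of_nonneg_right hc h0.le]

theorem continuousAt_cot {x : ℝ} (h0 : 0 < x) (h1 : x < Real.pi) : ContinuousAt Real.cot x := by
  have : Real.cot = fun x => Real.cos x / Real.sin x := funext Real.cot_eq_cos_div_sin
  rw [this]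
  exact Real.continuous_cos.continuousAt.div Real.continuous_sin.continuousAt
    (Real.sin_pos_of_pos_of_lt_pi h0 h1).ne'

theorem piMod_sub {t s : ℝ} (h0 : 0 ≤ s) (h1 : s < piMod t) : piMod (t - s) = piMod t - s := by
  obtain ⟨n, hn⟩ := exists_eq_piMod_add t
  refine piMod_eq_of (n := n) (by linarith) (by linarith [piMod_le t]) ?_
  linarith

theorem halfCot_sub {t s : ℝ} (h0 : 0 ≤ s) (h1 : s < piMod t) :
    halfCot (t - s) = Real.cot ((piMod t - s) / 2) := by
  rw [halfCot, piMod_sub h0 h1]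

theorem halfCot_int_mul_pi_add {s : ℝ} (h0 : 0 < s) (h1 : s ≤ Real.pi) (n : ℤ) :
    halfCot (n * Real.pi + s) = Real.cot (s / 2) := by
  rw [halfCot, piMod_eq_of (n := n) h0 h1 (by ring)]

theorem halfCot_int_mul_pi (n : ℤ) : halfCot (n * Real.pi) = 0 := by
  rw [halfCot, piMod_eq_of (n := n - 1) Real.pi_pos le_rfl (by push_cast; ring),
    Real.cot_eq_cos_div_sin, Real.cos_pi_div_two, zero_div]

theorem halfCot_le (t : ℝ) : halfCot t ≤ 2 / piMod t := by
  have := cot_le_inv (x := piMod t / 2) (by linarith [piMod_pos t]) (by linarith [piMod_le t])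
  rwa [inv_div] at this

theorem countable_sin_eq_zero {l : ℝ} (hl : 0 < l) : {q : ℝ | Real.sin (q * l) = 0}.Countable := by
  refine (countable_range fun n : ℤ => (n : ℝ) * Real.pi / l).mono fun q hq => ?_
  obtain ⟨n, hn⟩ := Real.sin_eq_zero_iff.1 hq
  exact ⟨n, by simp only []; rw [hn]; field_simp⟩

/-- The zeros of the sines are countable, so the remaining points are dense, and the spectrum is
closed. -/
theorem sq_mem_of_forall_Ioo {ℓ : Fin 2 → ℝ} (hℓ : ∀ j, 0 < ℓ j) {D x y : ℝ} (hxy : x < y)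
    (h : ∀ q ∈ Ioo x y, (∀ j, Real.sin (q * ℓ j) ≠ 0) → q ^ 2 ∈ deltaPrimeSSpectrum ℓ D) :
    ∀ q ∈ Icc x y, q ^ 2 ∈ deltaPrimeSSpectrum ℓ D := by
  have hc : {q : ℝ | ∃ j, Real.sin (q * ℓ j) = 0}.Countable := by
    have : {q : ℝ | ∃ j, Real.sin (q * ℓ j) = 0} = ⋃ j, {q : ℝ | Real.sin (q * ℓ j) = 0} := by
      ext q; simp
    rw [this]
    exact countable_iUnion fun j => countable_sin_eq_zero (hℓ j)
  have hcl : IsClosed {q : ℝ | q ^ 2 ∈ deltaPrimeSSpectrum ℓ D} :=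
    (isClosed_deltaPrimeSSpectrum ℓ D).preimage (continuous_pow 2)
  have h1 : Ioo x y ⊆ {q : ℝ | q ^ 2 ∈ deltaPrimeSSpectrum ℓ D} := by
    refine ((hc.dense_compl ℝ).open_subset_closure_inter isOpen_Ioo).trans
      (closure_minimal ?_ hcl)
    rintro q ⟨hq, hq'⟩
    refine h q hq fun j hj => hq' ⟨j, hj⟩
  intro q hq
  rw [← closure_Ioo hxy.ne] at hq
  exact closure_minimal h1 hcl hq

/-- `halfCot` is continuous from the left, with value 0 at multiples of π. A limit from the left
extends the inequality to the zeros of the sines and to the end y; it fails to extend to x, which is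
why x is excluded. -/
theorem le_halfCot_of_forall_Ioo {ℓ : Fin 2 → ℝ} (hℓ : ∀ j, 0 < ℓ j) {D x y : ℝ}
    (hD : ∀ q ∈ Ioo x y, 0 < q * D)
    (h : ∀ q ∈ Ioo x y, q ^ 2 ∈ deltaPrimeSSpectrum ℓ D) :
    ∀ q ∈ Ioc x y, q * D / 2 ≤ ∑ j, halfCot (q * ℓ j) := by
  intro q hq
  have hpos := fun j => piMod_pos (q * ℓ j)
  have hle := fun j => piMod_le (q * ℓ j)
  set f : ℝ → ℝ := fun s => ∑ j, Real.cot ((piMod (q * ℓ j) - s * ℓ j) / 2) with hf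
  have hlim : Filter.Tendsto f (nhdsWithin 0 (Ioi 0)) (nhds (∑ j, halfCot (q * ℓ j))) := by
    have hcf : ContinuousAt f 0 := by
      refine tendsto_finsetSum _ fun j _ => ?_
      refine ContinuousAt.comp (f := fun s => (piMod (q * ℓ j) - s * ℓ j) / 2) (g := Real.cot)
        (continuousAt_cot ?_ ?_) (by fun_prop)
      · have := hpos j; simp; linarith
      · have := hle j; have := hpos j; simp; linarith
    have h0 : f 0 = ∑ j, halfCot (q * ℓ j) := by simp [hf, halfCot]
    rw [← h0]
    exact hcf.tendsto.mono_left nhdsWithin_le_nhds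
  have hlim2 : Filter.Tendsto (fun s => (q - s) * D / 2) (nhdsWithin 0 (Ioi 0))
      (nhds (q * D / 2)) := by
    have : ContinuousAt (fun s : ℝ => (q - s) * D / 2) 0 := by fun_prop
    have h2 := this.tendsto
    rw [sub_zero] at h2
    exact h2.mono_left nhdsWithin_le_nhds
  refine le_of_tendsto_of_tendsto hlim2 hlim ?_
  have e1 : ∀ j, ∀ᶠ s in nhdsWithin (0 : ℝ) (Ioi 0), s < piMod (q * ℓ j) / ℓ j := fun j =>
    nhdsWithin_le_nhds (Iio_mem_nhds (div_pos (hpos j) (hℓ j)))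
  have e2 : ∀ᶠ s in nhdsWithin (0 : ℝ) (Ioi 0), s < q - x :=
    nhdsWithin_le_nhds (Iio_mem_nhds (sub_pos.2 hq.1))
  filter_upwards [e1 0, e1 1, e2, self_mem_nhdsWithin] with s h0 h1 h2 h3
  have h3 : 0 < s := h3
  have hs : ∀ j, s * ℓ j < piMod (q * ℓ j) := Fin.forall_fin_two.2
    ⟨(lt_div_iff₀ (hℓ 0)).1 h0, (lt_div_iff₀ (hℓ 1)).1 h1⟩
  have hmem : q - s ∈ Ioo x y := ⟨by linarith, by linarith [hq.2]⟩
  have hmul : ∀ j, (q - s) * ℓ j = q * ℓ j - s * ℓ j := fun j => by ring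
  have hsl : ∀ j, 0 < s * ℓ j := fun j => mul_pos h3 (hℓ j)
  have hne : ∀ j, Real.sin ((q - s) * ℓ j) ≠ 0 := fun j => by
    rw [sin_ne_zero_iff_piMod, hmul, piMod_sub (hsl j).le (hs j)]
    linarith [hle j, hsl j]
  refine ((sq_mem_deltaPrimeSSpectrum_iff hℓ (hD _ hmem) hne).1 (h _ hmem)).trans (le_of_eq ?_)
  refine Finset.sum_congr rfl fun j _ => ?_
  rw [hmul, halfCot_sub (hsl j).le (hs j)]

/-! ### Upper bounds for the band widths -/

set_option maxHeartbeats 400000 in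
-- δA and δB are the distances from y back to the preceding anchors of the two families; by
-- assumption the B-anchor is the nearer one. The alternative is whether that anchor lies inside the
-- interval.
theorem band_width_aux {A B κ x y : ℝ} (hA : 0 < A) (hB : 0 < B) (hκ : 1 < κ)
    (hκ' : B / A ≤ Real.pi / 4 * κ) (hxy : x < y)
    (hδ : piMod (y * B) / B ≤ piMod (y * A) / A)
    (h : ∀ q ∈ Ioc x y, κ ≤ halfCot (q * A) + halfCot (q * B)) :
    κ * (y - x) ≤ 2 / A + 2 / B ∨
      (κ * (y - x) ≤ (2 * (2 / A) + 2 / B + √((2 / B) ^ 2 + 4 * (2 / A) * (2 / B))) / 2 ∧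
        ∃ m n : ℤ, 0 < n * Real.pi / B - m * Real.pi / A ∧
          κ * (n * Real.pi / B - m * Real.pi / A) ≤ 2 / A) := by
  have hκ0 : 0 < κ := by linarith
  set a : ℝ := 2 / A with ha
  set b : ℝ := 2 / B with hb
  have ha0 : 0 < a := by positivity
  have hb0 : 0 < b := by positivity
  set δA : ℝ := piMod (y * A) / A with hδA
  set δB : ℝ := piMod (y * B) / B with hδB
  have hA1 : piMod (y * A) = δA * A := by rw [hδA]; field_simp
  have hB1 : piMod (y * B) = δB * B := by rw [hδB]; field_simp
  have hδA0 : 0 < δA := div_pos (piMod_pos _) hA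
  have hδB0 : 0 < δB := div_pos (piMod_pos _) hB
  obtain ⟨m, hm⟩ := exists_eq_piMod_add (y * A)
  obtain ⟨n, hn⟩ := exists_eq_piMod_add (y * B)
  rw [hA1] at hm
  rw [hB1] at hn
  have hcA : ∀ s, 0 < s → s * A ≤ Real.pi → Real.cot (s * A / 2) ≤ a / s := fun s hs hs' => by
    refine (cot_le_inv (by positivity) (by linarith)).trans (le_of_eq ?_)
    rw [ha]; field_simp
  have hy := h y ⟨hxy, le_rfl⟩
  have hyA : halfCot (y * A) ≤ a / δA := by
    refine (halfCot_le _).trans (le_of_eq ?_)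
    rw [hA1, ha]; field_simp
  have hyB : halfCot (y * B) ≤ b / δB := by
    refine (halfCot_le _).trans (le_of_eq ?_)
    rw [hB1, hb]; field_simp
  -- If the B-anchor is not beyond x, then y - x ≤ δB ≤ δA, and the inequality at y gives κ ≤ (a +
  -- b)/δB.
  rcases le_or_gt (y - δB) x with hx | hx
  · left
    have h1 : a / δA ≤ a / δB := div_le_div_of_nonneg_left ha0.le hδB0 hδ
    have h2 : κ ≤ (a + b) / δB := by rw [add_div]; linarith
    rw [le_div_iff₀ hδB0] at h2
    nlinarith
  right
  have hrB : (y - δB) * B = n * Real.pi := by linarith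
  have hrA : (y - δA) * A = m * Real.pi := by linarith
  -- At the B-anchor the B-term is 0, so the A-term alone must reach κ: the two anchors are at most
  -- a/κ apart.
  have h1 := h (y - δB) ⟨hx, by linarith⟩
  rw [hrB, halfCot_int_mul_pi, add_zero] at h1
  set η : ℝ := δA - δB with hη
  have hη0 : 0 < η := by
    rcases hδ.eq_or_lt with he | hlt
    · rw [he, hrA, halfCot_int_mul_pi] at h1
      linarith
    · exact sub_pos.2 hlt
  have hηA : η * A ≤ Real.pi := by
    have := piMod_le (y * A)
    rw [hA1] at this
    nlinarith [mul_pos hδB0 hA]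
  have hηa : κ * η ≤ a := by
    have e1 : (y - δB) * A = m * Real.pi + η * A := by rw [← hrA, hη]; ring
    rw [e1, halfCot_int_mul_pi_add (by positivity) hηA] at h1
    have := h1.trans (hcA η hη0 hηA)
    rwa [le_div_iff₀ hη0] at this
  have hrr : n * Real.pi / B - m * Real.pi / A = η := by
    rw [← hrB, ← hrA, hη]; field_simp; ring
  refine ⟨?_, m, n, by rw [hrr]; exact hη0, by rw [hrr]; exact hηa⟩
  rcases le_or_gt (y - δA) x with hx' | hx'
  -- Here κ(y - x) ≤ Y = κδA. The inequality at y, with κη ≤ a, gives 1 ≤ a/Y + b/(Y - a) when Y >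
  -- a, i.e. Y² - (2a + b)Y + a² ≤ 0. R is the larger root.
  · set R : ℝ := (2 * a + b + √(b ^ 2 + 4 * a * b)) / 2 with hR
    have hRsq : R ^ 2 - (2 * a + b) * R + a ^ 2 = 0 := by
      have := Real.sq_sqrt (by positivity : 0 ≤ b ^ 2 + 4 * a * b)
      rw [hR]
      linear_combination this / 4
    have hRpos := Real.sqrt_nonneg (b ^ 2 + 4 * a * b)
    set Y : ℝ := κ * δA with hY
    have h2 : κ * (y - x) ≤ Y := by rw [hY]; gcongr; linarith
    refine h2.trans ?_
    by_contra hcon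
    have hcon : R < Y := not_le.1 hcon
    have hYa : 0 < Y - a := by linarith
    have h3 : b / δB ≤ κ * (b / (Y - a)) := by
      rw [← mul_div_assoc, div_le_div_iff₀ hδB0 hYa]
      have : Y - a ≤ κ * δB := by
        have : κ * δB = Y - κ * η := by rw [hY, hη]; ring
        linarith
      calc b * (Y - a) ≤ b * (κ * δB) := mul_le_mul_of_nonneg_left this hb0.le
        _ = κ * b * δB := by ring
    have h4 : a / δA = κ * (a / Y) := by rw [hY]; field_simp
    have hY0 : 0 < Y := by positivity
    have h5 : 1 ≤ a / Y + b / (Y - a) := by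
      have : κ * 1 ≤ κ * (a / Y + b / (Y - a)) := by linarith
      exact le_of_mul_le_mul_left this hκ0
    rw [div_add_div _ _ hY0.ne' hYa.ne', le_div_iff₀ (mul_pos hY0 hYa)] at h5
    have h6 : 0 < (Y - R) * (Y + R - (2 * a + b)) :=
      mul_pos (by linarith) (by linarith [hR])
    linarith
  -- The A-anchor cannot lie inside as well: there the A-term is 0, and the B-term is near the end
  -- of its period, at most cot(π/4) = 1 < κ.
  · exfalso
    have h2 := h (y - δA) ⟨hx', by linarith⟩
    have hηB : η * B ≤ Real.pi / 2 := by
      have e1 : κ * (η * B) ≤ κ * (Real.pi / 2) := by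
        calc κ * (η * B) = κ * η * B := by ring
          _ ≤ a * B := by gcongr
          _ = 2 * (B / A) := by rw [ha]; ring
          _ ≤ κ * (Real.pi / 2) := by linarith
      exact le_of_mul_le_mul_left e1 hκ0
    have hηB0 : 0 < η * B := by positivity
    have e2 : (y - δA) * B = ((n - 1 : ℤ) : ℝ) * Real.pi + (Real.pi - η * B) := by
      push_cast
      rw [hη]
      linear_combination hrB
    rw [hrA, halfCot_int_mul_pi, e2, halfCot_int_mul_pi_add (by linarith [Real.pi_pos]) (by linarith),
      zero_add] at h2
    have e3 : Real.cot ((Real.pi - η * B) / 2) ≤ 1 := by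
      have e4 : (Real.pi - η * B) / 2 = Real.pi / 2 - η * B / 2 := by ring
      rw [e4, Real.cot_eq_cos_div_sin, Real.cos_pi_div_two_sub, Real.sin_pi_div_two_sub,
        ← Real.tan_eq_sin_div_cos, ← Real.tan_pi_div_four]
      exact Real.strictMonoOn_tan.monotoneOn ⟨by linarith, by linarith⟩
        ⟨by linarith [Real.pi_pos], by linarith [Real.pi_pos]⟩ (by linarith)
    linarith

theorem one_le_conspiracyG {θ : ℝ} (hθ : 0 < θ) : 1 ≤ conspiracyG θ := by
  rw [conspiracyG, le_div_iff₀ (by positivity)]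
  have : 1 ≤ √(1 + 4 * θ) := Real.one_le_sqrt.2 (by linarith)
  linarith

/-- The bound (2θ + 5)/3 is the tangent of √(1 + 4θ) at θ = 2. -/
theorem conspiracyG_le {θ : ℝ} (hθ : 0 < θ) : conspiracyG θ ≤ 4 / 3 := by
  rw [conspiracyG, div_le_div_iff₀ (by positivity) (by norm_num)]
  have : √(1 + 4 * θ) ≤ (2 * θ + 5) / 3 :=
    Real.sqrt_le_iff.2 ⟨by positivity, by nlinarith [sq_nonneg (θ - 2)]⟩
  linarith

theorem conspiracyG_eq_iff {θ : ℝ} (hθ : 0 < θ) : conspiracyG θ = 4 / 3 ↔ θ = 2 := by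
  rw [conspiracyG, div_eq_div_iff (by positivity) (by norm_num)]
  constructor
  · intro h
    have h1 : √(1 + 4 * θ) = (2 * θ + 5) / 3 := by linarith
    have h2 := Real.sq_sqrt (by positivity : 0 ≤ 1 + 4 * θ)
    rw [h1] at h2
    have h3 : (θ - 2) ^ 2 = 0 := by linarith
    linarith [pow_eq_zero_iff (two_ne_zero) |>.1 h3]
  · rintro rfl
    have : √(1 + 4 * 2) = 3 := by
      rw [Real.sqrt_eq_iff_mul_self_eq (by norm_num) (by norm_num)]; norm_num
    rw [this]; norm_num

theorem one_le_conspiracyE {θ : ℝ} (hθ : 0 < θ) : 1 ≤ conspiracyE θ :=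
  (one_le_conspiracyG hθ).trans (le_max_left _ _)

theorem conspiracyE_le {θ : ℝ} (hθ : 0 < θ) : conspiracyE θ ≤ 4 / 3 :=
  max_le (conspiracyG_le hθ) (conspiracyG_le (inv_pos.2 hθ))

theorem conspiracyE_eq_iff {θ : ℝ} (hθ : 0 < θ) :
    conspiracyE θ = 4 / 3 ↔ θ = 2 ∨ θ = 1 / 2 := by
  have h1 := conspiracyG_eq_iff hθ
  have h2 := conspiracyG_eq_iff (inv_pos.2 hθ)
  have h3 : θ⁻¹ = 2 ↔ θ = 1 / 2 := by
    rw [inv_eq_iff_eq_inv, one_div]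
  rw [← h1, ← h3, ← h2, conspiracyE]
  have h4 := conspiracyG_le hθ
  have h5 := conspiracyG_le (inv_pos.2 hθ)
  rcases le_total (conspiracyG θ) (conspiracyG θ⁻¹) with h | h
  · rw [max_eq_right h]
    exact ⟨Or.inr, fun h' => h'.elim (fun e => le_antisymm h5 (e ▸ h)) id⟩
  · rw [max_eq_left h]
    exact ⟨Or.inl, fun h' => h'.elim id fun e => le_antisymm h4 (e ▸ h)⟩

theorem root_eq_conspiracyG {A B : ℝ} (hA : 0 < A) (hB : 0 < B) :
    (2 * (2 / A) + 2 / B + √((2 / B) ^ 2 + 4 * (2 / A) * (2 / B))) / 2 =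
      (2 / A + 2 / B) * conspiracyG (B / A) := by
  have h1 : √((2 / B) ^ 2 + 4 * (2 / A) * (2 / B)) = 2 / B * √(1 + 4 * (B / A)) := by
    rw [← Real.sqrt_sq (by positivity : 0 ≤ 2 / B), ← Real.sqrt_mul (by positivity),
      Real.sqrt_sq (by positivity : 0 ≤ 2 / B)]
    congr 1
    field_simp
  rw [h1, conspiracyG]
  have : 0 < B / A := by positivity
  have h3 : 2 * (2 / A) + 2 / B + 2 / B * √(1 + 4 * (B / A)) =
      2 / B * (2 * (B / A) + 1 + √(1 + 4 * (B / A))) := by field_simp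
  have h4 : 2 / A + 2 / B = 2 / B * (B / A + 1) := by field_simp
  rw [h3, h4]
  generalize √(1 + 4 * (B / A)) = r
  field_simp

theorem exists_band_width_bound {ℓ : Fin 2 → ℝ} (hℓ : ∀ j, 0 < ℓ j) :
    ∃ κ₀ : ℝ, 0 < κ₀ ∧ ∀ κ, κ₀ ≤ κ → ∀ x y, x < y →
      (∀ q ∈ Ioc x y, κ ≤ ∑ j, halfCot (q * ℓ j)) →
      κ * (y - x) ≤ 2 * ((ℓ 0)⁻¹ + (ℓ 1)⁻¹) * conspiracyE (ℓ 1 / ℓ 0) ∧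
      (ℓ 1 / ℓ 0 = 2 ∨ ℓ 1 / ℓ 0 = 1 / 2 → κ * (y - x) ≤ 2 * ((ℓ 0)⁻¹ + (ℓ 1)⁻¹)) := by
  have h0 := hℓ 0
  have h1 := hℓ 1
  have hπ := Real.pi_pos
  -- If one length is twice the other, all anchors are multiples of π/max(A, B), so distinct ones
  -- are at least that far apart. For large κ this contradicts a distance of at most 2/(Aκ).
  have hsep : ∀ A B : ℝ, 0 < A → 0 < B → (A = 2 * B ∨ B = 2 * A) → ∀ κ : ℝ, 0 < κ →
      2 * max A B / (A * Real.pi) < κ →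
      ¬ ∃ m n : ℤ, 0 < n * Real.pi / B - m * Real.pi / A ∧
          κ * (n * Real.pi / B - m * Real.pi / A) ≤ 2 / A := by
    rintro A B hA hB hAB κ hκ hκ1 ⟨m, n, hp, hle⟩
    have hgap : Real.pi / max A B ≤ n * Real.pi / B - m * Real.pi / A := by
      rcases hAB with h | h
      · have e : n * Real.pi / B - m * Real.pi / A = ((2 * n - m : ℤ) : ℝ) * (Real.pi / A) := by
          rw [h]; push_cast; field_simp
        have hi : (1 : ℝ) ≤ ((2 * n - m : ℤ) : ℝ) := by
          rw [e] at hp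
          have := pos_of_mul_pos_left hp (by positivity)
          exact_mod_cast this
        rw [e, max_eq_left (by linarith)]
        exact le_mul_of_one_le_left (by positivity) hi
      · have e : n * Real.pi / B - m * Real.pi / A = ((n - 2 * m : ℤ) : ℝ) * (Real.pi / B) := by
          rw [h]; push_cast; field_simp
        have hi : (1 : ℝ) ≤ ((n - 2 * m : ℤ) : ℝ) := by
          rw [e] at hp
          have := pos_of_mul_pos_left hp (by positivity)
          exact_mod_cast this
        rw [e, max_eq_right (by linarith)]
        exact le_mul_of_one_le_left (by positivity) hi
    have hM : 0 < max A B := lt_max_of_lt_left hA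
    have h2 : κ * (Real.pi / max A B) ≤ 2 / A := (mul_le_mul_of_nonneg_left hgap hκ.le).trans hle
    rw [← mul_div_assoc, div_le_div_iff₀ hM hA] at h2
    rw [div_lt_iff₀ (by positivity)] at hκ1
    linarith
  -- The 2 gives κ > 1; the next two terms give the ratio condition of `band_width_aux` for both
  -- orders of the lengths, the last two the threshold of `hsep`.
  set κ₀ : ℝ := 2 + ℓ 1 / ℓ 0 * (4 / Real.pi) + ℓ 0 / ℓ 1 * (4 / Real.pi) +
    2 * max (ℓ 0) (ℓ 1) / (ℓ 0 * Real.pi) + 2 * max (ℓ 1) (ℓ 0) / (ℓ 1 * Real.pi) with hκ₀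
  have p1 : 0 < ℓ 1 / ℓ 0 * (4 / Real.pi) := by positivity
  have p2 : 0 < ℓ 0 / ℓ 1 * (4 / Real.pi) := by positivity
  have p3 : 0 < 2 * max (ℓ 0) (ℓ 1) / (ℓ 0 * Real.pi) := by
    have : 0 < max (ℓ 0) (ℓ 1) := lt_max_of_lt_left h0
    positivity
  have p4 : 0 < 2 * max (ℓ 1) (ℓ 0) / (ℓ 1 * Real.pi) := by
    have : 0 < max (ℓ 1) (ℓ 0) := lt_max_of_lt_left h1
    positivity
  refine ⟨κ₀, by positivity, fun κ hκ x y hxy h => ?_⟩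
  have hθ : 0 < ℓ 1 / ℓ 0 := by positivity
  have hk1 : ℓ 1 / ℓ 0 ≤ Real.pi / 4 * κ := by
    have : ℓ 1 / ℓ 0 * (4 / Real.pi) ≤ κ := by linarith
    rw [← mul_div_assoc, div_le_iff₀ hπ] at this
    linarith
  have hk2 : ℓ 0 / ℓ 1 ≤ Real.pi / 4 * κ := by
    have : ℓ 0 / ℓ 1 * (4 / Real.pi) ≤ κ := by linarith
    rw [← mul_div_assoc, div_le_iff₀ hπ] at this
    linarith
  have hU : 2 * ((ℓ 0)⁻¹ + (ℓ 1)⁻¹) = 2 / ℓ 0 + 2 / ℓ 1 := by ring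
  have hU0 : 0 < 2 / ℓ 0 + 2 / ℓ 1 := by positivity
  have hspec : ℓ 1 / ℓ 0 = 2 ∨ ℓ 1 / ℓ 0 = 1 / 2 → ℓ 0 = 2 * ℓ 1 ∨ ℓ 1 = 2 * ℓ 0 := by
    rintro (h | h)
    · right
      rwa [div_eq_iff h0.ne'] at h
    · left
      rw [div_eq_iff h0.ne'] at h
      linarith
  rw [hU]
  have he := one_le_conspiracyE hθ
  simp only [Fin.sum_univ_two] at h
  have hfin : ∀ g, κ * (y - x) ≤ (2 / ℓ 0 + 2 / ℓ 1) * g → g ≤ conspiracyE (ℓ 1 / ℓ 0) →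
      κ * (y - x) ≤ (2 / ℓ 0 + 2 / ℓ 1) * conspiracyE (ℓ 1 / ℓ 0) := fun g hg hge =>
    hg.trans (mul_le_mul_of_nonneg_left hge hU0.le)
  rcases le_total (piMod (y * ℓ 1) / ℓ 1) (piMod (y * ℓ 0) / ℓ 0) with hδ | hδ
  · rcases band_width_aux h0 h1 (by linarith) hk1 hxy hδ h with h2 | ⟨h2, h3⟩
    · exact ⟨hfin 1 (by linarith) he, fun _ => h2⟩
    · rw [root_eq_conspiracyG h0 h1] at h2
      refine ⟨hfin _ h2 (le_max_left _ _), fun hs => ?_⟩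
      exact absurd h3 (hsep _ _ h0 h1 (hspec hs) κ (by linarith) (by linarith))
  · rcases band_width_aux h1 h0 (by linarith) hk2 hxy hδ
      (fun q hq => by rw [add_comm]; exact h q hq) with h2 | ⟨h2, h3⟩
    · exact ⟨hfin 1 (by linarith) he, fun _ => by linarith⟩
    · rw [root_eq_conspiracyG h1 h0, add_comm (2 / ℓ 1)] at h2
      refine ⟨hfin _ h2 ?_, fun hs => ?_⟩
      · rw [← inv_div (ℓ 1) (ℓ 0)]; exact le_max_right _ _
      · exact absurd h3 (hsep _ _ h1 h0 (hspec hs).symm κ (by linarith) (by linarith))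

/-- On the band |qD|/2 is at least κ = |D|k/2, so κ(k' - k) ≤ U. In k'² - k² = 2k(k' - k) + (k' -
k)² the first term is at most 4U/|D| and the second is O(1/k). For D < 0 the mirrored interval from
-k' to -k is used. -/
theorem exists_energy_width_bound {ℓ : Fin 2 → ℝ} (hℓ : ∀ j, 0 < ℓ j) {D : ℝ} (hD : D ≠ 0) :
    ∃ k₀ C : ℝ, 1 ≤ k₀ ∧ 0 ≤ C ∧ ∀ k k', k₀ ≤ k → k < k' →
      Icc (k ^ 2) (k' ^ 2) ⊆ deltaPrimeSSpectrum ℓ D →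
      k' - k ≤ C / k ∧
      k' ^ 2 - k ^ 2 ≤ 8 / |D| * ((ℓ 0)⁻¹ + (ℓ 1)⁻¹) * conspiracyE (ℓ 1 / ℓ 0) + C / k ∧
      (ℓ 1 / ℓ 0 = 2 ∨ ℓ 1 / ℓ 0 = 1 / 2 →
        k' ^ 2 - k ^ 2 ≤ 8 / |D| * ((ℓ 0)⁻¹ + (ℓ 1)⁻¹) + C / k) := by
  obtain ⟨κ₀, hκ₀, hw⟩ := exists_band_width_bound hℓ
  have hD0 : 0 < |D| := abs_pos.2 hD
  have hθ : 0 < ℓ 1 / ℓ 0 := div_pos (hℓ 1) (hℓ 0)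
  have he := one_le_conspiracyE hθ
  set V : ℝ := 2 * ((ℓ 0)⁻¹ + (ℓ 1)⁻¹) with hV
  have hV0 : 0 < V := by
    have := hℓ 0; have := hℓ 1; positivity
  set U : ℝ := V * conspiracyE (ℓ 1 / ℓ 0) with hU
  have hVU : V ≤ U := le_mul_of_one_le_right hV0.le he
  have hU0 : 0 < U := hV0.trans_le hVU
  refine ⟨1 + 2 * κ₀ / |D|, 2 * U / |D| + (2 * U / |D|) ^ 2, by
    have : 0 < 2 * κ₀ / |D| := by positivity
    linarith, by positivity, fun k k' hk hkk' hsub => ?_⟩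
  have hk1 : 1 ≤ k := by
    have : 0 < 2 * κ₀ / |D| := by positivity
    linarith
  have hk0 : 0 < k := by linarith
  have hκ : κ₀ ≤ |D| * k / 2 := by
    have : 2 * κ₀ / |D| ≤ k := by linarith
    rw [div_le_iff₀ hD0] at this
    linarith
  have hmem : ∀ q : ℝ, k ≤ |q| → |q| ≤ k' → q ^ 2 ∈ deltaPrimeSSpectrum ℓ D := by
    intro q h1 h2
    refine hsub ⟨?_, ?_⟩
    · rw [← sq_abs q]; exact pow_le_pow_left₀ hk0.le h1 2
    · rw [← sq_abs q]; exact pow_le_pow_left₀ (abs_nonneg q) h2 2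
  have key : |D| * k / 2 * (k' - k) ≤ U ∧ (ℓ 1 / ℓ 0 = 2 ∨ ℓ 1 / ℓ 0 = 1 / 2 →
      |D| * k / 2 * (k' - k) ≤ V) := by
    rcases lt_or_gt_of_ne hD with hneg | hpos
    · have hab : |D| = -D := abs_of_neg hneg
      have h1 := le_halfCot_of_forall_Ioo hℓ (D := D) (x := -k') (y := -k)
        (fun q hq => mul_pos_of_neg_of_neg (by linarith [hq.2]) hneg)
        (fun q hq => hmem q (by rw [abs_of_neg (by linarith [hq.2])]; linarith [hq.2])
          (by rw [abs_of_neg (by linarith [hq.2])]; linarith [hq.1]))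
      have h2 := hw _ hκ (-k') (-k) (by linarith) fun q hq => by
        refine le_trans ?_ (h1 q hq)
        rw [hab]
        nlinarith [hq.2]
      have e : -k - -k' = k' - k := by ring
      rwa [e] at h2
    · have hab : |D| = D := abs_of_pos hpos
      have h1 := le_halfCot_of_forall_Ioo hℓ (D := D) (x := k) (y := k')
        (fun q hq => mul_pos (by linarith [hq.1]) hpos)
        (fun q hq => hmem q (by rw [abs_of_pos (by linarith [hq.1])]; linarith [hq.1])
          (by rw [abs_of_pos (by linarith [hq.1])]; linarith [hq.2]))
      exact hw _ hκ k k' hkk' fun q hq => by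
        refine le_trans ?_ (h1 q hq)
        rw [hab]
        nlinarith [hq.1]
  have hgen : ∀ T, 0 < T → T ≤ U → |D| * k / 2 * (k' - k) ≤ T →
      k' - k ≤ 2 * T / |D| / k ∧
      k' ^ 2 - k ^ 2 ≤ 4 * T / |D| + (2 * U / |D| + (2 * U / |D|) ^ 2) / k := by
    intro T hT hTU h
    have h1 : k' - k ≤ 2 * T / |D| / k := by
      rw [div_div, le_div_iff₀ (by positivity)]
      linarith
    refine ⟨h1, ?_⟩
    have h2 : k' - k ≤ 2 * U / |D| / k := h1.trans (by gcongr)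
    have h3 : (k' - k) ^ 2 ≤ (2 * U / |D|) ^ 2 / k := by
      refine (pow_le_pow_left₀ (by linarith) h2 2).trans ?_
      rw [div_pow]
      gcongr
      nlinarith
    have h4 : 2 * k * (k' - k) ≤ 4 * T / |D| := by
      refine (mul_le_mul_of_nonneg_left h1 (by positivity)).trans (le_of_eq ?_)
      field_simp
      ring
    have h5 : 0 ≤ 2 * U / |D| / k := by positivity
    rw [add_div]
    nlinarith
  obtain ⟨g1, g2⟩ := hgen U hU0 le_rfl key.1
  refine ⟨g1.trans ?_, g2.trans (le_of_eq ?_), fun hs => ?_⟩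
  · gcongr
    have : 0 ≤ (2 * U / |D|) ^ 2 := by positivity
    linarith
  · rw [hU, hV]; ring
  · refine (hgen V hV0 hVU (key.2 hs)).2.trans (le_of_eq ?_)
    rw [hV]; ring

/-! ### The spectrum next to an anchor -/

/-- A lower bound, of the order `4 / (|D| ℓ |q|)`, for the length of the part of a band next to the
point `q` with `sin (q ℓ) = 0`. -/
noncomputable def anchorLength (l D q : ℝ) : ℝ :=
  2 / l / (|D| / 2 * |q| + (1 + (l / 2 + |D| / 2) * (2 / l)))

theorem anchorLength_pos {l : ℝ} (hl : 0 < l) (D q : ℝ) : 0 < anchorLength l D q := by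
  rw [anchorLength]; positivity

/-- The j-th term alone suffices, via cot x ≥ 1/x - x with x = (q - p)ℓ_j/2. The constant added to
|D||p|/2 in `anchorLength` pays for the loss -x and for the growth of |qD|/2 from p to q. -/
theorem sq_mem_right_of_anchor {ℓ : Fin 2 → ℝ} (hℓ : ∀ j, 0 < ℓ j) {D : ℝ} (n : ℤ) (j : Fin 2)
    {δ : ℝ} (hδ : 0 < δ) (hδ' : δ ≤ anchorLength (ℓ j) D (n * Real.pi / ℓ j))
    (hsign : ∀ q ∈ Ioo (n * Real.pi / ℓ j) (n * Real.pi / ℓ j + δ), 0 < q * D) :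
    ∀ q ∈ Icc (n * Real.pi / ℓ j) (n * Real.pi / ℓ j + δ), q ^ 2 ∈ deltaPrimeSSpectrum ℓ D := by
  refine sq_mem_of_forall_Ioo hℓ (by linarith) fun q hq hs => ?_
  rw [sq_mem_deltaPrimeSSpectrum_iff hℓ (hsign q hq) hs]
  set p : ℝ := n * Real.pi / ℓ j with hp
  have hl := hℓ j
  have h1 : halfCot (q * ℓ j) ≤ ∑ i, halfCot (q * ℓ i) :=
    Finset.single_le_sum (f := fun i => halfCot (q * ℓ i)) (fun i _ => halfCot_nonneg _)
      (Finset.mem_univ j)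
  refine le_trans ?_ h1
  set d : ℝ := |D| / 2 with hd
  have hd0 : 0 ≤ d := by positivity
  set c : ℝ := 1 + (ℓ j / 2 + d) * (2 / ℓ j) with hc
  have hc1 : 2 ≤ c := by
    have e : c = 2 + d * (2 / ℓ j) := by rw [hc]; field_simp; ring
    have : 0 ≤ d * (2 / ℓ j) := by positivity
    linarith
  have hden : c ≤ d * |p| + c := by
    have : 0 ≤ d * |p| := by positivity
    linarith
  have hdp : δ * (d * |p| + c) ≤ 2 / ℓ j := by
    have h2 : δ ≤ 2 / ℓ j / (d * |p| + c) := hδ'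
    rwa [le_div_iff₀ (by linarith)] at h2
  have hδc : δ * c ≤ 2 / ℓ j := (mul_le_mul_of_nonneg_left hden hδ.le).trans hdp
  have hδl : δ * ℓ j * c ≤ 2 := by
    have := mul_le_mul_of_nonneg_right hδc hl.le
    rw [div_mul_cancel₀ _ hl.ne'] at this
    linarith
  set x : ℝ := (q - p) * ℓ j / 2 with hx
  have hqp : 0 < q - p := by linarith [hq.1]
  have hqδ : q - p ≤ δ := by linarith [hq.2]
  have hx0 : 0 < x := by positivity
  have hxδ : x ≤ δ * ℓ j / 2 := by rw [hx]; gcongr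
  have hx1 : x ≤ 1 := by nlinarith [mul_pos hδ hl]
  have e1 : q * ℓ j = n * Real.pi + 2 * x := by
    rw [hx, hp]; field_simp; ring
  rw [e1, halfCot_int_mul_pi_add (by linarith) (by linarith [Real.pi_gt_three]),
    mul_div_cancel_left₀ _ two_ne_zero]
  refine le_trans ?_ (inv_sub_le_cot hx0 hx1)
  have h2 : d * |p| + c ≤ x⁻¹ := by
    have : d * |p| + c ≤ (δ * ℓ j / 2)⁻¹ := by
      rw [← one_div, le_div_iff₀ (by positivity)]
      have := mul_le_mul_of_nonneg_right hdp hl.le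
      rw [div_mul_cancel₀ _ hl.ne'] at this
      linarith
    exact this.trans (inv_anti₀ hx0 hxδ)
  have h3 : q * D / 2 ≤ d * (|p| + δ) := by
    have e2 : q * D ≤ |q| * |D| := by rw [← abs_mul]; exact le_abs_self _
    have e3 : |q| ≤ |p| + δ := by
      have : q = p + (q - p) := by ring
      rw [this]
      refine (abs_add_le _ _).trans ?_
      rw [abs_of_pos hqp]
      linarith
    have e4 := mul_le_mul_of_nonneg_right e3 (abs_nonneg D)
    rw [hd]
    linarith
  have h4 : (ℓ j / 2 + d) * δ ≤ 1 := by
    have e5 : (ℓ j / 2 + d) * (2 / ℓ j) ≤ c := by linarith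
    have e6 : (ℓ j / 2 + d) * (δ * c) ≤ (ℓ j / 2 + d) * (2 / ℓ j) := by gcongr
    have e7 : (ℓ j / 2 + d) * δ * c ≤ 1 * c := by linarith
    exact le_of_mul_le_mul_right e7 (by linarith)
  linarith

theorem uIcc_sq_subset {T : Set ℝ} {a b : ℝ} (h : ∀ q ∈ uIcc a b, q ^ 2 ∈ T) :
    uIcc (a ^ 2) (b ^ 2) ⊆ T := by
  refine (intermediate_value_uIcc (f := fun q : ℝ => q ^ 2) (by fun_prop)).trans ?_
  rintro _ ⟨q, hq, rfl⟩
  exact h q hq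

/-- For D < 0 the admissible q are negative, so the part to the right of -p lies, in energy, below
p². Hence the sign of D in the formula. -/
theorem exists_anchor_interval {ℓ : Fin 2 → ℝ} (hℓ : ∀ j, 0 < ℓ j) {D : ℝ} (hD : D ≠ 0)
    {n : ℕ} (hn : 0 < n) (j : Fin 2) {δ : ℝ} (hδ : 0 < δ) (hδp : δ < n * Real.pi / ℓ j)
    (hδ' : δ ≤ anchorLength (ℓ j) D (n * Real.pi / ℓ j)) :
    uIcc ((n * Real.pi / ℓ j + SignType.sign D * δ) ^ 2) ((n * Real.pi / ℓ j) ^ 2) ⊆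
      deltaPrimeSSpectrum ℓ D := by
  have hp : 0 < n * Real.pi / ℓ j := by
    have := hℓ j
    have := Real.pi_pos
    positivity
  rcases lt_or_gt_of_ne hD with hneg | hpos
  · have e : ((-(n : ℤ) : ℤ) : ℝ) * Real.pi / ℓ j = -(n * Real.pi / ℓ j) := by push_cast; ring
    have h := sq_mem_right_of_anchor hℓ (D := D) (-(n : ℤ)) j hδ
      (by rw [e]; rw [anchorLength, abs_neg]; exact hδ')
      (by
        rw [e]
        intro q hq
        exact mul_pos_of_neg_of_neg (by linarith [hq.2]) hneg)
    rw [e] at h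
    rw [sign_neg hneg]
    have e2 : (n * Real.pi / ℓ j + ((-1 : SignType) : ℝ) * δ) ^ 2 =
        (-(n * Real.pi / ℓ j) + δ) ^ 2 := by simp; ring
    have e3 : (n * Real.pi / ℓ j) ^ 2 = (-(n * Real.pi / ℓ j)) ^ 2 := by ring
    rw [e2, e3]
    refine uIcc_sq_subset fun q hq => h q ?_
    rwa [uIcc_of_ge (by linarith)] at hq
  · have e : ((n : ℤ) : ℝ) * Real.pi / ℓ j = n * Real.pi / ℓ j := by push_cast; ring
    have h := sq_mem_right_of_anchor hℓ (D := D) (n : ℤ) j hδ (by rw [e]; exact hδ')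
      (by
        rw [e]
        intro q hq
        exact mul_pos (by linarith [hq.1]) hpos)
    rw [e] at h
    rw [sign_pos hpos]
    have e2 : (n * Real.pi / ℓ j + ((1 : SignType) : ℝ) * δ) ^ 2 =
        (n * Real.pi / ℓ j + δ) ^ 2 := by simp
    rw [e2]
    refine uIcc_sq_subset fun q hq => h q ?_
    rwa [uIcc_of_ge (by linarith)] at hq

/-! ### Negative energies and the bottom of the spectrum -/

theorem tanh_pos {x : ℝ} (hx : 0 < x) : 0 < Real.tanh x := by
  rw [Real.tanh_eq_sinh_div_cosh]
  exact div_pos (Real.sinh_pos_iff.2 hx) (Real.cosh_pos x)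

theorem hasDerivAt_tanh_sq (x : ℝ) : HasDerivAt Real.tanh ((Real.cosh x ^ 2)⁻¹) x := by
  have h : Real.tanh = fun x => Real.sinh x / Real.cosh x := funext Real.tanh_eq_sinh_div_cosh
  rw [h]
  refine ((Real.hasDerivAt_sinh x).div (Real.hasDerivAt_cosh x) (Real.cosh_pos x).ne').congr_deriv ?_
  rw [← one_div]
  congr 1
  linarith [Real.cosh_sq x]

theorem continuous_tanh' : Continuous Real.tanh :=
  continuous_iff_continuousAt.2 fun x => (hasDerivAt_tanh_sq x).continuousAt

theorem strictMono_tanh' : StrictMono Real.tanh :=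
  strictMono_of_hasDerivAt_pos hasDerivAt_tanh_sq fun x => by
    have := Real.cosh_pos x
    positivity

theorem concaveOn_tanh : ConcaveOn ℝ (Ici 0) Real.tanh := by
  refine AntitoneOn.concaveOn_of_deriv (convex_Ici 0) continuous_tanh'.continuousOn
    (fun x _ => (hasDerivAt_tanh_sq x).differentiableAt.differentiableWithinAt) ?_
  intro x hx y hy hxy
  rw [interior_Ici] at hx hy
  rw [(hasDerivAt_tanh_sq x).deriv, (hasDerivAt_tanh_sq y).deriv]
  have h1 := Real.cosh_pos x
  have h2 : Real.cosh x ≤ Real.cosh y := Real.cosh_le_cosh.2 (by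
    rw [abs_of_pos hx, abs_of_pos hy]; exact hxy)
  gcongr

theorem mul_tanh_le {t x : ℝ} (hx : 0 ≤ x) (h0 : 0 ≤ t) (h1 : t ≤ 1) :
    t * Real.tanh x ≤ Real.tanh (t * x) := by
  have := concaveOn_tanh.2 (mem_Ici.2 hx) (mem_Ici.2 le_rfl) h0 (sub_nonneg.2 h1) (by ring)
  simpa using this

theorem tanh_le_self {x : ℝ} (hx : 0 ≤ x) : Real.tanh x ≤ x := by
  have hmono : MonotoneOn (fun x => x - Real.tanh x) univ := by
    refine (monotone_of_hasDerivAt_nonneg (f' := fun x => 1 - (Real.cosh x ^ 2)⁻¹)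
      (fun x => (hasDerivAt_id x).sub (hasDerivAt_tanh_sq x)) fun x => ?_).monotoneOn _
    have := Real.one_le_cosh x
    have h2 : (Real.cosh x ^ 2)⁻¹ ≤ 1 := inv_le_one_of_one_le₀ (by nlinarith)
    simpa using h2
  have := hmono (mem_univ 0) (mem_univ x) hx
  simp at this
  linarith

/-- Intermediate value theorem: near 0 the coth sum dominates because tanh x ≤ x, while for large κ
the linear term exceeds the decreasing sum. -/
theorem exists_sum_inv_tanh_eq {ℓ : Fin 2 → ℝ} (hℓ : ∀ j, 0 < ℓ j) {d : ℝ} (hd : 0 < d) :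
    ∃ κ : ℝ, 0 < κ ∧ ∑ j, (Real.tanh (κ * ℓ j / 2))⁻¹ = κ * d := by
  have hl0 := hℓ 0
  have hpos : ∀ κ : ℝ, 0 < κ → ∀ j, 0 < Real.tanh (κ * ℓ j / 2) := fun κ hκ j =>
    tanh_pos (by have := hℓ j; positivity)
  set T : ℝ := ∑ j, (Real.tanh (1 * ℓ j / 2))⁻¹ with hT
  have hT0 : 0 < T := Finset.sum_pos (fun j _ => inv_pos.2 (hpos 1 one_pos j)) ⟨0, Finset.mem_univ _⟩
  set ε : ℝ := min 1 (2 / (d * ℓ 0)) with hε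
  have hε0 : 0 < ε := by positivity
  have hε1 : ε ≤ 1 := min_le_left _ _
  have hε2 : ε * (d * ℓ 0) ≤ 2 := by
    rw [← le_div_iff₀ (by positivity)]; exact min_le_right _ _
  set K : ℝ := max 1 (T / d) with hK
  have hK1 : 1 ≤ K := le_max_left _ _
  have hK2 : T ≤ K * d := by
    rw [← div_le_iff₀ hd]; exact le_max_right _ _
  set F : ℝ → ℝ := fun κ => κ * d - ∑ j, (Real.tanh (κ * ℓ j / 2))⁻¹ with hF
  have hcont : ContinuousOn F (Icc ε K) := by
    refine ContinuousOn.sub (by fun_prop) (continuousOn_finsetSum _ fun j _ => ?_)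
    refine ContinuousOn.inv₀ (continuous_tanh'.comp_continuousOn (by fun_prop)) fun κ hκ => ?_
    exact (hpos κ (hε0.trans_le hκ.1) j).ne'
  have hFε : F ε ≤ 0 := by
    have h1 : (Real.tanh (ε * ℓ 0 / 2))⁻¹ ≤ ∑ j, (Real.tanh (ε * ℓ j / 2))⁻¹ :=
      Finset.single_le_sum (f := fun j => (Real.tanh (ε * ℓ j / 2))⁻¹)
        (fun i _ => (inv_pos.2 (hpos ε hε0 i)).le) (Finset.mem_univ 0)
    have h2 : (ε * ℓ 0 / 2)⁻¹ ≤ (Real.tanh (ε * ℓ 0 / 2))⁻¹ :=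
      inv_anti₀ (hpos ε hε0 0) (tanh_le_self (by positivity))
    have h3 : ε * d ≤ (ε * ℓ 0 / 2)⁻¹ := by
      rw [← one_div, le_div_iff₀ (by positivity)]
      nlinarith
    simp only [hF]
    linarith
  have hFK : 0 ≤ F K := by
    have h1 : ∑ j, (Real.tanh (K * ℓ j / 2))⁻¹ ≤ T := by
      refine Finset.sum_le_sum fun j _ => inv_anti₀ (hpos 1 one_pos j) ?_
      refine strictMono_tanh'.monotone ?_
      have := hℓ j
      gcongr
    simp only [hF]
    linarith
  obtain ⟨κ, hκ, hκ0⟩ := intermediate_value_Icc (hε1.trans hK1) hcont ⟨hFε, hFK⟩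
  refine ⟨κ, hε0.trans_le hκ.1, ?_⟩
  simp only [hF] at hκ0
  linarith

theorem exists_mul_eq_int_mul_pi {l q : ℝ} (hl : 0 < l) (h : Real.sin (q * l) = 0) :
    ∃ n : ℤ, q = n * Real.pi / l := by
  obtain ⟨n, hn⟩ := Real.sin_eq_zero_iff.1 h
  exact ⟨n, by rw [hn]; field_simp⟩

/-- For D > 0 the tanh sum excludes negative energies and e₀ = 0. For D < 0, with d = -D/2, the coth
condition means κ ≤ κ₁, and the tanh condition, once true at κ, holds for all larger κ because
tanh(x)/x decreases. So the negative spectrum starts at -κ₁² and has no gaps. The last clause is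
needed because 0 is an anchor too. -/
theorem exists_ground_anchor {ℓ : Fin 2 → ℝ} (hℓ : ∀ j, 0 < ℓ j) {D : ℝ} (hD : D ≠ 0) :
    ∃ e₀ : ℝ, e₀ ≤ 0 ∧ e₀ ∈ deltaPrimeSSpectrum ℓ D ∧
      (∀ x ∈ deltaPrimeSSpectrum ℓ D, x < 0 → e₀ ≤ x ∧ Icc e₀ x ⊆ deltaPrimeSSpectrum ℓ D) ∧
      (∃ y, y ≠ e₀ ∧ uIcc y e₀ ⊆ deltaPrimeSSpectrum ℓ D) ∧
      ∃ y, y ≠ 0 ∧ uIcc y 0 ⊆ deltaPrimeSSpectrum ℓ D := by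
  have htp : ∀ κ : ℝ, 0 < κ → ∀ j, 0 < Real.tanh (κ * ℓ j / 2) := fun κ hκ j =>
    tanh_pos (by have := hℓ j; positivity)
  have hneg : ∀ x : ℝ, x < 0 → ∃ κ : ℝ, 0 < κ ∧ x = -κ ^ 2 := fun x hx =>
    ⟨√(-x), Real.sqrt_pos.2 (by linarith), by rw [Real.sq_sqrt (by linarith)]; ring⟩
  rcases lt_or_gt_of_ne hD with hDn | hDp
  · set d : ℝ := -D / 2 with hd
    have hd0 : 0 < d := by rw [hd]; linarith
    have hdκ : ∀ κ : ℝ, -(κ * D / 2) = κ * d := fun κ => by rw [hd]; ring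
    obtain ⟨κ₁, hκ₁, hκe⟩ := exists_sum_inv_tanh_eq hℓ hd0
    have hmono : ∀ κ κ' : ℝ, 0 < κ → κ ≤ κ' → ∀ j,
        Real.tanh (κ * ℓ j / 2) ≤ Real.tanh (κ' * ℓ j / 2) := fun κ κ' hκ h j => by
      refine strictMono_tanh'.monotone ?_
      have := hℓ j
      gcongr
    have hup : ∀ κ : ℝ, 0 < κ → κ ≤ κ₁ → κ * d ≤ ∑ j, (Real.tanh (κ * ℓ j / 2))⁻¹ := by
      intro κ hκ h
      calc κ * d ≤ κ₁ * d := by gcongr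
        _ = ∑ j, (Real.tanh (κ₁ * ℓ j / 2))⁻¹ := hκe.symm
        _ ≤ _ := Finset.sum_le_sum fun j _ => inv_anti₀ (htp κ hκ j) (hmono κ κ₁ hκ h j)
    have hle : ∀ κ : ℝ, 0 < κ → κ * d ≤ ∑ j, (Real.tanh (κ * ℓ j / 2))⁻¹ → κ ≤ κ₁ := by
      intro κ hκ h
      by_contra hlt
      have hlt : κ₁ < κ := not_le.1 hlt
      have h1 : ∑ j, (Real.tanh (κ * ℓ j / 2))⁻¹ ≤ ∑ j, (Real.tanh (κ₁ * ℓ j / 2))⁻¹ :=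
        Finset.sum_le_sum fun j _ => inv_anti₀ (htp κ₁ hκ₁ j) (hmono κ₁ κ hκ₁ hlt.le j)
      nlinarith
    have hmem : ∀ κ : ℝ, 0 < κ → κ ≤ κ₁ → ∑ j, Real.tanh (κ * ℓ j / 2) ≤ κ * d →
        -κ ^ 2 ∈ deltaPrimeSSpectrum ℓ D := fun κ h0 h1 h2 => by
      rw [neg_sq_mem_deltaPrimeSSpectrum_iff hℓ h0, hdκ]
      exact ⟨h2, hup κ h0 h1⟩
    have hIcc : ∀ κ : ℝ, 0 < κ → κ ≤ κ₁ →
        (∀ κ', κ ≤ κ' → κ' ≤ κ₁ → ∑ j, Real.tanh (κ' * ℓ j / 2) ≤ κ' * d) →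
        Icc (-κ₁ ^ 2) (-κ ^ 2) ⊆ deltaPrimeSSpectrum ℓ D := by
      intro κ h0 h1 h z hz
      obtain ⟨κ', hκ', rfl⟩ := hneg z (by nlinarith [hz.2])
      have h3 : κ ≤ κ' := abs_le_of_sq_le_sq' (by linarith [hz.2]) hκ'.le |>.2
      have h4 : κ' ≤ κ₁ := abs_le_of_sq_le_sq' (by linarith [hz.1]) hκ₁.le |>.2
      exact hmem κ' hκ' h4 (h κ' h3 h4)
    have hstrict : ∑ j, Real.tanh (κ₁ * ℓ j / 2) < κ₁ * d := by
      rw [← hκe]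
      refine Finset.sum_lt_sum_of_nonempty ⟨0, Finset.mem_univ _⟩ fun j _ => ?_
      have h1 := Real.tanh_lt_one (κ₁ * ℓ j / 2)
      exact h1.trans (one_lt_inv₀ (htp κ₁ hκ₁ j) |>.2 h1)
    have hT0 : 0 < ∑ j, Real.tanh (κ₁ * ℓ j / 2) :=
      Finset.sum_pos (fun j _ => htp κ₁ hκ₁ j) ⟨0, Finset.mem_univ _⟩
    refine ⟨-κ₁ ^ 2, by nlinarith, hmem κ₁ hκ₁ le_rfl hstrict.le, fun x hx hx0 => ?_, ?_, ?_⟩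
    · obtain ⟨κ, hκ, rfl⟩ := hneg x hx0
      rw [neg_sq_mem_deltaPrimeSSpectrum_iff hℓ hκ, hdκ] at hx
      have h1 := hle κ hκ hx.2
      refine ⟨by nlinarith, hIcc κ hκ h1 fun κ' h2 h3 => ?_⟩
      have hκ' : 0 < κ' := hκ.trans_le h2
      have h4 : ∀ j, κ / κ' * Real.tanh (κ' * ℓ j / 2) ≤ Real.tanh (κ * ℓ j / 2) := fun j => by
        have := mul_tanh_le (t := κ / κ') (x := κ' * ℓ j / 2)
          (by have := hℓ j; positivity) (by positivity) (div_le_one_of_le₀ h2 hκ'.le)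
        have e : κ / κ' * (κ' * ℓ j / 2) = κ * ℓ j / 2 := by field_simp
        rwa [e] at this
      have h5 : κ / κ' * ∑ j, Real.tanh (κ' * ℓ j / 2) ≤ κ * d := by
        rw [Finset.mul_sum]
        exact (Finset.sum_le_sum fun j _ => h4 j).trans hx.1
      rw [div_mul_eq_mul_div, div_le_iff₀ hκ'] at h5
      have h6 : κ * ∑ j, Real.tanh (κ' * ℓ j / 2) ≤ κ * (κ' * d) := by linarith
      exact le_of_mul_le_mul_left h6 hκ
    -- With this κ < κ₁, monotonicity of tanh bounds the tanh sum on [κ, κ₁] by its value at κ₁,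
    -- which is κd.
    · set κ : ℝ := (∑ j, Real.tanh (κ₁ * ℓ j / 2)) / d with hκ
      have hκ0 : 0 < κ := by positivity
      have hκ1 : κ < κ₁ := (div_lt_iff₀ hd0).2 hstrict
      have hκd : κ * d = ∑ j, Real.tanh (κ₁ * ℓ j / 2) := div_mul_cancel₀ _ hd0.ne'
      have hlt : -κ₁ ^ 2 < -κ ^ 2 := by nlinarith
      refine ⟨-κ ^ 2, hlt.ne', ?_⟩
      rw [uIcc_of_ge hlt.le]
      refine hIcc κ hκ0 hκ1.le fun κ' h1 h2 => ?_
      calc ∑ j, Real.tanh (κ' * ℓ j / 2) ≤ ∑ j, Real.tanh (κ₁ * ℓ j / 2) :=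
            Finset.sum_le_sum fun j _ => hmono κ' κ₁ (hκ0.trans_le h1) h2 j
        _ = κ * d := hκd.symm
        _ ≤ κ' * d := by gcongr
    -- Small d: tan x ≥ x puts small positive energies into the spectrum. Large d: tanh x ≤ x puts
    -- all of [-κ₁², 0) into it. Either way 0 belongs to a nondegenerate interval of spectrum.
    · rcases le_total d (∑ j, ℓ j / 2) with hc | hc
      · have hsum := Finset.sum_nonneg fun (j : Fin 2) (_ : j ∈ Finset.univ) => (hℓ j).le
        set M : ℝ := max (ℓ 0) (ℓ 1) with hM
        have hM0 : 0 < M := lt_max_of_lt_left (hℓ 0)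
        have hMj : ∀ j, ℓ j ≤ M := Fin.forall_fin_two.2 ⟨le_max_left _ _, le_max_right _ _⟩
        set y : ℝ := -(Real.pi / M) with hy
        have hy0 : y < 0 := by
          have := Real.pi_pos
          rw [hy, neg_lt_zero]
          positivity
        have hall : ∀ q ∈ Icc y 0, q ^ 2 ∈ deltaPrimeSSpectrum ℓ D := by
          refine sq_mem_of_forall_Ioo hℓ hy0 fun q hq hs => ?_
          rw [sq_mem_deltaPrimeSSpectrum_iff hℓ (mul_pos_of_neg_of_neg hq.2 hDn) hs]
          have hqM : -q * M < Real.pi := by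
            have : -q < Real.pi / M := by linarith [hq.1]
            rwa [lt_div_iff₀ hM0] at this
          have hterm : ∀ j, -q * (ℓ j / 2) ≤ halfCot (q * ℓ j) := by
            intro j
            have h1 : 0 < -q * ℓ j := mul_pos (by linarith [hq.2]) (hℓ j)
            have h2 : -q * ℓ j < Real.pi :=
              (mul_le_mul_of_nonneg_left (hMj j) (by linarith [hq.2])).trans_lt hqM
            have e1 : q * ℓ j = ((-1 : ℤ) : ℝ) * Real.pi + (Real.pi - -q * ℓ j) := by
              push_cast; ring
            rw [e1, halfCot_int_mul_pi_add (by linarith) (by linarith)]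
            have e2 : (Real.pi - -q * ℓ j) / 2 = Real.pi / 2 - -q * (ℓ j / 2) := by ring
            rw [e2, Real.cot_eq_cos_div_sin, Real.cos_pi_div_two_sub, Real.sin_pi_div_two_sub,
              ← Real.tan_eq_sin_div_cos]
            exact Real.le_tan (by linarith) (by linarith)
          calc q * D / 2 = -q * d := by rw [hd]; ring
            _ ≤ -q * ∑ j, ℓ j / 2 := mul_le_mul_of_nonneg_left hc (by linarith [hq.2])
            _ = ∑ j, -q * (ℓ j / 2) := Finset.mul_sum _ _ _
            _ ≤ _ := Finset.sum_le_sum fun j _ => hterm j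
        refine ⟨y ^ 2, pow_ne_zero 2 hy0.ne, ?_⟩
        have h0 := uIcc_sq_subset (a := y) (b := 0) fun q hq => hall q (by
          rwa [uIcc_of_le hy0.le] at hq)
        simpa using h0
      · have hlt : -κ₁ ^ 2 < 0 := by nlinarith
        refine ⟨-κ₁ ^ 2, hlt.ne, ?_⟩
        rw [uIcc_of_le hlt.le, ← closure_Ico hlt.ne]
        refine closure_minimal (fun z hz => ?_) (isClosed_deltaPrimeSSpectrum ℓ D)
        obtain ⟨κ, hκ, rfl⟩ := hneg z hz.2
        refine hmem κ hκ (abs_le_of_sq_le_sq' (by linarith [hz.1]) hκ₁.le |>.2) ?_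
        calc ∑ j, Real.tanh (κ * ℓ j / 2) ≤ ∑ j, κ * (ℓ j / 2) :=
              Finset.sum_le_sum fun j _ => (tanh_le_self (by have := hℓ j; positivity)).trans
                (le_of_eq (by ring))
          _ = κ * ∑ j, ℓ j / 2 := (Finset.mul_sum _ _ _).symm
          _ ≤ κ * d := by gcongr
  · have hδ := anchorLength_pos (hℓ 0) D (((0 : ℤ) : ℝ) * Real.pi / ℓ 0)
    have h := sq_mem_right_of_anchor hℓ (D := D) 0 0 hδ le_rfl (fun q hq => by
      simp only [Int.cast_zero, zero_mul, zero_div] at hq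
      exact mul_pos hq.1 hDp)
    set δ : ℝ := anchorLength (ℓ 0) D (((0 : ℤ) : ℝ) * Real.pi / ℓ 0) with hδdef
    simp only [Int.cast_zero, zero_mul, zero_div, zero_add] at h
    have h0 : (0 : ℝ) ∈ deltaPrimeSSpectrum ℓ D := by
      simpa using h 0 ⟨le_rfl, hδ.le⟩
    have hu : ∃ y : ℝ, y ≠ 0 ∧ uIcc y 0 ⊆ deltaPrimeSSpectrum ℓ D := by
      refine ⟨δ ^ 2, pow_ne_zero 2 hδ.ne', ?_⟩
      have h1 := uIcc_sq_subset (a := δ) (b := 0) fun q hq => h q (by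
        rwa [uIcc_of_ge hδ.le] at hq)
      simpa using h1
    refine ⟨0, le_rfl, h0, fun x hx hx0 => ?_, hu, hu⟩
    obtain ⟨κ, hκ, rfl⟩ := hneg x hx0
    rw [neg_sq_mem_deltaPrimeSSpectrum_iff hℓ hκ] at hx
    have h1 : 0 ≤ ∑ j, Real.tanh (κ * ℓ j / 2) := Finset.sum_nonneg fun j _ => (htp κ hκ j).le
    have h2 : 0 < κ * D := mul_pos hκ hDp
    linarith [hx.1]

/-! ### Convexity between consecutive anchors -/

theorem monotoneOn_neg_inv_sin_sq :
    MonotoneOn (fun x => -(Real.sin x ^ 2)⁻¹) (Ioo 0 (Real.pi / 2)) := by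
  intro x hx y hy hxy
  have h1 : 0 < Real.sin x := Real.sin_pos_of_pos_of_lt_pi hx.1 (by linarith [hx.2, Real.pi_pos])
  have h2 : Real.sin x ≤ Real.sin y :=
    Real.sin_le_sin_of_le_of_le_pi_div_two (by linarith [hx.1, Real.pi_pos]) hy.2.le hxy
  simp only [neg_le_neg_iff]
  gcongr

theorem convexOn_cot : ConvexOn ℝ (Ioo 0 (Real.pi / 2)) Real.cot := by
  have hd : ∀ x ∈ Ioo 0 (Real.pi / 2), HasDerivAt Real.cot (-(Real.sin x ^ 2)⁻¹) x := by
    intro x hx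
    have hs : Real.sin x ≠ 0 :=
      (Real.sin_pos_of_pos_of_lt_pi hx.1 (by linarith [hx.2, Real.pi_pos])).ne'
    have h : Real.cot = fun x => Real.cos x / Real.sin x := funext Real.cot_eq_cos_div_sin
    rw [h]
    refine ((Real.hasDerivAt_cos x).div (Real.hasDerivAt_sin x) hs).congr_deriv ?_
    rw [← one_div, ← neg_div]
    congr 1
    linarith [Real.sin_sq_add_cos_sq x]
  refine MonotoneOn.convexOn_of_deriv (convex_Ioo _ _)
    (fun x hx => (hd x hx).continuousAt.continuousWithinAt) ?_ ?_
  · rw [interior_Ioo]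
    exact fun x hx => (hd x hx).differentiableAt.differentiableWithinAt
  · rw [interior_Ioo]
    intro x hx y hy hxy
    rw [(hd x hx).deriv, (hd y hy).deriv]
    exact monotoneOn_neg_inv_sin_sq hx hy hxy

theorem convexOn_cot_affine {x y q l ρ : ℝ}
    (h : ∀ p ∈ Ioo x y, 0 < ρ + (p - q) * l ∧ ρ + (p - q) * l < Real.pi) :
    ConvexOn ℝ (Ioo x y) fun p => Real.cot ((ρ + (p - q) * l) / 2) := by
  refine ⟨convex_Ioo _ _, fun a ha b hb s t hs ht hst => ?_⟩
  have h1 := convexOn_cot.2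
    (x := (ρ + (a - q) * l) / 2) (y := (ρ + (b - q) * l) / 2)
    ⟨by linarith [(h a ha).1], by linarith [(h a ha).2]⟩
    ⟨by linarith [(h b hb).1], by linarith [(h b hb).2]⟩ hs ht hst
  have e : (ρ + (s • a + t • b - q) * l) / 2 =
      s • ((ρ + (a - q) * l) / 2) + t • ((ρ + (b - q) * l) / 2) := by
    simp only [smul_eq_mul]
    linear_combination ((-ρ + q * l) / 2) * hst
  beta_reduce
  rw [e]
  exact h1

set_option maxHeartbeats 400000 in
/-- On an interval between consecutive zeros of `sin (q ℓ j)`, one of the two parts into which a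
point of the spectrum divides it consists of points of the spectrum. -/
theorem joined_to_anchor {ℓ : Fin 2 → ℝ} (hℓ : ∀ j, 0 < ℓ j) {D q : ℝ} (hq : 0 < q * D)
    (hs : ∀ j, Real.sin (q * ℓ j) ≠ 0) (hmem : q ^ 2 ∈ deltaPrimeSSpectrum ℓ D) :
    ∃ q', (∃ j, Real.sin (q' * ℓ j) = 0) ∧ ∀ p ∈ uIcc q q', p ^ 2 ∈ deltaPrimeSSpectrum ℓ D := by
  have hρ0 := fun j => piMod_pos (q * ℓ j)
  have hρ1 := fun j => (sin_ne_zero_iff_piMod (q * ℓ j)).1 (hs j)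
  choose n hn using fun j => exists_eq_piMod_add (q * ℓ j)
  obtain ⟨jl, hjl⟩ : ∃ i, ∀ j, piMod (q * ℓ i) / ℓ i ≤ piMod (q * ℓ j) / ℓ j :=
    Finite.exists_min fun j => piMod (q * ℓ j) / ℓ j
  obtain ⟨jr, hjr⟩ : ∃ i, ∀ j, (Real.pi - piMod (q * ℓ i)) / ℓ i ≤
      (Real.pi - piMod (q * ℓ j)) / ℓ j :=
    Finite.exists_min fun j => (Real.pi - piMod (q * ℓ j)) / ℓ j
  -- x and y are the anchors, of either family, nearest to q on the left and on the right.
  set x : ℝ := q - piMod (q * ℓ jl) / ℓ jl with hx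
  set y : ℝ := q + (Real.pi - piMod (q * ℓ jr)) / ℓ jr with hy
  have hxq : x < q := by
    have := div_pos (hρ0 jl) (hℓ jl)
    linarith
  have hqy : q < y := by
    have := div_pos (sub_pos.2 (hρ1 jr)) (hℓ jr)
    linarith
  have hxl : x * ℓ jl = n jl * Real.pi := by
    have := (hℓ jl).ne'
    have e : x * ℓ jl = q * ℓ jl - piMod (q * ℓ jl) := by rw [hx]; field_simp
    rw [e]
    linarith [hn jl]
  have hyr : y * ℓ jr = ((n jr + 1 : ℤ) : ℝ) * Real.pi := by
    have := (hℓ jr).ne'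
    have e : y * ℓ jr = q * ℓ jr + (Real.pi - piMod (q * ℓ jr)) := by rw [hy]; field_simp
    rw [e]
    push_cast
    linarith [hn jr]
  have harg : ∀ p ∈ Ioo x y, ∀ j, 0 < piMod (q * ℓ j) + (p - q) * ℓ j ∧
      piMod (q * ℓ j) + (p - q) * ℓ j < Real.pi := by
    intro p hp j
    have hl := hℓ j
    have h1 : q - p < piMod (q * ℓ j) / ℓ j := by linarith [hjl j, hp.1]
    have h2 : p - q < (Real.pi - piMod (q * ℓ j)) / ℓ j := by linarith [hjr j, hp.2]
    rw [lt_div_iff₀ hl] at h1 h2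
    constructor <;> linarith
  have hmod : ∀ p ∈ Ioo x y, ∀ j, piMod (p * ℓ j) = piMod (q * ℓ j) + (p - q) * ℓ j :=
    fun p hp j => piMod_eq_of (n := n j) (harg p hp j).1 (harg p hp j).2.le (by
      have := hn j
      linarith)
  -- 0 is itself an anchor, so the interval cannot cross it and p keeps the sign of q.
  have hsign : ∀ p ∈ Ioo x y, 0 < p * D := by
    intro p hp
    rcases pos_and_pos_or_neg_and_neg_of_mul_pos hq with ⟨hq0, hD⟩ | ⟨hq0, hD⟩
    · have h1 : 0 ≤ x * ℓ jl := by
        rw [hxl]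
        have h2 : 0 < q * ℓ jl := mul_pos hq0 (hℓ jl)
        have h3 : (-1 : ℝ) < n jl := by
          have := hn jl
          have h4 := hρ1 jl
          by_contra hcon
          nlinarith [Real.pi_pos]
        have h4 : (-1 : ℤ) < n jl := by exact_mod_cast h3
        have h5 : (0 : ℝ) ≤ n jl := by exact_mod_cast (by omega : 0 ≤ n jl)
        exact mul_nonneg h5 Real.pi_pos.le
      have h6 : 0 ≤ x := nonneg_of_mul_nonneg_left h1 (hℓ jl)
      exact mul_pos (by linarith [hp.1]) hD
    · have h1 : y * ℓ jr ≤ 0 := by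
        rw [hyr]
        have h2 : q * ℓ jr < 0 := mul_neg_of_neg_of_pos hq0 (hℓ jr)
        have h3 : (n jr : ℝ) < 0 := by
          have := hn jr
          have h4 := hρ0 jr
          by_contra hcon
          nlinarith [Real.pi_pos]
        have h4 : n jr < 0 := by exact_mod_cast h3
        have h5 : ((n jr + 1 : ℤ) : ℝ) ≤ 0 := by exact_mod_cast (by omega : n jr + 1 ≤ 0)
        exact mul_nonpos_of_nonpos_of_nonneg h5 Real.pi_pos.le
      have h6 : y ≤ 0 := by
        by_contra hcon
        nlinarith [hℓ jr]
      exact mul_pos_of_neg_of_neg (by linarith [hp.2]) hD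
  have hsin : ∀ p ∈ Ioo x y, ∀ j, Real.sin (p * ℓ j) ≠ 0 := fun p hp j => by
    rw [sin_ne_zero_iff_piMod, hmod p hp j]
    exact (harg p hp j).2
  set f : ℝ → ℝ := fun p => ∑ j, Real.cot ((piMod (q * ℓ j) + (p - q) * ℓ j) / 2) - p * D / 2
    with hf
  have hiff : ∀ p ∈ Ioo x y, (p ^ 2 ∈ deltaPrimeSSpectrum ℓ D ↔ 0 ≤ f p) := fun p hp => by
    rw [sq_mem_deltaPrimeSSpectrum_iff hℓ (hsign p hp) (hsin p hp), hf, sub_nonneg]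
    simp only [halfCot, hmod p hp]
  -- For D < 0 the term -pD/2 increases, so f need not be monotone; convexity works for both signs.
  have hconv : ∀ u v w, u ∈ Ioo x y → w ∈ Ioo x y → u ≤ v → v ≤ w → f v ≤ max (f u) (f w) := by
    intro u v w hu hw huv hvw
    have hcj : ∀ j, ConvexOn ℝ (Ioo x y)
        fun p => Real.cot ((piMod (q * ℓ j) + (p - q) * ℓ j) / 2) :=
      fun j => convexOn_cot_affine fun p hp => harg p hp j
    have hlin : ConcaveOn ℝ (Ioo x y) fun p : ℝ => p * D / 2 :=
      ⟨convex_Ioo _ _, fun a _ b _ s t _ _ _ => le_of_eq (by simp only [smul_eq_mul]; ring)⟩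
    have hc : ConvexOn ℝ (Ioo x y) f := by
      have h2 := ((hcj 0).add (hcj 1)).sub hlin
      convert! h2 using 2
      simp only [hf, Fin.sum_univ_two]
      rfl
    exact hc.le_max_of_mem_Icc hu hw ⟨huv, hvw⟩
  have hfq : 0 ≤ f q := (hiff q ⟨hxq, hqy⟩).1 hmem
  by_cases hall : ∀ p ∈ Ioo x q, 0 ≤ f p
  · refine ⟨x, ⟨jl, by rw [hxl, Real.sin_int_mul_pi]⟩, ?_⟩
    rw [uIcc_of_ge hxq.le]
    exact sq_mem_of_forall_Ioo hℓ hxq fun p hp _ =>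
      (hiff p ⟨hp.1, hp.2.trans hqy⟩).2 (hall p hp)
  -- If f is negative at some u left of q while f(q) ≥ 0, convexity forces f ≥ 0 at every point
  -- right of q.
  · simp only [not_forall, not_le] at hall
    obtain ⟨u, hu, hfu⟩ := hall
    refine ⟨y, ⟨jr, by rw [hyr, Real.sin_int_mul_pi]⟩, ?_⟩
    rw [uIcc_of_le hqy.le]
    refine sq_mem_of_forall_Ioo hℓ hqy fun p hp _ => ?_
    have hpI : p ∈ Ioo x y := ⟨hxq.trans hp.1, hp.2⟩
    refine (hiff p hpI).2 ?_
    have h1 := hconv u q p ⟨hu.1, hu.2.trans hqy⟩ hpI hu.2.le hp.1.le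
    rcases le_max_iff.1 h1 with h2 | h2 <;> linarith

/-! ### Counting anchors and assembling the bands -/

/-- The point `e₀` and the energies at which `sin (k ℓ j)` vanishes for some `j`. -/
def anchorSet (ℓ : Fin 2 → ℝ) (e₀ : ℝ) : Set ℝ :=
  {E | E = e₀ ∨ ∃ (n : ℕ) (j : Fin 2), E = (n * Real.pi / ℓ j) ^ 2}

/-- The summand 3 accounts for e₀ and for n = 0 in each of the two families. -/
theorem anchorSet_inter_Iic {ℓ : Fin 2 → ℝ} (hℓ : ∀ j, 0 < ℓ j) (e₀ R : ℝ) :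
    (anchorSet ℓ e₀ ∩ Iic R).Finite ∧
      ((anchorSet ℓ e₀ ∩ Iic R).ncard : ℝ) ≤ √R * ((ℓ 0 + ℓ 1) / Real.pi) + 3 := by
  classical
  set N : Fin 2 → ℕ := fun j => ⌊√R * ℓ j / Real.pi⌋₊ with hN
  set F : Finset ℝ := {e₀} ∪ ((Finset.range (N 0 + 1)).image (fun n : ℕ => (n * Real.pi / ℓ 0) ^ 2) ∪
    (Finset.range (N 1 + 1)).image (fun n : ℕ => (n * Real.pi / ℓ 1) ^ 2)) with hF
  have hsub : anchorSet ℓ e₀ ∩ Iic R ⊆ F := by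
    rintro E ⟨rfl | ⟨n, j, rfl⟩, hR⟩
    · simp [hF]
    · have hl := hℓ j
      have hn : n ≤ N j := by
        refine Nat.le_floor ?_
        rw [le_div_iff₀ Real.pi_pos, ← div_le_iff₀ hl]
        exact Real.le_sqrt_of_sq_le hR
      have hj : (((n : ℝ) * Real.pi / ℓ j) ^ 2) ∈
          (Finset.range (N j + 1)).image (fun n : ℕ => (n * Real.pi / ℓ j) ^ 2) :=
        Finset.mem_image.2 ⟨n, Finset.mem_range.2 (by omega), rfl⟩
      rw [hF]
      rw [Finset.mem_coe]
      revert hj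
      fin_cases j
      · exact fun hj => Finset.mem_union_right _ (Finset.mem_union_left _ hj)
      · exact fun hj => Finset.mem_union_right _ (Finset.mem_union_right _ hj)
  refine ⟨F.finite_toSet.subset hsub, ?_⟩
  have h1 : (anchorSet ℓ e₀ ∩ Iic R).ncard ≤ 1 + ((N 0 + 1) + (N 1 + 1)) := by
    refine (ncard_le_ncard hsub F.finite_toSet).trans ?_
    rw [ncard_coe_finset]
    refine (Finset.card_union_le _ _).trans (add_le_add (by simp) ?_)
    refine (Finset.card_union_le _ _).trans (add_le_add ?_ ?_) <;>
    exact Finset.card_image_le.trans (by simp)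
  have h2 : ∀ j, (N j : ℝ) ≤ √R * ℓ j / Real.pi := fun j => by
    have := hℓ j
    have := Real.pi_pos
    exact Nat.floor_le (by positivity)
  have h3 : ((anchorSet ℓ e₀ ∩ Iic R).ncard : ℝ) ≤ 1 + ((N 0 + 1) + (N 1 + 1)) := by
    exact_mod_cast h1
  have h4 : √R * ((ℓ 0 + ℓ 1) / Real.pi) = √R * ℓ 0 / Real.pi + √R * ℓ 1 / Real.pi := by ring
  rw [h4]
  linarith [h2 0, h2 1]

/-- Enlarging the constant makes the inequality strict and covers the finitely many r below N. Every
larger constant works too, so several bounds can share one. -/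
theorem exists_const_of_eventually_le {f : ℕ → ℝ} {U C : ℝ} {N : ℕ}
    (h : ∀ r : ℕ, N ≤ r → f r ≤ U + C / (r + 1)) :
    ∃ C₀ : ℝ, ∀ C', C₀ ≤ C' → ∀ r : ℕ, f r < U + C' / (r + 1) := by
  set B : ℝ := ∑ r ∈ Finset.range N, |f r - U| with hB
  have hB0 : 0 ≤ B := Finset.sum_nonneg fun r _ => abs_nonneg _
  refine ⟨|C| + 1 + (B + 1) * (N + 1), fun C' hC' r => ?_⟩
  have hr : (0 : ℝ) < r + 1 := by positivity
  rcases lt_or_ge r N with hrN | hrN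
  · have h1 : |f r - U| ≤ B :=
      Finset.single_le_sum (f := fun r => |f r - U|) (fun i _ => abs_nonneg _)
        (Finset.mem_range.2 hrN)
    have h2 : B < C' / (r + 1) := by
      rw [lt_div_iff₀ hr]
      have h3 : (r : ℝ) ≤ N := by exact_mod_cast hrN.le
      have h4 : B * (r + 1) ≤ B * (N + 1) := by gcongr
      have h5 : (0 : ℝ) < N + 1 := by positivity
      nlinarith [abs_nonneg C]
    linarith [le_abs_self (f r - U)]
  · refine (h r hrN).trans_lt ?_
    have h5 : 0 ≤ (B + 1) * ((N : ℝ) + 1) := by positivity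
    have : C < C' := by linarith [le_abs_self C]
    gcongr

/-- In energy the piece of length δ = a/(dp + c) has width 2pδ ± δ², with leading term 2a/d =
8/(|D|ℓ_j). The larger of the two lengths gives a bound valid for both families. -/
theorem exists_anchor_width {ℓ : Fin 2 → ℝ} (hℓ : ∀ j, 0 < ℓ j) {D : ℝ} (hD : D ≠ 0) (j : Fin 2) :
    ∃ p₀ C : ℝ, 0 ≤ C ∧ ∀ n : ℕ, p₀ < n * Real.pi / ℓ j →
      ∃ x y, x ≤ (n * Real.pi / ℓ j) ^ 2 ∧ (n * Real.pi / ℓ j) ^ 2 ≤ y ∧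
        Icc x y ⊆ deltaPrimeSSpectrum ℓ D ∧
        8 / (|D| * max (ℓ 0) (ℓ 1)) - C / (n * Real.pi / ℓ j) ≤ y - x := by
  have hl := hℓ j
  have hD0 : 0 < |D| := abs_pos.2 hD
  have hM0 : 0 < max (ℓ 0) (ℓ 1) := lt_max_of_lt_left (hℓ 0)
  have hMj : ℓ j ≤ max (ℓ 0) (ℓ 1) := by
    fin_cases j
    · exact le_max_left _ _
    · exact le_max_right _ _
  set a : ℝ := 2 / ℓ j with ha
  set d : ℝ := |D| / 2 with hd
  set c : ℝ := 1 + (ℓ j / 2 + d) * a with hc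
  have ha0 : 0 < a := by positivity
  have hd0 : 0 < d := by positivity
  have hc1 : 1 ≤ c := by
    have : 0 ≤ (ℓ j / 2 + d) * a := by positivity
    linarith
  refine ⟨a, 2 * a * c / d ^ 2 + (a / d) ^ 2 + a ^ 2 / d, by positivity, fun n hn => ?_⟩
  set p : ℝ := n * Real.pi / ℓ j with hp
  have hp0 : 0 < p := ha0.trans hn
  have hn0 : 0 < n := by
    rcases Nat.eq_zero_or_pos n with h | h
    · rw [hp, h] at hp0
      simp at hp0
    · exact h
  set δ : ℝ := anchorLength (ℓ j) D p with hδdef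
  have hδ : 0 < δ := anchorLength_pos hl D p
  have hδe : δ = a / (d * p + c) := by
    rw [hδdef, anchorLength, abs_of_pos hp0]
  have hden : 0 < d * p + c := by positivity
  have hδa : δ ≤ a := by
    rw [hδe]
    refine div_le_self ha0.le ?_
    have : 0 ≤ d * p := by positivity
    linarith
  have hδd : δ ≤ a / (d * p) := by
    rw [hδe]
    exact div_le_div_of_nonneg_left ha0.le (by positivity) (by linarith)
  have hsub := exists_anchor_interval hℓ hD hn0 j hδ (hδa.trans_lt hn) le_rfl
  rw [← hp] at hsub
  have hwidth : 2 * a / d - (2 * a * c / d ^ 2 + (a / d) ^ 2 + a ^ 2 / d) / p ≤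
      2 * p * δ - δ ^ 2 := by
    have h1 : 2 * p * δ = 2 * a / d - 2 * a * c / (d * (d * p + c)) := by
      rw [hδe]; field_simp; ring
    have h2 : 2 * a * c / (d * (d * p + c)) ≤ 2 * a * c / d ^ 2 / p := by
      rw [div_div]
      refine div_le_div_of_nonneg_left (by positivity) (by positivity) ?_
      nlinarith
    have h3 : δ ^ 2 ≤ a ^ 2 / d / p := by
      calc δ ^ 2 = δ * δ := sq δ
        _ ≤ a * (a / (d * p)) := mul_le_mul hδa hδd hδ.le ha0.le
        _ = a ^ 2 / d / p := by field_simp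
    have h4 : 0 ≤ (a / d) ^ 2 / p := by positivity
    rw [add_div, add_div]
    linarith
  have hU : 8 / (|D| * max (ℓ 0) (ℓ 1)) ≤ 2 * a / d := by
    have : 2 * a / d = 8 / (|D| * ℓ j) := by rw [ha, hd]; field_simp; norm_num
    rw [this]
    gcongr
  rcases lt_or_gt_of_ne hD with hneg | hpos
  · rw [sign_neg hneg] at hsub
    have e : (p + ((-1 : SignType) : ℝ) * δ) ^ 2 = (p - δ) ^ 2 := by simp; ring
    have hle : (p - δ) ^ 2 ≤ p ^ 2 := by nlinarith
    rw [e, uIcc_of_le hle] at hsub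
    exact ⟨_, _, hle, le_rfl, hsub, by nlinarith⟩
  · rw [sign_pos hpos] at hsub
    have e : (p + ((1 : SignType) : ℝ) * δ) ^ 2 = (p + δ) ^ 2 := by simp
    have hle : p ^ 2 ≤ (p + δ) ^ 2 := by nlinarith
    rw [e, uIcc_of_ge hle] at hsub
    exact ⟨_, _, le_rfl, hle, hsub, by nlinarith [sq_nonneg δ]⟩

theorem exists_nat_of_sin_eq_zero {l q : ℝ} (hl : 0 < l) (h : Real.sin (q * l) = 0) :
    ∃ n : ℕ, q ^ 2 = (n * Real.pi / l) ^ 2 := by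
  obtain ⟨n, rfl⟩ := exists_mul_eq_int_mul_pi hl h
  refine ⟨n.natAbs, ?_⟩
  have h1 : ((n.natAbs : ℕ) : ℝ) ^ 2 = (n : ℝ) ^ 2 := by
    rw [Nat.cast_natAbs, Int.cast_abs, sq_abs]
  rw [div_pow, div_pow, mul_pow, mul_pow, h1]

theorem exists_anchored_bands {ℓ : Fin 2 → ℝ} (hℓ : ∀ j, 0 < ℓ j) {D : ℝ} (hD : D ≠ 0) :
    ∃ (e₀ : ℝ) (α β a : ℕ → ℝ), IsBandStructure (deltaPrimeSSpectrum ℓ D) α β ∧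
      StrictMono a ∧ ∀ r, e₀ ≤ a r ∧ a r ∈ anchorSet ℓ e₀ ∧ a r ∈ Icc (α r) (β r) ∧
      ∀ x y, x ≤ a r → a r ≤ y → Icc x y ⊆ deltaPrimeSSpectrum ℓ D → α r ≤ x ∧ y ≤ β r := by
  obtain ⟨e₀, he0, heS, hneg, he1, hz⟩ := exists_ground_anchor hℓ hD
  have hlow : ∀ x ∈ deltaPrimeSSpectrum ℓ D, e₀ ≤ x := fun x hx => by
    rcases lt_or_ge x 0 with h | h
    · exact (hneg x hx h).1
    · linarith
  have hnd : ∀ p ∈ anchorSet ℓ e₀, ∃ y, y ≠ p ∧ uIcc y p ⊆ deltaPrimeSSpectrum ℓ D := by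
    rintro p (rfl | ⟨n, j, rfl⟩)
    · exact he1
    · rcases Nat.eq_zero_or_pos n with rfl | hn
      · simpa using hz
      · have hl := hℓ j
        have hp : 0 < n * Real.pi / ℓ j := by positivity
        have hA := anchorLength_pos hl D (n * Real.pi / ℓ j)
        set δ : ℝ := min (anchorLength (ℓ j) D (n * Real.pi / ℓ j)) (n * Real.pi / ℓ j / 2) with hδ
        have hδ0 : 0 < δ := lt_min hA (by linarith)
        have hδ1 : δ ≤ n * Real.pi / ℓ j / 2 := min_le_right _ _
        refine ⟨_, ?_, exists_anchor_interval hℓ hD hn j hδ0 (by linarith) (min_le_left _ _)⟩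
        rcases lt_or_gt_of_ne hD with hD' | hD'
        · rw [sign_neg hD']
          refine ne_of_lt ?_
          simp only [SignType.coe_neg_one]
          nlinarith
        · rw [sign_pos hD']
          refine ne_of_gt ?_
          simp only [SignType.coe_one]
          nlinarith
  have hPS : anchorSet ℓ e₀ ⊆ deltaPrimeSSpectrum ℓ D := fun p hp => by
    obtain ⟨y, -, hy⟩ := hnd p hp
    exact hy right_mem_uIcc
  have hunb : ∀ R, ∃ p ∈ anchorSet ℓ e₀, R < p := fun R => by
    have hl := hℓ 0
    have hc : 0 < Real.pi / ℓ 0 := by positivity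
    obtain ⟨n, hn⟩ := exists_nat_gt ((|R| + 1) / (Real.pi / ℓ 0))
    rw [div_lt_iff₀ hc, ← mul_div_assoc] at hn
    refine ⟨_, Or.inr ⟨n, 0, rfl⟩, ?_⟩
    have := le_abs_self R
    nlinarith [abs_nonneg R]
  have hanch : ∀ x ∈ deltaPrimeSSpectrum ℓ D,
      ∃ p ∈ anchorSet ℓ e₀, uIcc x p ⊆ deltaPrimeSSpectrum ℓ D := fun x hx => by
    rcases lt_or_ge x 0 with h | h
    · obtain ⟨h1, h2⟩ := hneg x hx h
      exact ⟨e₀, Or.inl rfl, by rwa [uIcc_of_ge h1]⟩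
    have key : ∀ q : ℝ, q ^ 2 = x → (∃ j, Real.sin (q * ℓ j) = 0) →
        ∃ p ∈ anchorSet ℓ e₀, uIcc x p ⊆ deltaPrimeSSpectrum ℓ D := by
      rintro q rfl ⟨j, hj⟩
      obtain ⟨n, hn⟩ := exists_nat_of_sin_eq_zero (hℓ j) hj
      exact ⟨q ^ 2, Or.inr ⟨n, j, hn⟩, by simpa using hx⟩
    rcases h.eq_or_lt with h | h
    · exact key 0 (by simp [← h]) ⟨0, by simp⟩
    obtain ⟨q, hqx, hq⟩ : ∃ q : ℝ, q ^ 2 = x ∧ 0 < q * D := by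
      rcases lt_or_gt_of_ne hD with hD' | hD'
      · exact ⟨-√x, by rw [neg_sq, Real.sq_sqrt h.le],
          mul_pos_of_neg_of_neg (neg_neg_of_pos (Real.sqrt_pos.2 h)) hD'⟩
      · exact ⟨√x, Real.sq_sqrt h.le, mul_pos (Real.sqrt_pos.2 h) hD'⟩
    by_cases hs : ∃ j, Real.sin (q * ℓ j) = 0
    · exact key q hqx hs
    · push Not at hs
      subst hqx
      obtain ⟨q', ⟨j, hj⟩, hsub⟩ := joined_to_anchor hℓ hq hs hx
      obtain ⟨n, hn⟩ := exists_nat_of_sin_eq_zero (hℓ j) hj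
      exact ⟨q' ^ 2, Or.inr ⟨n, j, hn⟩, uIcc_sq_subset hsub⟩
  -- Without gaps above R the spectrum would contain the energies of a momentum interval of length
  -- 2, longer than the bound C/k ≤ 1.
  have hgap : ∀ R, ∃ x, R < x ∧ x ∉ deltaPrimeSSpectrum ℓ D := fun R => by
    obtain ⟨k₀, C, hk₀, hC, hw⟩ := exists_energy_width_bound hℓ hD
    set k : ℝ := max k₀ (max C (|R| + 1)) with hk
    have hk1 : k₀ ≤ k := le_max_left _ _
    have hk2 : C ≤ k := (le_max_left _ _).trans (le_max_right _ _)
    have hk3 : |R| + 1 ≤ k := (le_max_right _ _).trans (le_max_right _ _)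
    by_contra! hcon
    have h1 := (hw k (k + 2) hk1 (by linarith) fun x hx => hcon x (by
      have := le_abs_self R
      nlinarith [hx.1, abs_nonneg R])).1
    have h2 : C / k ≤ 1 := div_le_one_of_le₀ hk2 (by linarith)
    linarith
  obtain ⟨α, β, a, hband, hmono, ha⟩ := exists_isBandStructure (isClosed_deltaPrimeSSpectrum ℓ D)
    ⟨e₀, hlow⟩ hPS (fun R => (anchorSet_inter_Iic hℓ e₀ R).1) hunb hanch hnd hgap
  exact ⟨e₀, α, β, a, hband, hmono, fun r =>
    ⟨hlow _ (hPS (ha r).1), (ha r).1, (ha r).2.1, (ha r).2.2⟩⟩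

/-- a 0, ..., a r are r + 1 different anchors not exceeding a r; comparison with the anchor count
gives the claim. -/
theorem le_sqrt_of_strictMono_anchor {ℓ : Fin 2 → ℝ} (hℓ : ∀ j, 0 < ℓ j) {e₀ : ℝ} {a : ℕ → ℝ}
    (hmono : StrictMono a) (ha : ∀ r, a r ∈ anchorSet ℓ e₀) (r : ℕ) :
    (r : ℝ) - 2 ≤ √(a r) * ((ℓ 0 + ℓ 1) / Real.pi) := by
  obtain ⟨hfin, hcard⟩ := anchorSet_inter_Iic hℓ e₀ (a r)
  have hsub : ((Finset.range (r + 1)).image a : Set ℝ) ⊆ anchorSet ℓ e₀ ∩ Iic (a r) := by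
    intro x hx
    simp only [Finset.coe_image, Finset.coe_range, mem_image, mem_Iio] at hx
    obtain ⟨i, hi, rfl⟩ := hx
    exact ⟨ha i, hmono.monotone (by omega)⟩
  have h1 := ncard_le_ncard hsub hfin
  rw [ncard_coe_finset, Finset.card_image_of_injective _ hmono.injective,
    Finset.card_range] at h1
  have h2 : ((r : ℝ) + 1) ≤ (anchorSet ℓ e₀ ∩ Iic (a r)).ncard := by exact_mod_cast h1
  linarith

theorem exists_band_structure_with_widths {ℓ : Fin 2 → ℝ} (hℓ : ∀ j, 0 < ℓ j) {D : ℝ}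
    (hD : D ≠ 0) :
    ∃ α β : ℕ → ℝ, IsBandStructure (deltaPrimeSSpectrum ℓ D) α β ∧
      ∃ (N : ℕ) (C : ℝ), ∀ r : ℕ, N ≤ r →
        8 / (|D| * max (ℓ 0) (ℓ 1)) - C / (r + 1) ≤ β r - α r ∧
        β r - α r ≤
          8 / |D| * ((ℓ 0)⁻¹ + (ℓ 1)⁻¹) * conspiracyE (ℓ 1 / ℓ 0) + C / (r + 1) ∧
        (ℓ 1 / ℓ 0 = 2 ∨ ℓ 1 / ℓ 0 = 1 / 2 →
          β r - α r ≤ 8 / |D| * ((ℓ 0)⁻¹ + (ℓ 1)⁻¹) + C / (r + 1)) := by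
  obtain ⟨e₀, α, β, a, hband, hmono, ha⟩ := exists_anchored_bands hℓ hD
  obtain ⟨k₀, C, hk₀, hC, hw⟩ := exists_energy_width_bound hℓ hD
  choose p₀ C' hC' hlow using exists_anchor_width hℓ hD
  set μ : ℝ := (ℓ 0 + ℓ 1) / Real.pi with hμ
  have hμ0 : 0 < μ := by
    have := hℓ 0; have := hℓ 1; positivity
  set K : ℝ := max k₀ (max (p₀ 0) (p₀ 1)) with hK
  set B : ℝ := max C (max (C' 0) (C' 1)) with hB
  have hB0 : 0 ≤ B := hC.trans (le_max_left _ _)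
  have hpK : ∀ j, p₀ j ≤ K ∧ C' j ≤ B := by
    intro j
    fin_cases j
    · exact ⟨(le_max_left _ _).trans (le_max_right _ _), (le_max_left _ _).trans (le_max_right _ _)⟩
    · exact ⟨(le_max_right _ _).trans (le_max_right _ _),
        (le_max_right _ _).trans (le_max_right _ _)⟩
  obtain ⟨N, hN⟩ := exists_nat_gt (2 * μ * K)
  -- For r ≥ 7 one has r + 1 ≤ 2(r - 3), which turns 1/s into 2μ/(r + 1).
  have hlarge : ∀ r : ℕ, N + 7 ≤ r → ∀ s : ℝ, (r : ℝ) - 3 ≤ s * μ →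
      K < s ∧ 0 < s ∧ ∀ c, c ≤ B → c / s ≤ B * (2 * μ) / (r + 1) := by
    intro r hr s hs
    have hr' : (N : ℝ) + 7 ≤ r := by exact_mod_cast hr
    have hN0 : (0 : ℝ) ≤ N := N.cast_nonneg
    have hs0 : 0 < s := pos_of_mul_pos_left (lt_of_lt_of_le (by linarith) hs) hμ0.le
    refine ⟨lt_of_mul_lt_mul_right (by nlinarith : K * μ < s * μ) hμ0.le, hs0, fun c hc => ?_⟩
    rw [div_le_div_iff₀ hs0 (by linarith)]
    nlinarith [mul_le_mul_of_nonneg_right hc (by linarith : (0 : ℝ) ≤ r + 1)]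
  have hgrow := le_sqrt_of_strictMono_anchor hℓ hmono fun r => (ha r).2.1
  refine ⟨α, β, hband, N + 7, B * (2 * μ), fun r hr => ?_⟩
  have hsub : Icc (α r) (β r) ⊆ deltaPrimeSSpectrum ℓ D := by
    rw [hband.eq_iUnion]
    exact subset_iUnion (fun r => Icc (α r) (β r)) r
  have hupper : C / √(α r) ≤ B * (2 * μ) / (r + 1) ∧
      β r - α r ≤ 8 / |D| * ((ℓ 0)⁻¹ + (ℓ 1)⁻¹) * conspiracyE (ℓ 1 / ℓ 0) + C / √(α r) ∧
      (ℓ 1 / ℓ 0 = 2 ∨ ℓ 1 / ℓ 0 = 1 / 2 →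
        β r - α r ≤ 8 / |D| * ((ℓ 0)⁻¹ + (ℓ 1)⁻¹) + C / √(α r)) := by
    -- The lower end of band r is only known to exceed the anchor of the preceding band; the shift
    -- by one turns r - 2 into r - 3.
    have hprev : a (r - 1) ≤ α r := by
      have h1 := hband.gap (r - 1)
      rw [Nat.sub_add_cancel (by omega)] at h1
      exact (ha (r - 1)).2.2.1.2.trans h1.le
    have h2 := hgrow (r - 1)
    rw [Nat.cast_sub (by omega), Nat.cast_one] at h2
    have hs : (r : ℝ) - 3 ≤ √(α r) * μ := by
      have := mul_le_mul_of_nonneg_right (Real.sqrt_le_sqrt hprev) hμ0.le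
      linarith
    obtain ⟨h3, h4, h5⟩ := hlarge r hr _ hs
    have hα : 0 < α r := Real.sqrt_pos.1 h4
    have hβ : 0 < β r := hα.trans (hband.band r)
    have := hw √(α r) √(β r) ((le_max_left _ _).trans h3.le)
      (Real.sqrt_lt_sqrt hα.le (hband.band r))
      (by rwa [Real.sq_sqrt hα.le, Real.sq_sqrt hβ.le])
    rw [Real.sq_sqrt hα.le, Real.sq_sqrt hβ.le] at this
    exact ⟨h5 C (le_max_left _ _), this.2⟩
  refine ⟨?_, by linarith [hupper.2.1, hupper.1], fun h => by
    linarith [hupper.2.2 h, hupper.1]⟩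
  have hs : (r : ℝ) - 3 ≤ √(a r) * μ := by linarith [hgrow r]
  obtain ⟨h3, h4, h5⟩ := hlarge r hr _ hs
  have har : 0 < a r := Real.sqrt_pos.1 h4
  -- The anchor of band r > 0 is not e₀, since a r > a 0 ≥ e₀.
  rcases (ha r).2.1 with he | ⟨n, j, hnj⟩
  · have h6 := hmono (show 0 < r by omega)
    linarith [(ha 0).1]
  · have hl := hℓ j
    have hsq : √(a r) = n * Real.pi / ℓ j := by
      rw [hnj, Real.sqrt_sq (by positivity)]
    rw [hsq] at h3 h5
    obtain ⟨x, y, hx, hy, hxy, hwid⟩ := hlow j n ((hpK j).1.trans_lt h3)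
    rw [← hnj] at hx hy
    have h6 := (ha r).2.2.2 x y hx hy hxy
    linarith [h6.1, h6.2, h5 (C' j) (hpK j).2]

theorem mainTheorem4 (ℓ : Fin 2 → ℝ) (hℓ : ∀ j, 0 < ℓ j) (D : ℝ) (hD : D ≠ 0) :
    (∃ α β : ℕ → ℝ, IsBandStructure (deltaPrimeSSpectrum ℓ D) α β ∧
      ∃ C : ℝ, ∀ r : ℕ,
        8 / (|D| * max (ℓ 0) (ℓ 1)) - C / (r + 1) < β r - α r ∧
        β r - α r <
          8 / |D| * ((ℓ 0)⁻¹ + (ℓ 1)⁻¹) * conspiracyE (ℓ 1 / ℓ 0) + C / (r + 1) ∧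
        (ℓ 1 / ℓ 0 = 2 ∨ ℓ 1 / ℓ 0 = 1 / 2 →
          β r - α r < 8 / |D| * ((ℓ 0)⁻¹ + (ℓ 1)⁻¹) + C / (r + 1))) ∧
    conspiracyE (ℓ 1 / ℓ 0) ≤ 4 / 3 ∧
    (conspiracyE (ℓ 1 / ℓ 0) = 4 / 3 ↔ ℓ 1 / ℓ 0 = 2 ∨ ℓ 1 / ℓ 0 = 1 / 2) := by
  have hθ : 0 < ℓ 1 / ℓ 0 := div_pos (hℓ 1) (hℓ 0)
  refine ⟨?_, conspiracyE_le hθ, conspiracyE_eq_iff hθ⟩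
  obtain ⟨α, β, hband, N, C, hw⟩ := exists_band_structure_with_widths hℓ hD
  obtain ⟨C₁, h₁⟩ := exists_const_of_eventually_le (f := fun r => -(β r - α r))
    (U := -(8 / (|D| * max (ℓ 0) (ℓ 1)))) (C := C) fun r hr => by linarith [(hw r hr).1]
  obtain ⟨C₂, h₂⟩ := exists_const_of_eventually_le (f := fun r => β r - α r)
    fun r hr => (hw r hr).2.1
  have h₃ : ∃ C₃ : ℝ, ∀ C', C₃ ≤ C' → ∀ r : ℕ, ℓ 1 / ℓ 0 = 2 ∨ ℓ 1 / ℓ 0 = 1 / 2 →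
      β r - α r < 8 / |D| * ((ℓ 0)⁻¹ + (ℓ 1)⁻¹) + C' / (r + 1) := by
    by_cases h : ℓ 1 / ℓ 0 = 2 ∨ ℓ 1 / ℓ 0 = 1 / 2
    · obtain ⟨C₃, h₃⟩ := exists_const_of_eventually_le (f := fun r => β r - α r)
        fun r hr => (hw r hr).2.2 h
      exact ⟨C₃, fun C' hC' r _ => h₃ C' hC' r⟩
    · exact ⟨0, fun _ _ _ h' => absurd h' h⟩
  obtain ⟨C₃, h₃⟩ := h₃
  refine ⟨α, β, hband, max C₁ (max C₂ C₃), fun r => ⟨?_, ?_, ?_⟩⟩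
  · have := h₁ (max C₁ (max C₂ C₃)) (le_max_left _ _) r
    linarith
  · exact h₂ _ ((le_max_left _ _).trans (le_max_right _ _)) r
  · exact h₃ _ ((le_max_right _ _).trans (le_max_right _ _)) r
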